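/- Let $n\ge 3$. A signed permutation of $\{\pm1,\dots,\pm n\}$ is a bijection $w$ with $w(-i)=-w(i)$; write $(\!(i\;j)\!)=(i\;j)(-i\;-j)$, $[i]=(i\;-i)$ and $[i_1\dots i_k]=(i_1\dots i_k\;-i_1\dots -i_k)$. Let $W(D_n)$ be the group generated by the reflections $(\!(i\;j)\!)$ with $1\le i<|j|\le n$, let $\ell(w)$ be the least number of reflections whose product is $w$, and let $v\le w$ if $\ell(w)=\ell(v)+\ell(v^{-1}w)$ (the absolute order). Let $c=s_1s_2\cdots s_n=[1\dots n-1][n]$, where $s_i=(\!(i\;i+1)\!)$ for $1\le i<n$ and $s_n=(\!(-(n-1)\;n)\!)$, and let $NC(D_n)=\{w\in W(D_n): w\le c\}$ with the absolute order. Let $\mathrm{Aut}(NC(D_n))$ be the group of its (poset, equivalently lattice) automorphisms. Then there are $l,r\in W(D_n)$ with $c=lr$ and $l^2=r^2=1$. For every such pair let $\varphi_l(w)=lw^{-1}l$, $\varphi_r(w)=rw^{-1}r$ and $\varphi_n(w)=[n]w[n]$; these are automorphisms of $NC(D_n)$. Let $D^*\le \mathrm{Aut}(NC(D_n))$ be the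 subgroup generated by $\varphi_l$ and $\varphi_r\circ\varphi_n$. Then: 1. $D^*$ is a dihedral group of order $4(n-1)$. 2. If $n\ne 4$, then $\mathrm{Aut}(NC(D_n))=D^*$. 3. If $n=4$, then $D^*$ (of order $12$) is a proper subgroup of $\mathrm{Aut}(NC(D_4))$. More precisely, there is an automorphism $\zeta\notin D^*$ of order $2$ that exchanges the two reflections in each of the pairs $$(\!(1\;2)\!)\leftrightarrow(\!(1\;4)\!),\quad (\!(2\;3)\!)\leftrightarrow(\!(3\;4)\!),\quad (\!(1\;-3)\!)\leftrightarrow(\!(-2\;4)\!),\quad (\!(-1\;4)\!)\leftrightarrow(\!(-3\;4)\!),\quad (\!(2\;-3)\!)\leftrightarrow(\!(1\;-2)\!)$$ and fixes $(\!(2\;4)\!)$ and $(\!(1\;3)\!)$. -/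

import Mathlib

noncomputable section

namespace NCD

/-! ### Word length with respect to a set of generators -/

section Length

variable {G : Type*} [Group G]

/-- The length of `w` with respect to `T`: the least number of letters of a word in the letters
`T` whose product is `w`. It is used only for `w` in the subgroup generated by a set `T` that is
closed under inverses, where such words exist. -/
def wordLength (T : Set G) (w : G) : ℕ :=
  sInf {k | ∃ L : List G, (∀ t ∈ L, t ∈ T) ∧ L.prod = w ∧ L.length = k}

theorem wordLength_le {T : Set G} (L : List G) (hL : ∀ t ∈ L, t ∈ T) :
    wordLength T L.prod ≤ L.length :=
  Nat.sInf_le ⟨L, hL, rfl, rfl⟩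

theorem exists_word {T : Set G} (hT : ∀ t ∈ T, t⁻¹ ∈ T) {w : G}
    (hw : w ∈ Subgroup.closure T) :
    ∃ L : List G, (∀ t ∈ L, t ∈ T) ∧ L.prod = w ∧ L.length = wordLength T w := by
  have hne : {k | ∃ L : List G, (∀ t ∈ L, t ∈ T) ∧ L.prod = w ∧ L.length = k}.Nonempty := by
    rw [← Subgroup.mem_toSubmonoid, Subgroup.closure_toSubmonoid] at hw
    obtain ⟨L, hL, hp⟩ := Submonoid.exists_list_of_mem_closure hw
    refine ⟨L.length, L, fun t ht => ?_, hp, rfl⟩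
    rcases hL t ht with h | h
    · exact h
    · simpa using hT _ h
  exact Nat.sInf_mem hne

theorem wordLength_one (T : Set G) : wordLength T 1 = 0 :=
  Nat.le_zero.mp (wordLength_le (T := T) [] (by simp))

theorem eq_one_of_wordLength {T : Set G} (hT : ∀ t ∈ T, t⁻¹ ∈ T) {w : G}
    (hw : w ∈ Subgroup.closure T) (h : wordLength T w = 0) : w = 1 := by
  obtain ⟨L, -, hp, hl⟩ := exists_word hT hw
  rw [h, List.length_eq_zero_iff] at hl
  rw [← hp, hl, List.prod_nil]

theorem wordLength_mul_le {T : Set G} (hT : ∀ t ∈ T, t⁻¹ ∈ T) {v w : G}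
    (hv : v ∈ Subgroup.closure T) (hw : w ∈ Subgroup.closure T) :
    wordLength T (v * w) ≤ wordLength T v + wordLength T w := by
  obtain ⟨L, hL, hp, hl⟩ := exists_word hT hv
  obtain ⟨M, hM, hq, hm⟩ := exists_word hT hw
  have h := wordLength_le (T := T) (L ++ M) (by
    intro t ht
    rcases List.mem_append.mp ht with h | h
    · exact hL t h
    · exact hM t h)
  rw [List.prod_append, List.length_append, hp, hq, hl, hm] at h
  exact h

theorem wordLength_inv_le {T : Set G} (hT : ∀ t ∈ T, t⁻¹ ∈ T) {w : G}
    (hw : w ∈ Subgroup.closure T) : wordLength T w⁻¹ ≤ wordLength T w := by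
  obtain ⟨L, hL, hp, hl⟩ := exists_word hT hw
  have h := wordLength_le (T := T) (L.map (fun x => x⁻¹)).reverse (by
    intro t ht
    simp only [List.mem_reverse, List.mem_map] at ht
    obtain ⟨s, hs, rfl⟩ := ht
    exact hT s (hL s hs))
  rw [← List.prod_inv_reverse, hp] at h
  simpa [hl] using h

theorem wordLength_inv {T : Set G} (hT : ∀ t ∈ T, t⁻¹ ∈ T) {w : G}
    (hw : w ∈ Subgroup.closure T) : wordLength T w⁻¹ = wordLength T w := by
  refine le_antisymm (wordLength_inv_le hT hw) ?_
  simpa using wordLength_inv_le hT (inv_mem hw)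

theorem conj_mem_closure {T : Set G} {g : G} (hg : ∀ t ∈ T, g * t * g⁻¹ ∈ T) {w : G}
    (hw : w ∈ Subgroup.closure T) : g * w * g⁻¹ ∈ Subgroup.closure T := by
  have h : Subgroup.closure T ≤ (Subgroup.closure T).comap (MulAut.conj g).toMonoidHom := by
    rw [Subgroup.closure_le]
    intro t ht
    exact Subgroup.subset_closure (hg t ht)
  exact h hw

theorem wordLength_conj_le {T : Set G} (hT : ∀ t ∈ T, t⁻¹ ∈ T) {g : G}
    (hg : ∀ t ∈ T, g * t * g⁻¹ ∈ T) {w : G} (hw : w ∈ Subgroup.closure T) :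
    wordLength T (g * w * g⁻¹) ≤ wordLength T w := by
  obtain ⟨L, hL, hp, hl⟩ := exists_word hT hw
  have h := wordLength_le (T := T) (L.map (MulAut.conj g)) (by
    intro t ht
    simp only [List.mem_map] at ht
    obtain ⟨s, hs, rfl⟩ := ht
    exact hg s (hL s hs))
  rw [← map_list_prod, hp, List.length_map, hl] at h
  exact h

/-- Conjugation by an involution that normalizes `T` preserves the length. -/
theorem wordLength_conj {T : Set G} (hT : ∀ t ∈ T, t⁻¹ ∈ T) {g : G} (h2 : g * g = 1)
    (hg : ∀ t ∈ T, g * t * g⁻¹ ∈ T) {w : G} (hw : w ∈ Subgroup.closure T) :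
    wordLength T (g * w * g⁻¹) = wordLength T w := by
  refine le_antisymm (wordLength_conj_le hT hg hw) ?_
  have h := wordLength_conj_le hT hg (conj_mem_closure hg hw)
  have hi : g⁻¹ = g := inv_eq_of_mul_eq_one_left h2
  have e : g * (g * w * g⁻¹) * g⁻¹ = w := by
    rw [hi, show g * (g * w * g) * g = (g * g) * w * (g * g) by group, h2]
    simp
  rwa [e] at h

end Length

/-! ### The Coxeter group of type `D` -/

/-- The paired cycle `((i j)) = (i j)(-i -j)`. -/
def paired (i j : ℤ) : Equiv.Perm ℤ := Equiv.swap i j * Equiv.swap (-i) (-j)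

/-- The balanced cycle `[i] = (i -i)`. -/
def balanced (i : ℤ) : Equiv.Perm ℤ := Equiv.swap i (-i)

/-- The reflections `((i j))`, `1 ≤ i < |j| ≤ n`, of the Coxeter group of type `D_n`. -/
def refl (n : ℕ) : Set (Equiv.Perm ℤ) :=
  {t | ∃ i j : ℤ, 1 ≤ i ∧ i < |j| ∧ |j| ≤ n ∧ t = paired i j}

/-- The Coxeter group `W(D_n)`, generated by its reflections. A signed permutation of
`{±1, …, ±n}` is regarded as a permutation of `ℤ` that fixes `0` and all `i` with `|i| > n`. -/
def W (n : ℕ) : Subgroup (Equiv.Perm ℤ) := Subgroup.closure (refl n)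

/-- The absolute length on `W(D_n)`. -/
def absLength (n : ℕ) (w : Equiv.Perm ℤ) : ℕ := wordLength (refl n) w

/-- The relation of the absolute order on `W(D_n)`. -/
def AbsLE (n : ℕ) (v w : Equiv.Perm ℤ) : Prop :=
  absLength n w = absLength n v + absLength n (v⁻¹ * w)

/-- The standard Coxeter element `c = s₁ s₂ ⋯ sₙ = [1 … n-1][n]`, where `sᵢ = ((i i+1))` for
`1 ≤ i < n` and `sₙ = ((-(n-1) n))`. -/
def cox (n : ℕ) : Equiv.Perm ℤ :=
  ((List.range (n - 1)).map fun k : ℕ => paired ((k : ℤ) + 1) ((k : ℤ) + 2)).prod *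
    paired (-((n : ℤ) - 1)) n

/-- The non-crossing partitions `NC(D_n)`: the elements of `W(D_n)` below `c`. -/
def NC (n : ℕ) : Type := {w : Equiv.Perm ℤ // w ∈ W n ∧ AbsLE n w (cox n)}

theorem paired_apply_neg {i j : ℤ} (hi : i ≠ 0) (hj : j ≠ 0) (x : ℤ) : paired i j (-x) = -paired i j x := by
  simp only [paired, Equiv.Perm.mul_apply, Equiv.swap_apply_def]
  split_ifs <;> omega

theorem paired_inv {i j : ℤ} (h1 : i ≠ 0) (h2 : j ≠ 0) (h3 : i ≠ j) (h4 : i ≠ -j) :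
    (paired i j)⁻¹ = paired i j := by
  apply inv_eq_of_mul_eq_one_left
  ext x
  simp only [paired, Equiv.Perm.mul_apply, Equiv.swap_apply_def, Equiv.Perm.one_apply]
  split_ifs <;> omega

theorem refl_inv {n : ℕ} : ∀ t ∈ refl n, t⁻¹ ∈ refl n := by
  rintro t ⟨i, j, h1, h2, h3, rfl⟩
  have : i ≠ j ∧ i ≠ -j ∧ j ≠ 0 := by
    rcases abs_cases j with h | h <;> omega
  rw [paired_inv (by omega) this.2.2 this.1 this.2.1]
  exact ⟨i, j, h1, h2, h3, rfl⟩

theorem paired_neg (i j : ℤ) (h1 : i ≠ 0) (h2 : j ≠ 0) (h3 : i ≠ j) (h4 : i ≠ -j) :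
    paired (-i) (-j) = paired i j := by
  ext x
  simp only [paired, Equiv.Perm.mul_apply, Equiv.swap_apply_def]
  split_ifs <;> omega

theorem paired_comm (i j : ℤ) : paired i j = paired j i := by
  simp only [paired, Equiv.swap_comm]

/-- Up to equivalence of cycles, every `((i j))` with `i ≠ ±j` is a reflection. -/
theorem paired_mem_refl {n : ℕ} {i j : ℤ} (hi : i ≠ 0) (hj : j ≠ 0) (hi' : |i| ≤ n)
    (hj' : |j| ≤ n) (h3 : i ≠ j) (h4 : i ≠ -j) : paired i j ∈ refl n := by
  have key : ∀ i j : ℤ, i ≠ 0 → j ≠ 0 → |i| ≤ n → |j| ≤ n → i ≠ j → i ≠ -j → |i| < |j| →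
      paired i j ∈ refl n := by
    intro i j hi hj hi' hj' h3 h4 h
    rcases lt_or_gt_of_ne hi with hn | hp
    · refine ⟨-i, -j, by omega, ?_, ?_, (paired_neg i j hi hj h3 h4).symm⟩
      · rw [abs_neg]; rwa [abs_of_neg hn] at h
      · rwa [abs_neg]
    · exact ⟨i, j, by omega, by rwa [abs_of_pos hp] at h, hj', rfl⟩
  rcases lt_trichotomy |i| |j| with h | h | h
  · exact key i j hi hj hi' hj' h3 h4 h
  · rcases abs_eq_abs.mp h with h | h
    · exact absurd h h3
    · exact absurd h h4
  · rw [paired_comm]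
    exact key j i hj hi hj' hi' (Ne.symm h3) (by omega) h

theorem conj_paired (g : Equiv.Perm ℤ) (hg : ∀ x, g (-x) = -g x) (i j : ℤ) :
    g * paired i j * g⁻¹ = paired (g i) (g j) := by
  have h : ∀ a b : ℤ, g * Equiv.swap a b * g⁻¹ = Equiv.swap (g a) (g b) := fun a b => by
    rw [Equiv.mul_swap_eq_swap_mul, mul_inv_cancel_right]
  calc g * paired i j * g⁻¹
      = (g * Equiv.swap i j * g⁻¹) * (g * Equiv.swap (-i) (-j) * g⁻¹) := by
        simp only [paired]; group
    _ = paired (g i) (g j) := by rw [h, h, hg, hg]; rfl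

theorem paired_commute {a b : ℤ} (ha : 0 < a) (hb : 0 < b) (hab : a ≠ b) :
    paired (-a) b * paired a b = paired a b * paired (-a) b := by
  have g1 : paired a b a = b := by
    rw [paired, Equiv.Perm.mul_apply,
      Equiv.swap_apply_of_ne_of_ne (a := -a) (by omega) (by omega), Equiv.swap_apply_left]
  have g2 : paired a b b = a := by
    rw [paired, Equiv.Perm.mul_apply,
      Equiv.swap_apply_of_ne_of_ne (a := -a) (by omega) (by omega), Equiv.swap_apply_right]
  have hg := paired_apply_neg (i := a) (j := b) (by omega) (by omega)
  have h := conj_paired (paired a b) hg (-a) b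
  rw [hg, g1, g2, ← paired_neg (-b) a (by omega) (by omega) (by omega) (by omega), neg_neg,
    paired_comm b (-a)] at h
  exact (mul_inv_eq_iff_eq_mul.mp h).symm

/-- `g` is a signed permutation of `{±1, …, ±n}`. -/
def IsSigned (n : ℕ) (g : Equiv.Perm ℤ) : Prop :=
  (∀ x, g (-x) = -g x) ∧ ∀ x, (n : ℤ) < |x| → g x = x

theorem conj_refl {n : ℕ} {g : Equiv.Perm ℤ} (hg : IsSigned n g) :
    ∀ t ∈ refl n, g * t * g⁻¹ ∈ refl n := by
  rintro t ⟨i, j, h1, h2, h3, rfl⟩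
  have h0 : g 0 = 0 := by have := hg.1 0; simp only [neg_zero] at this; omega
  have hle : ∀ x : ℤ, |x| ≤ n → |g x| ≤ n := by
    intro x hx
    by_contra h
    have h' := hg.2 (g x) (by omega)
    rw [g.injective h'] at h
    exact h hx
  have hj : i ≠ j ∧ i ≠ -j ∧ j ≠ 0 ∧ |i| ≤ n := by
    rcases abs_cases j with h | h <;> rcases abs_cases i with h' | h' <;> omega
  rw [conj_paired g hg.1]
  refine paired_mem_refl ?_ ?_ (hle i hj.2.2.2) (hle j h3) ?_ ?_
  · rw [← h0]; exact g.injective.ne (by omega)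
  · rw [← h0]; exact g.injective.ne hj.2.2.1
  · exact g.injective.ne hj.1
  · rw [← hg.1]; exact g.injective.ne hj.2.1

theorem isSigned_of_mem {n : ℕ} {g : Equiv.Perm ℤ} (hg : g ∈ W n) : IsSigned n g := by
  induction hg using Subgroup.closure_induction with
  | mem t ht =>
    obtain ⟨i, j, h1, h2, h3, rfl⟩ := ht
    have hj : j ≠ 0 := by rcases abs_cases j with h | h <;> omega
    refine ⟨paired_apply_neg (by omega) hj, fun x hx => ?_⟩
    have : x ≠ i ∧ x ≠ -i ∧ x ≠ j ∧ x ≠ -j := by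
      rcases abs_cases j with h | h <;> rcases abs_cases x with h' | h' <;> omega
    simp only [paired, Equiv.Perm.mul_apply]
    rw [Equiv.swap_apply_of_ne_of_ne this.2.1 this.2.2.2,
      Equiv.swap_apply_of_ne_of_ne this.1 this.2.2.1]
  | one => exact ⟨fun x => rfl, fun x _ => rfl⟩
  | mul a b _ _ ha hb =>
    refine ⟨fun x => ?_, fun x hx => ?_⟩
    · simp only [Equiv.Perm.mul_apply, hb.1, ha.1]
    · simp only [Equiv.Perm.mul_apply, hb.2 x hx, ha.2 x hx]
  | inv a _ ha =>
    refine ⟨fun x => ?_, fun x hx => ?_⟩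
    · rw [Equiv.Perm.inv_eq_iff_eq, ha.1, ← Equiv.Perm.mul_apply, mul_inv_cancel,
        Equiv.Perm.one_apply]
    · rw [Equiv.Perm.inv_eq_iff_eq, ha.2 x hx]

/-- `NC(D_n)` is partially ordered by the absolute order. -/
instance (n : ℕ) : PartialOrder (NC n) where
  le v w := AbsLE n v.1 w.1
  le_refl v := by simp [AbsLE, absLength, wordLength_one]
  le_trans u v w huv hvw := by
    have h1 := wordLength_mul_le refl_inv (mul_mem (inv_mem u.2.1) v.2.1)
      (mul_mem (inv_mem v.2.1) w.2.1)
    have h2 := wordLength_mul_le refl_inv u.2.1 (mul_mem (inv_mem u.2.1) w.2.1)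
    rw [mul_inv_cancel_left] at h2
    rw [show (u.1⁻¹ * v.1) * (v.1⁻¹ * w.1) = u.1⁻¹ * w.1 by group] at h1
    simp only [AbsLE, absLength] at huv hvw ⊢
    omega
  le_antisymm v w h1 h2 := by
    simp only [AbsLE, absLength] at h1 h2
    have h : wordLength (refl n) (v.1⁻¹ * w.1) = 0 := by omega
    have := eq_one_of_wordLength refl_inv (mul_mem (inv_mem v.2.1) w.2.1) h
    exact Subtype.ext (inv_mul_eq_one.mp this)

/-! ### The automorphisms -/

theorem absLE_conj {n : ℕ} {g v w : Equiv.Perm ℤ} (hg : IsSigned n g) (h2 : g * g = 1)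
    (hv : v ∈ W n) (hw : w ∈ W n) (h : AbsLE n v w) :
    AbsLE n (g * v * g⁻¹) (g * w * g⁻¹) := by
  simp only [AbsLE, absLength] at h ⊢
  rw [show (g * v * g⁻¹)⁻¹ * (g * w * g⁻¹) = g * (v⁻¹ * w) * g⁻¹ by group,
    wordLength_conj refl_inv h2 (conj_refl hg) hv,
    wordLength_conj refl_inv h2 (conj_refl hg) hw,
    wordLength_conj refl_inv h2 (conj_refl hg) (mul_mem (inv_mem hv) hw), h]

theorem absLE_inv {n : ℕ} {v w : Equiv.Perm ℤ} (hv : v ∈ W n) (hw : w ∈ W n)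
    (h : AbsLE n v w) : AbsLE n v⁻¹ w⁻¹ := by
  simp only [AbsLE, absLength] at h ⊢
  have hvw : v⁻¹ * w ∈ Subgroup.closure (refl n) := mul_mem (inv_mem hv) hw
  have h1 : wordLength (refl n) (v⁻¹⁻¹ * w⁻¹) ≤ wordLength (refl n) (v⁻¹ * w) := by
    rw [← wordLength_inv refl_inv hvw,
      show v⁻¹⁻¹ * w⁻¹ = v * (v⁻¹ * w)⁻¹ * v⁻¹ by group]
    exact wordLength_conj_le refl_inv (conj_refl (isSigned_of_mem hv)) (inv_mem hvw)
  have h2 := wordLength_mul_le refl_inv (inv_mem hv)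
    (mul_mem (inv_mem (inv_mem hv)) (inv_mem hw))
  rw [mul_inv_cancel_left] at h2
  rw [wordLength_inv refl_inv hv, wordLength_inv refl_inv hw] at *
  omega

theorem cox_mem {n : ℕ} (hn : 2 ≤ n) : cox n ∈ W n := by
  refine mul_mem (list_prod_mem fun t ht => ?_) (Subgroup.subset_closure ?_)
  · simp only [List.mem_map, List.mem_range] at ht
    obtain ⟨k, hk, rfl⟩ := ht
    refine Subgroup.subset_closure ⟨_, _, ?_, ?_, ?_, rfl⟩
    · omega
    · rw [abs_of_pos (by omega)]; omega
    · rw [abs_of_pos (by omega)]; omega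
  · refine paired_mem_refl (by omega) (by omega) ?_ ?_ (by omega) (by omega)
    · rw [abs_neg, abs_of_pos (by omega)]; omega
    · rw [abs_of_pos (by omega)]

/-- The bipartitions `c = l r`, `l² = r² = 1`, of the Coxeter element. -/
structure IsBipartition (n : ℕ) (l r : Equiv.Perm ℤ) : Prop where
  left_mem : l ∈ W n
  right_mem : r ∈ W n
  left_sq : l * l = 1
  right_sq : r * r = 1
  mul_eq : l * r = cox n

theorem IsBipartition.cox_mem {n : ℕ} {l r : Equiv.Perm ℤ} (h : IsBipartition n l r) :
    cox n ∈ W n := h.mul_eq ▸ mul_mem h.left_mem h.right_mem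

theorem IsBipartition.conj_left {n : ℕ} {l r : Equiv.Perm ℤ} (h : IsBipartition n l r) :
    l * (cox n)⁻¹ * l⁻¹ = cox n := by
  have hr : r⁻¹ = r := inv_eq_of_mul_eq_one_left h.right_sq
  have hl : l⁻¹ = l := inv_eq_of_mul_eq_one_left h.left_sq
  rw [← h.mul_eq, mul_inv_rev, hr, hl, mul_assoc, mul_assoc r l l, h.left_sq, mul_one]

theorem IsBipartition.conj_right {n : ℕ} {l r : Equiv.Perm ℤ} (h : IsBipartition n l r) :
    r * (cox n)⁻¹ * r⁻¹ = cox n := by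
  have hr : r⁻¹ = r := inv_eq_of_mul_eq_one_left h.right_sq
  have hl : l⁻¹ = l := inv_eq_of_mul_eq_one_left h.left_sq
  rw [← h.mul_eq, mul_inv_rev, hr, hl, ← mul_assoc r r l, h.right_sq, one_mul]

theorem conj_inv_mem {n : ℕ} {g : Equiv.Perm ℤ} (hg : g ∈ W n) (h2 : g * g = 1)
    (hc : cox n ∈ W n) (hgc : g * (cox n)⁻¹ * g⁻¹ = cox n) (w : NC n) :
    g * w.1⁻¹ * g⁻¹ ∈ W n ∧ AbsLE n (g * w.1⁻¹ * g⁻¹) (cox n) := by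
  refine ⟨mul_mem (mul_mem hg (inv_mem w.2.1)) (inv_mem hg), ?_⟩
  have h := absLE_conj (isSigned_of_mem hg) h2 (inv_mem w.2.1) (inv_mem hc)
    (absLE_inv w.2.1 hc w.2.2)
  rwa [hgc] at h

/-- The automorphism `w ↦ g w⁻¹ g = g w⁻¹ g⁻¹` of `NC(D_n)`, for an involution `g` that inverts
the Coxeter element. -/
def conjInv {n : ℕ} {g : Equiv.Perm ℤ} (hg : g ∈ W n) (h2 : g * g = 1)
    (hc : cox n ∈ W n) (hgc : g * (cox n)⁻¹ * g⁻¹ = cox n) : NC n ≃o NC n :=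
  have inv : ∀ w : Equiv.Perm ℤ, g * (g * w⁻¹ * g⁻¹)⁻¹ * g⁻¹ = w := fun w => by
    have hi : g⁻¹ = g := inv_eq_of_mul_eq_one_left h2
    rw [show g * (g * w⁻¹ * g⁻¹)⁻¹ * g⁻¹ = (g * g) * w * (g * g)⁻¹ by group, h2]
    simp
  have mono : ∀ v w : NC n, v ≤ w →
      AbsLE n (g * v.1⁻¹ * g⁻¹) (g * w.1⁻¹ * g⁻¹) := fun v w h =>
    absLE_conj (isSigned_of_mem hg) h2 (inv_mem v.2.1) (inv_mem w.2.1)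
      (absLE_inv v.2.1 w.2.1 h)
  { toFun := fun w => ⟨g * w.1⁻¹ * g⁻¹, conj_inv_mem hg h2 hc hgc w⟩
    invFun := fun w => ⟨g * w.1⁻¹ * g⁻¹, conj_inv_mem hg h2 hc hgc w⟩
    left_inv := fun w => Subtype.ext (inv w.1)
    right_inv := fun w => Subtype.ext (inv w.1)
    map_rel_iff' := by
      intro v w
      refine ⟨fun h => ?_, fun h => mono v w h⟩
      have h' := mono ⟨_, conj_inv_mem hg h2 hc hgc v⟩ ⟨_, conj_inv_mem hg h2 hc hgc w⟩ h
      simp only [inv] at h'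
      exact h' }

/-- The automorphism `φ_l : w ↦ l w⁻¹ l` of `NC(D_n)`. -/
def phiL {n : ℕ} {l r : Equiv.Perm ℤ} (h : IsBipartition n l r) : NC n ≃o NC n :=
  conjInv h.left_mem h.left_sq h.cox_mem h.conj_left

/-- The automorphism `φ_r : w ↦ r w⁻¹ r` of `NC(D_n)`. -/
def phiR {n : ℕ} {l r : Equiv.Perm ℤ} (h : IsBipartition n l r) : NC n ≃o NC n :=
  conjInv h.right_mem h.right_sq h.cox_mem h.conj_right

theorem coe_phiL {n : ℕ} {l r : Equiv.Perm ℤ} (h : IsBipartition n l r) (w : NC n) :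
    (phiL h w).1 = l * w.1⁻¹ * l := by
  change l * w.1⁻¹ * l⁻¹ = _
  rw [inv_eq_of_mul_eq_one_left h.left_sq]

theorem coe_phiR {n : ℕ} {l r : Equiv.Perm ℤ} (h : IsBipartition n l r) (w : NC n) :
    (phiR h w).1 = r * w.1⁻¹ * r := by
  change r * w.1⁻¹ * r⁻¹ = _
  rw [inv_eq_of_mul_eq_one_left h.right_sq]

theorem balanced_sq (i : ℤ) : balanced i * balanced i = 1 := Equiv.swap_mul_self _ _

theorem balanced_inv (i : ℤ) : (balanced i)⁻¹ = balanced i :=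
  inv_eq_of_mul_eq_one_left (balanced_sq i)

theorem balanced_signed {n : ℕ} (hn : 2 ≤ n) : IsSigned n (balanced n) := by
  refine ⟨fun x => ?_, fun x hx => ?_⟩
  · simp only [balanced, Equiv.swap_apply_def]
    split_ifs <;> omega
  · have : x ≠ n ∧ x ≠ -n := by rcases abs_cases x with h | h <;> omega
    exact Equiv.swap_apply_of_ne_of_ne this.1 this.2

theorem balanced_conj_cox {n : ℕ} (hn : 2 ≤ n) :
    balanced n * cox n * (balanced n)⁻¹ = cox n := by
  obtain ⟨m, rfl⟩ : ∃ m, n = m + 2 := ⟨n - 2, by omega⟩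
  have hs := balanced_signed hn
  set b := balanced ((m + 2 : ℕ) : ℤ) with hb
  have b1 : b ((m + 2 : ℕ) : ℤ) = -((m + 2 : ℕ) : ℤ) := Equiv.swap_apply_left _ _
  have b2 : ∀ x : ℤ, |x| < m + 2 → b x = x := fun x hx => by
    refine Equiv.swap_apply_of_ne_of_ne ?_ ?_ <;>
      rcases abs_cases x with h | h <;> push_cast <;> omega
  set P := ((List.range m).map fun k : ℕ => paired ((k : ℤ) + 1) ((k : ℤ) + 2)).prod with hP
  have hPb : Commute b P := by
    refine Commute.list_prod_right _ _ fun t ht => ?_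
    simp only [List.mem_map, List.mem_range] at ht
    obtain ⟨k, hk, rfl⟩ := ht
    have h := conj_paired b hs.1 ((k : ℤ) + 1) ((k : ℤ) + 2)
    rw [b2 _ (by rw [abs_of_pos] <;> omega), b2 _ (by rw [abs_of_pos] <;> omega)] at h
    exact mul_inv_eq_iff_eq_mul.mp h
  have hc : cox (m + 2) = P * (paired ((m : ℤ) + 1) ((m : ℤ) + 2) *
      paired (-((m : ℤ) + 1)) ((m : ℤ) + 2)) := by
    have e1 : (-(((m + 2 : ℕ) : ℤ) - 1)) = -((m : ℤ) + 1) := by push_cast; ring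
    have e2 : ((m + 2 : ℕ) : ℤ) = (m : ℤ) + 2 := by push_cast; ring
    rw [cox, e1, e2, show m + 2 - 1 = m + 1 by omega, List.range_succ]
    rw [List.map_append, List.prod_append, ← hP, List.map_singleton, List.prod_singleton, mul_assoc]
  have e2 : ((m + 2 : ℕ) : ℤ) = (m : ℤ) + 2 := by push_cast; ring
  have c1 := conj_paired b hs.1 ((m : ℤ) + 1) ((m : ℤ) + 2)
  have c2 := conj_paired b hs.1 (-((m : ℤ) + 1)) ((m : ℤ) + 2)
  rw [hs.1] at c2
  rw [e2] at b1
  have b3 := b2 ((m : ℤ) + 1) (by rw [abs_of_pos] <;> omega)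
  rw [b1, b3] at c1 c2
  rw [paired_neg _ _ (by omega) (by omega) (by omega) (by omega)] at c2
  have c1' : paired ((m : ℤ) + 1) (-((m : ℤ) + 2)) = paired (-((m : ℤ) + 1)) ((m : ℤ) + 2) := by
    rw [← paired_neg _ _ (by omega) (by omega) (by omega) (by omega), neg_neg]
  rw [c1'] at c1
  have hcomm : paired (-((m : ℤ) + 1)) ((m : ℤ) + 2) * paired ((m : ℤ) + 1) ((m : ℤ) + 2) =
      paired ((m : ℤ) + 1) ((m : ℤ) + 2) * paired (-((m : ℤ) + 1)) ((m : ℤ) + 2) := by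
    exact paired_commute (by omega) (by omega) (by omega)
  rw [hc]
  calc b * (P * (paired ((m : ℤ) + 1) ((m : ℤ) + 2) *
      paired (-((m : ℤ) + 1)) ((m : ℤ) + 2))) * b⁻¹
      = (b * P * b⁻¹) * ((b * paired ((m : ℤ) + 1) ((m : ℤ) + 2) * b⁻¹) *
        (b * paired (-((m : ℤ) + 1)) ((m : ℤ) + 2) * b⁻¹)) := by group
    _ = _ := by
      rw [c1, c2, hcomm, hPb.eq, mul_inv_cancel_right]

theorem conj_balanced_mem {n : ℕ} (hn : 2 ≤ n) (w : NC n) :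
    balanced n * w.1 * (balanced n)⁻¹ ∈ W n ∧
      AbsLE n (balanced n * w.1 * (balanced n)⁻¹) (cox n) := by
  refine ⟨conj_mem_closure (conj_refl (balanced_signed hn)) w.2.1, ?_⟩
  have h := absLE_conj (balanced_signed hn) (balanced_sq n) w.2.1 (cox_mem hn) w.2.2
  rwa [balanced_conj_cox hn] at h

/-- The automorphism `φ_n : w ↦ [n] w [n] = [n] w [n]⁻¹` of `NC(D_n)`. -/
def phiN {n : ℕ} (hn : 2 ≤ n) : NC n ≃o NC n :=
  have inv : ∀ w : Equiv.Perm ℤ,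
      balanced n * (balanced n * w * (balanced n)⁻¹) * (balanced n)⁻¹ = w := fun w => by
    rw [show balanced n * (balanced n * w * (balanced n)⁻¹) * (balanced n)⁻¹ =
      (balanced n * balanced n) * w * (balanced n * balanced n)⁻¹ by group, balanced_sq]
    simp
  have mono : ∀ v w : NC n, v ≤ w → AbsLE n (balanced n * v.1 * (balanced n)⁻¹)
      (balanced n * w.1 * (balanced n)⁻¹) := fun v w h =>
    absLE_conj (balanced_signed hn) (balanced_sq n) v.2.1 w.2.1 h
  { toFun := fun w => ⟨balanced n * w.1 * (balanced n)⁻¹, conj_balanced_mem hn w⟩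
    invFun := fun w => ⟨balanced n * w.1 * (balanced n)⁻¹, conj_balanced_mem hn w⟩
    left_inv := fun w => Subtype.ext (inv w.1)
    right_inv := fun w => Subtype.ext (inv w.1)
    map_rel_iff' := by
      intro v w
      refine ⟨fun h => ?_, fun h => mono v w h⟩
      have h' := mono ⟨_, conj_balanced_mem hn v⟩ ⟨_, conj_balanced_mem hn w⟩ h
      simp only [inv] at h'
      exact h' }

theorem coe_phiN {n : ℕ} (hn : 2 ≤ n) (w : NC n) :
    (phiN hn w).1 = balanced n * w.1 * balanced n := by
  change balanced n * w.1 * (balanced n)⁻¹ = _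
  rw [balanced_inv]

/-- The group `D*` of automorphisms of `NC(D_n)` generated by `φ_l` and `φ_r ∘ φ_n`. The
multiplication of automorphisms is composition. -/
def DStar {n : ℕ} (hn : 2 ≤ n) {l r : Equiv.Perm ℤ} (h : IsBipartition n l r) :
    Subgroup (NC n ≃o NC n) :=
  Subgroup.closure {phiL h, phiR h * phiN hn}

/-- The pairs of reflections of `W(D_4)` that the exotic automorphism of `NC(D_4)` exchanges. -/
def exoticPairs : List (Equiv.Perm ℤ × Equiv.Perm ℤ) :=
  [(paired 1 2, paired 1 4), (paired 2 3, paired 3 4), (paired 1 (-3), paired (-2) 4),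
    (paired (-1) 4, paired (-3) 4), (paired 2 4, paired 2 4), (paired 2 (-3), paired 1 (-2)),
    (paired 1 3, paired 1 3)]

end NCD

end

noncomputable section

namespace NCD

open Module

/-! ### Signed permutations and signed vectors -/

/-! W(D_n) acts on ℚ^n, realised as `vec n`. By Carter's lemma (`absLength_add`) the absolute length
of w is the codimension of Fix w, so a reflection lies below w exactly when its hyperplane contains
Fix w. Since Fix c = 0, all reflections lie below c: they are the atoms of NC(D_n). An element of
NC(D_n) is determined by its fixed space (`ext_fixed`, an argument of Brady and Watt), and an
automorphism is determined by its action on the atoms (`eq_one_of_fix_atoms`).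

Write the long cycle of c as p_0, p_1, …, with p_{k+n-1} = -p_k. The reflections are the chords
((p_i p_j)) and the spokes ((p_i n)). Two invariant relations on atoms are used: compatibility (a
common upper bound of rank two) and triples (three atoms below one element of rank two).
Compatibility is read off from the lines Fix(sc) and Fix(tc) (`comp_iff`), which are explicit
(`chord_fixed`, `spoke_fixed`); in a triple each atom is the conjugate of a second by the third
(`triangle`).

For n ≠ 4 the sides ((p_i p_{i+1})) are exactly the atoms with a unique incompatible atom, and the
spokes are then recognised by their relations with the sides. Hence an automorphism permutes the
2(n-1) spokes and preserves adjacency, where neighbours are two spokes that form a triple with a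
side. If it fixes two neighbours, it is trivial. So the automorphism group embeds in the symmetries
of a 2(n-1)-gon, and D* supplies all of these: φ_l φ_r φ_n is conjugation by c[n], which turns the
spokes by one step, and φ_l reverses their order.

For n = 4 a spoke, too, has a unique incompatible atom, and the argument breaks down. The root
system D_4 has symmetries beyond the signed permutations. One of them, the involution `spin`,
conjugates c to its inverse, so w ↦ g w⁻¹ g⁻¹ with g = `spin` is an automorphism. It takes the spoke
((1 4)) to the side ((1 2)), whereas D* preserves the spokes. -/

theorem perm_apply_inv (g : Equiv.Perm ℤ) (x : ℤ) : g (g⁻¹ x) = x := g.apply_symm_apply x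

theorem perm_inv_apply (g : Equiv.Perm ℤ) (x : ℤ) : g⁻¹ (g x) = x := g.symm_apply_apply x

theorem IsSigned.map_zero {n : ℕ} {g : Equiv.Perm ℤ} (hg : IsSigned n g) : g 0 = 0 := by
  have := hg.1 0
  simp only [neg_zero] at this
  omega

theorem IsSigned.inv {n : ℕ} {g : Equiv.Perm ℤ} (hg : IsSigned n g) : IsSigned n g⁻¹ := by
  refine ⟨fun x => ?_, fun x hx => ?_⟩
  · rw [Equiv.Perm.inv_eq_iff_eq, hg.1, perm_apply_inv]
  · rw [Equiv.Perm.inv_eq_iff_eq, hg.2 x hx]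

theorem IsSigned.abs_le {n : ℕ} {g : Equiv.Perm ℤ} (hg : IsSigned n g) {x : ℤ} (hx : |x| ≤ n) :
    |g x| ≤ n := by
  by_contra h
  have h' := hg.2 (g x) (by omega)
  rw [g.injective h'] at h
  exact h hx

theorem IsSigned.abs_le_iff {n : ℕ} {g : Equiv.Perm ℤ} (hg : IsSigned n g) {x : ℤ} :
    |g x| ≤ n ↔ |x| ≤ n :=
  ⟨fun h => by simpa using hg.inv.abs_le h, hg.abs_le⟩

theorem IsSigned.ne_zero {n : ℕ} {g : Equiv.Perm ℤ} (hg : IsSigned n g) {x : ℤ} (hx : x ≠ 0) :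
    g x ≠ 0 := fun h => hx (g.injective (h.trans hg.map_zero.symm))

/-- The odd functions on `ℤ` with support in `[-n, n]`, the space on which the signed permutations
of `{±1, …, ±n}` act. -/
def vec (n : ℕ) : Submodule ℚ (ℤ → ℚ) where
  carrier := {x | (∀ i, x (-i) = -x i) ∧ ∀ i : ℤ, (n : ℤ) < |i| → x i = 0}
  add_mem' := fun {a b} ha hb =>
    ⟨fun i => by simp only [Pi.add_apply, ha.1, hb.1]; ring,
      fun i hi => by simp only [Pi.add_apply, ha.2 i hi, hb.2 i hi, add_zero]⟩
  zero_mem' := ⟨fun i => by simp, fun i _ => rfl⟩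
  smul_mem' := fun c a ha =>
    ⟨fun i => by simp only [Pi.smul_apply, ha.1, smul_neg],
      fun i hi => by simp only [Pi.smul_apply, ha.2 i hi, smul_zero]⟩

/-- The vectors fixed by a signed permutation. -/
def fixed (n : ℕ) (w : Equiv.Perm ℤ) : Submodule ℚ (ℤ → ℚ) where
  carrier := {x | x ∈ vec n ∧ ∀ i, x (w i) = x i}
  add_mem' := fun {a b} ha hb =>
    ⟨add_mem ha.1 hb.1, fun i => by simp only [Pi.add_apply, ha.2, hb.2]⟩
  zero_mem' := ⟨zero_mem _, fun i => rfl⟩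
  smul_mem' := fun c a ha =>
    ⟨Submodule.smul_mem _ c ha.1, fun i => by simp only [Pi.smul_apply, ha.2]⟩

theorem fixed_le_vec (n : ℕ) (w : Equiv.Perm ℤ) : fixed n w ≤ vec n := fun _ h => h.1

theorem vec_zero {n : ℕ} {x : ℤ → ℚ} (hx : x ∈ vec n) : x 0 = 0 := by
  have := hx.1 0
  simp only [neg_zero] at this
  linarith

theorem vec_comp {n : ℕ} {w : Equiv.Perm ℤ} (hw : IsSigned n w) {x : ℤ → ℚ} (hx : x ∈ vec n) :
    (fun k => x (w k)) ∈ vec n := by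
  refine ⟨fun i => ?_, fun i hi => ?_⟩
  · simp only [hw.1, hx.1]
  · simp only [hw.2 i hi, hx.2 i hi]

/-- A vector is determined by its first `n` coordinates. -/
theorem vec_ext {n : ℕ} {x : ℤ → ℚ} (hx : x ∈ vec n) (h : ∀ k : ℤ, 1 ≤ k → k ≤ n → x k = 0) :
    x = 0 := by
  funext k
  rcases le_or_gt |k| n with hk | hk
  · rcases lt_trichotomy k 0 with h0 | h0 | h0
    · have := h (-k) (by omega) (by rwa [abs_of_neg h0] at hk)
      rw [hx.1] at this
      simpa using this
    · rw [h0, vec_zero hx]; rfl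
    · exact h k (by omega) (by rwa [abs_of_pos h0] at hk)
  · exact hx.2 k hk

instance vec_finite (n : ℕ) : FiniteDimensional ℚ (vec n) := by
  let f : vec n →ₗ[ℚ] (Fin n → ℚ) :=
    (LinearMap.funLeft ℚ ℚ (fun k : Fin n => ((k : ℕ) : ℤ) + 1)) ∘ₗ (vec n).subtype
  refine FiniteDimensional.of_injective f ?_
  rw [← LinearMap.ker_eq_bot, LinearMap.ker_eq_bot']
  rintro ⟨x, hx⟩ h
  refine Subtype.ext (vec_ext hx fun k hk hk' => ?_)
  have := congrFun h ⟨(k - 1).toNat, by omega⟩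
  have e : (((k - 1).toNat : ℕ) : ℤ) + 1 = k := by omega
  change x ((((k - 1).toNat : ℕ) : ℤ) + 1) = 0 at this
  rwa [e] at this

instance fixed_finite (n : ℕ) (w : Equiv.Perm ℤ) : FiniteDimensional ℚ (fixed n w) :=
  Submodule.finiteDimensional_of_le (fixed_le_vec n w)

/-- The basis vector `e_k - e_{-k}`. -/
def unitVec (k : ℤ) : ℤ → ℚ := Pi.single k 1 - Pi.single (-k) 1

theorem unitVec_apply (k i : ℤ) :
    unitVec k i = (if i = k then 1 else 0) - (if i = -k then 1 else 0) := by
  simp [unitVec, Pi.single_apply]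

theorem unitVec_neg (k : ℤ) : unitVec (-k) = -unitVec k := by
  simp [unitVec]

theorem unitVec_mem {n : ℕ} {k : ℤ} (hk : |k| ≤ n) : unitVec k ∈ vec n := by
  refine ⟨fun i => ?_, fun i hi => ?_⟩
  · simp only [unitVec_apply, neg_eq_iff_eq_neg, neg_neg]
    ring
  · have : i ≠ k ∧ i ≠ -k := by
      constructor <;> rintro rfl <;> [skip; rw [abs_neg] at hi] <;> omega
    simp [unitVec_apply, this]

theorem unitVec_comp (w : Equiv.Perm ℤ) (hw : ∀ x, w (-x) = -w x) (k i : ℤ) :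
    unitVec k (w⁻¹ i) = unitVec (w k) i := by
  simp only [unitVec_apply, Equiv.Perm.inv_eq_iff_eq, hw]

/-- The standard scalar product, up to a factor of two. -/
def pairing (n : ℕ) (x z : ℤ → ℚ) : ℚ := ∑ k ∈ Finset.Icc (-(n : ℤ)) n, x k * z k

theorem mem_Icc_abs {n : ℕ} {k : ℤ} : k ∈ Finset.Icc (-(n : ℤ)) n ↔ |k| ≤ n := by
  rw [Finset.mem_Icc, abs_le]

theorem pairing_comp {n : ℕ} {w : Equiv.Perm ℤ} (hw : IsSigned n w) (x z : ℤ → ℚ) :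
    pairing n (fun k => x (w k)) (fun k => z (w k)) = pairing n x z :=
  Finset.sum_equiv w (fun k => by rw [mem_Icc_abs, mem_Icc_abs, hw.abs_le_iff]) fun k _ => rfl

theorem sum_smul_unitVec {n : ℕ} {z : ℤ → ℚ} (hz : z ∈ vec n) :
    ∑ k ∈ Finset.Icc (-(n : ℤ)) n, z k • unitVec k = (2 : ℚ) • z := by
  funext i
  have e : ∀ k, i = -k ↔ k = -i := fun k => by omega
  simp only [Finset.sum_apply, Pi.smul_apply, unitVec_apply, smul_eq_mul, mul_sub, mul_ite, mul_one,
    mul_zero, Finset.sum_sub_distrib, e, eq_comm (a := i)]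
  rw [Finset.sum_ite_eq', Finset.sum_ite_eq']
  simp only [mem_Icc_abs, abs_neg]
  split_ifs with h
  · rw [hz.1]; ring
  · rw [hz.2 i (by omega)]; ring

theorem pairing_unitVec {n : ℕ} {x : ℤ → ℚ} (hx : x ∈ vec n) (k : ℤ) (hk : |k| ≤ n) :
    pairing n x (unitVec k) = 2 * x k := by
  simp only [pairing, unitVec_apply, mul_sub, mul_ite, mul_one, mul_zero, Finset.sum_sub_distrib]
  rw [Finset.sum_ite_eq', Finset.sum_ite_eq']
  simp only [mem_Icc_abs, abs_neg, if_pos hk, hx.1]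
  ring

theorem pairing_add {n : ℕ} (x y z : ℤ → ℚ) :
    pairing n x (y + z) = pairing n x y + pairing n x z := by
  simp [pairing, mul_add, Finset.sum_add_distrib]

theorem pairing_sub {n : ℕ} (x y z : ℤ → ℚ) :
    pairing n x (y - z) = pairing n x y - pairing n x z := by
  simp [pairing, mul_sub, Finset.sum_sub_distrib]

theorem pairing_comm {n : ℕ} (x y : ℤ → ℚ) : pairing n x y = pairing n y x := by
  simp only [pairing, mul_comm]

/-- A vector orthogonal to the fixed space of `w` is in the image of `w - 1`. -/
theorem exists_sub_of_pairing {n : ℕ} {w : Equiv.Perm ℤ} (hw : IsSigned n w) {z : ℤ → ℚ}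
    (hz : z ∈ vec n) (h : ∀ x ∈ fixed n w, pairing n x z = 0) :
    ∃ y ∈ vec n, ∀ k, y (w⁻¹ k) - y k = z k := by
  let D : (ℤ → ℚ) →ₗ[ℚ] (ℤ → ℚ) := LinearMap.funLeft ℚ ℚ (w⁻¹ : Equiv.Perm ℤ) - LinearMap.id
  by_contra hne
  have hz' : z ∉ (vec n).map D := by
    rintro ⟨y, hy, hyz⟩
    exact hne ⟨y, hy, fun k => congrFun hyz k⟩
  -- If z is not in the image of w - 1, some functional φ kills that image but not z.
  obtain ⟨φ, hφ, hφ'⟩ := Submodule.exists_dual_map_eq_bot_of_notMem hz' inferInstance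
  have hφ0 : ∀ y ∈ vec n, φ (D y) = 0 := fun y hy => by
    have : φ (D y) ∈ ((vec n).map D).map φ :=
      Submodule.mem_map_of_mem (Submodule.mem_map_of_mem hy)
    rwa [hφ', Submodule.mem_bot] at this
  -- The vector that represents φ with respect to the pairing. It is fixed by w because φ kills
  -- w(e_i) - e_i, so the hypothesis makes it orthogonal to z, that is, φ(2z) = 0.
  let x : ℤ → ℚ := fun k => if |k| ≤ n then φ (unitVec k) else 0
  have hx : x ∈ fixed n w := by
    refine ⟨⟨fun i => ?_, fun i hi => if_neg (by omega)⟩, fun i => ?_⟩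
    · simp only [x, abs_neg, unitVec_neg, map_neg]
      split_ifs <;> simp
    · simp only [x, hw.abs_le_iff]
      split_ifs with hi
      · have := hφ0 _ (unitVec_mem hi)
        have e : D (unitVec i) = unitVec (w i) - unitVec i := by
          funext k
          rw [Pi.sub_apply, ← unitVec_comp w hw.1]
          rfl
        rw [e, map_sub] at this
        linarith
      · rfl
  have h1 := h x hx
  have h2 : pairing n x z = φ ((2 : ℚ) • z) := by
    rw [← sum_smul_unitVec hz, map_sum]
    refine Finset.sum_congr rfl fun k hk => ?_
    rw [map_smul, smul_eq_mul, mul_comm]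
    simp only [x, if_pos (mem_Icc_abs.mp hk)]
  rw [h1, map_smul, smul_eq_mul] at h2
  exact hφ (by linarith)

/-- The image of `w - 1` is orthogonal to the fixed space of `w`. -/
theorem pairing_sub_eq_zero {n : ℕ} {w : Equiv.Perm ℤ} (hw : IsSigned n w) {x y : ℤ → ℚ}
    (hx : x ∈ fixed n w) : pairing n x (fun k => y (w⁻¹ k) - y k) = 0 := by
  have h := pairing_comp hw.inv x y
  have e : (fun k => x (w⁻¹ k)) = x := by
    funext k
    rw [← hx.2, perm_apply_inv]
  rw [e] at h
  have := pairing_sub (n := n) x (fun k => y (w⁻¹ k)) y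
  rw [h, sub_self] at this
  exact this

/-! ### Absolute length and fixed spaces -/

/-- `e_a - e_b` is a root of type `D_n`. -/
def Root (n : ℕ) (a b : ℤ) : Prop := a ≠ 0 ∧ b ≠ 0 ∧ |a| ≤ n ∧ |b| ≤ n ∧ a ≠ b ∧ a ≠ -b

theorem Root.mem_refl {n : ℕ} {a b : ℤ} (h : Root n a b) : paired a b ∈ refl n :=
  paired_mem_refl h.1 h.2.1 h.2.2.1 h.2.2.2.1 h.2.2.2.2.1 h.2.2.2.2.2

theorem Root.mem {n : ℕ} {a b : ℤ} (h : Root n a b) : paired a b ∈ W n :=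
  Subgroup.subset_closure h.mem_refl

theorem exists_root_of_refl {n : ℕ} {t : Equiv.Perm ℤ} (ht : t ∈ refl n) :
    ∃ a b, Root n a b ∧ t = paired a b := by
  obtain ⟨i, j, h1, h2, h3, rfl⟩ := ht
  refine ⟨i, j, ?_, rfl⟩
  rcases abs_cases j with h | h <;> rcases abs_cases i with h' | h' <;>
    refine ⟨?_, ?_, ?_, ?_, ?_, ?_⟩ <;> omega

theorem Root.symm {n : ℕ} {a b : ℤ} (h : Root n a b) : Root n b a := by
  obtain ⟨h1, h2, h3, h4, h5, h6⟩ := h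
  exact ⟨h2, h1, h4, h3, h5.symm, by omega⟩

theorem Root.neg {n : ℕ} {a b : ℤ} (h : Root n a b) : Root n (-a) (-b) := by
  obtain ⟨h1, h2, h3, h4, h5, h6⟩ := h
  exact ⟨by omega, by omega, by rwa [abs_neg], by rwa [abs_neg], by omega, by omega⟩

theorem paired_apply (a b x : ℤ) (h1 : a ≠ 0) (h2 : b ≠ 0) (h3 : a ≠ b) (h4 : a ≠ -b) :
    paired a b x = if x = a then b else if x = b then a else if x = -a then -b else
      if x = -b then -a else x := by
  simp only [paired, Equiv.Perm.mul_apply, Equiv.swap_apply_def]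
  split_ifs <;> omega

theorem Root.apply {n : ℕ} {a b : ℤ} (h : Root n a b) (x : ℤ) :
    paired a b x = if x = a then b else if x = b then a else if x = -a then -b else
      if x = -b then -a else x :=
  paired_apply a b x h.1 h.2.1 h.2.2.2.2.1 h.2.2.2.2.2

theorem Root.sq {n : ℕ} {a b : ℤ} (h : Root n a b) : paired a b * paired a b = 1 := by
  have := paired_inv h.1 h.2.1 h.2.2.2.2.1 h.2.2.2.2.2
  nth_rewrite 1 [← this]
  exact inv_mul_cancel _

theorem Root.inv {n : ℕ} {a b : ℤ} (h : Root n a b) : (paired a b)⁻¹ = paired a b :=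
  paired_inv h.1 h.2.1 h.2.2.2.2.1 h.2.2.2.2.2

theorem Root.mem_fixed {n : ℕ} {a b : ℤ} (h : Root n a b) {x : ℤ → ℚ} (hx : x ∈ vec n) :
    x ∈ fixed n (paired a b) ↔ x a = x b := by
  refine ⟨fun hf => ?_, fun hab => ⟨hx, fun k => ?_⟩⟩
  · have := hf.2 b
    rw [h.apply] at this
    rw [if_neg h.2.2.2.2.1.symm, if_pos rfl] at this
    exact this
  · rw [h.apply]
    split_ifs with h1 h2 h3 h4
    · rw [h1, hab]
    · rw [h2, hab]
    · rw [h3, hx.1, hx.1, hab]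
    · rw [h4, hx.1, hx.1, hab]
    · rfl

theorem fixed_one (n : ℕ) : fixed n 1 = vec n :=
  le_antisymm (fixed_le_vec n 1) fun _ hx => ⟨hx, fun _ => rfl⟩

theorem fixed_inf_le (n : ℕ) (g h : Equiv.Perm ℤ) : fixed n g ⊓ fixed n h ≤ fixed n (g * h) :=
  fun _ hx => ⟨hx.1.1, fun i => by rw [Equiv.Perm.mul_apply, hx.1.2, hx.2.2]⟩

theorem finrank_fixed_le (n : ℕ) (w : Equiv.Perm ℤ) :
    finrank ℚ (fixed n w) ≤ finrank ℚ (vec n) :=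
  Submodule.finrank_mono (fixed_le_vec n w)

theorem finrank_fixed_add_le (n : ℕ) (g h : Equiv.Perm ℤ) :
    finrank ℚ (fixed n g) + finrank ℚ (fixed n h) ≤
      finrank ℚ (vec n) + finrank ℚ (fixed n g ⊓ fixed n h : Submodule ℚ (ℤ → ℚ)) := by
  rw [← Submodule.finrank_sup_add_finrank_inf_eq]
  have : finrank ℚ (fixed n g ⊔ fixed n h : Submodule ℚ (ℤ → ℚ)) ≤ finrank ℚ (vec n) :=
    Submodule.finrank_mono (sup_le (fixed_le_vec n g) (fixed_le_vec n h))
  omega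

theorem finrank_inf_le (n : ℕ) (g h : Equiv.Perm ℤ) :
    finrank ℚ (fixed n g ⊓ fixed n h : Submodule ℚ (ℤ → ℚ)) ≤ finrank ℚ (fixed n (g * h)) :=
  Submodule.finrank_mono (fixed_inf_le n g h)

/-- On `vec n` the fixed space is the kernel of the single functional x ↦ x a - x b. -/
theorem finrank_fixed_root {n : ℕ} {a b : ℤ} (h : Root n a b) :
    finrank ℚ (vec n) ≤ finrank ℚ (fixed n (paired a b)) + 1 := by
  let f : vec n →ₗ[ℚ] ℚ := ((LinearMap.proj a : (ℤ → ℚ) →ₗ[ℚ] ℚ) - LinearMap.proj b) ∘ₗ (vec n).subtype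
  have h1 := LinearMap.finrank_range_add_finrank_ker f
  have h2 : finrank ℚ (LinearMap.range f) ≤ 1 := by
    simpa using Submodule.finrank_le (LinearMap.range f)
  have h3 : finrank ℚ (LinearMap.ker f) ≤ finrank ℚ (fixed n (paired a b)) := by
    rw [(Submodule.equivMapOfInjective (vec n).subtype Subtype.val_injective
      (LinearMap.ker f)).finrank_eq]
    refine Submodule.finrank_mono ?_
    rintro _ ⟨⟨x, hx⟩, hk, rfl⟩
    refine (h.mem_fixed hx).mpr ?_
    have : x a - x b = 0 := hk
    linarith
  omega

/-- A product of k reflections fixes the intersection of k hyperplanes, which has codimension at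
most k. This is the easy half of Carter's lemma. -/
theorem le_absLength_add {n : ℕ} {w : Equiv.Perm ℤ} (hw : w ∈ W n) :
    finrank ℚ (vec n) ≤ absLength n w + finrank ℚ (fixed n w) := by
  obtain ⟨L, hL, rfl, hl⟩ := exists_word refl_inv hw
  rw [absLength, ← hl]
  clear hl hw
  induction L with
  | nil => rw [List.prod_nil, fixed_one]; exact Nat.le_add_left _ _
  | cons t L ih =>
    obtain ⟨a, b, hab, rfl⟩ := exists_root_of_refl (hL t (by simp))
    have h1 := ih fun t ht => hL t (by simp [ht])
    have h2 := finrank_fixed_add_le n (paired a b) L.prod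
    have h3 := finrank_inf_le n (paired a b) L.prod
    have h4 := finrank_fixed_root hab
    rw [List.prod_cons, List.length_cons]
    omega

/-- If the fixed space of `w` lies in the hyperplane of a root, then multiplication by the reflection
enlarges the fixed space. -/
theorem finrank_fixed_lt {n : ℕ} {w : Equiv.Perm ℤ} (hw : IsSigned n w) {a b : ℤ}
    (h : Root n a b) (hf : ∀ x ∈ fixed n w, x a = x b) :
    finrank ℚ (fixed n w) + 1 ≤ finrank ℚ (fixed n (paired a b * w)) := by
  have ha := unitVec_mem h.2.2.1
  have hb := unitVec_mem h.2.2.2.1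
  -- The root α = e_a - e_b is orthogonal to Fix w, hence α = wy - y for some y.
  obtain ⟨y, hy, hyz⟩ := exists_sub_of_pairing hw (sub_mem ha hb) fun x hx => by
    rw [pairing_sub, pairing_unitVec hx.1 _ h.2.2.1, pairing_unitVec hx.1 _ h.2.2.2.1, hf x hx,
      sub_self]
  have hyz' : (fun k => y (w⁻¹ k)) = y + (unitVec a - unitVec b) := by
    funext k
    rw [Pi.add_apply, ← hyz k]
    ring
  have hα : ∀ k, (unitVec a - unitVec b) k = (if k = a then 1 else 0) - (if k = -a then 1 else 0)
      - ((if k = b then 1 else 0) - (if k = -b then 1 else 0)) := fun k => by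
    rw [Pi.sub_apply, unitVec_apply, unitVec_apply]
  obtain ⟨a0, b0, a1, b1, ab, ab'⟩ := id h
  -- Since w is orthogonal, |y + α|² = |wy|² = |y|², which determines ⟨y, α⟩. It follows that the
  -- reflection in α takes wy = y + α back to y.
  have hy1 : y b = y a + 1 := by
    have h1 := pairing_comp hw.inv y y
    have hm := sub_mem ha hb
    have h2 := pairing_comm (n := n) (unitVec a - unitVec b) y
    rw [hyz', pairing_add, pairing_comm, pairing_add, pairing_comm (y + _), pairing_add, h2,
      pairing_sub, pairing_unitVec hy _ a1, pairing_unitVec hy _ b1, pairing_sub,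
      pairing_unitVec hm _ a1, pairing_unitVec hm _ b1, hα, hα] at h1
    rw [if_pos rfl, if_neg (by omega), if_neg ab, if_neg ab', if_neg ab.symm, if_neg (by omega),
      if_pos rfl, if_neg (by omega)] at h1
    linarith
  have hyfix : y ∈ fixed n (paired a b * w) := by
    refine ⟨hy, fun k => ?_⟩
    have hk := congrFun hyz' (w k)
    simp only [Pi.add_apply, hα] at hk
    rw [perm_inv_apply] at hk
    rw [hk, Equiv.Perm.mul_apply, h.apply]
    generalize w k = i
    by_cases i1 : i = a
    · subst i1
      rw [if_pos rfl, if_pos rfl, if_neg (by omega), if_neg ab, if_neg ab']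
      linarith
    by_cases i2 : i = b
    · subst i2
      rw [if_neg i1, if_neg i1, if_pos rfl, if_neg (by omega), if_pos rfl, if_neg (by omega)]
      linarith
    by_cases i3 : i = -a
    · rw [if_neg i1, if_neg i1, if_neg i2, if_pos i3, if_pos i3, if_neg i2, if_neg (by omega), i3,
        hy.1, hy.1]
      linarith
    by_cases i4 : i = -b
    · rw [if_neg i1, if_neg i1, if_neg i2, if_neg i3, if_neg i3, if_neg i2, if_pos i4, if_pos i4,
        i4, hy.1, hy.1]
      linarith
    rw [if_neg i1, if_neg i1, if_neg i2, if_neg i3, if_neg i3, if_neg i2, if_neg i4, if_neg i4]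
    ring
  -- The new fixed space contains Fix w and also y, which is not in Fix w because y b = y a + 1.
  refine Nat.succ_le_of_lt (Submodule.finrank_lt_finrank_of_lt (lt_of_le_of_ne ?_ fun he => ?_))
  · exact fun x hx => fixed_inf_le n _ _ ⟨(h.mem_fixed hx.1).mpr (hf x hx), hx⟩
  · have := hf y (he ▸ hyfix)
    linarith

/-! ### Balanced cycles are not in `W(D_n)` -/

/-- Each ((a b)) is a product of two transpositions of {-n, …, n}, hence even, whereas a balanced
cycle [i] is one transposition, hence odd. -/
theorem W_le_alternating (n : ℕ) {w : Equiv.Perm ℤ} (hw : w ∈ W n) :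
    ∃ u : Equiv.Perm {k : ℤ // k ∈ Finset.Icc (-(n : ℤ)) n},
      Equiv.Perm.sign u = 1 ∧ Equiv.Perm.ofSubtype u = w := by
  induction hw using Subgroup.closure_induction with
  | mem t ht =>
    obtain ⟨a, b, ⟨h1, h2, h3, h4, h5, h6⟩, rfl⟩ := exists_root_of_refl ht
    refine ⟨Equiv.swap ⟨a, mem_Icc_abs.mpr h3⟩ ⟨b, mem_Icc_abs.mpr h4⟩ *
      Equiv.swap ⟨-a, mem_Icc_abs.mpr (by rwa [abs_neg])⟩
        ⟨-b, mem_Icc_abs.mpr (by rwa [abs_neg])⟩, ?_, ?_⟩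
    · rw [Equiv.Perm.sign_mul, Equiv.Perm.sign_swap, Equiv.Perm.sign_swap]
      · rfl
      · simpa using h5
      · simpa using h5
    · rw [map_mul, Equiv.Perm.ofSubtype_swap_eq, Equiv.Perm.ofSubtype_swap_eq]
      rfl
  | one => exact ⟨1, map_one _, map_one _⟩
  | mul a b _ _ ha hb =>
    obtain ⟨u, hu, rfl⟩ := ha
    obtain ⟨v, hv, rfl⟩ := hb
    exact ⟨u * v, by rw [map_mul, hu, hv, one_mul], map_mul _ _ _⟩
  | inv a _ ha =>
    obtain ⟨u, hu, rfl⟩ := ha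
    exact ⟨u⁻¹, by rw [map_inv, hu, inv_one], map_inv _ _⟩

theorem balanced_notMem {n : ℕ} {i : ℤ} (h0 : i ≠ 0) (hi : |i| ≤ n) : balanced i ∉ W n := by
  intro hw
  obtain ⟨u, hu, hb⟩ := W_le_alternating n hw
  have hi' : |-i| ≤ n := by rwa [abs_neg]
  have e : Equiv.Perm.ofSubtype (Equiv.swap (⟨i, mem_Icc_abs.mpr hi⟩ :
      {k : ℤ // k ∈ Finset.Icc (-(n : ℤ)) n}) ⟨-i, mem_Icc_abs.mpr hi'⟩) = balanced i :=
    Equiv.Perm.ofSubtype_swap_eq _ _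
  rw [← e] at hb
  rw [Equiv.Perm.ofSubtype_injective hb, Equiv.Perm.sign_swap] at hu
  · exact absurd hu (by decide)
  · intro h
    have := congrArg Subtype.val h
    simp only at this
    omega

/-- A nontrivial element of `W(D_n)` has its fixed space in a root hyperplane. -/
theorem exists_root {n : ℕ} {w : Equiv.Perm ℤ} (hw : w ∈ W n) (h1 : w ≠ 1) :
    ∃ a b, Root n a b ∧ ∀ x ∈ fixed n w, x a = x b := by
  have hs := isSigned_of_mem hw
  -- If w moves i to some j ≠ ±i, every fixed vector agrees at i and j. Otherwise w only changes
  -- signs, and fixed vectors vanish at each negated index; two such indices give a root, and a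
  -- single one would make w a balanced cycle, which parity excludes.
  by_cases h : ∃ i, w i ≠ i ∧ w i ≠ -i
  · obtain ⟨i, hi, hi'⟩ := h
    have hn : |i| ≤ n := by
      by_contra hn
      exact hi (hs.2 i (by omega))
    have h0 : i ≠ 0 := fun h0 => hi (by rw [h0, hs.map_zero])
    exact ⟨i, w i, ⟨h0, hs.ne_zero h0, hn, hs.abs_le hn, hi.symm, by omega⟩,
      fun x hx => (hx.2 i).symm⟩
  push Not at h
  obtain ⟨i, hi⟩ : ∃ i, w i ≠ i := by
    by_contra! hc
    exact h1 (Equiv.ext hc)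
  have h0 : i ≠ 0 := fun h0 => hi (by rw [h0, hs.map_zero])
  have hn : |i| ≤ n := by
    by_contra hn
    exact hi (hs.2 i (by omega))
  have hwi := h i hi
  have hx : ∀ k, w k = -k → ∀ x ∈ fixed n w, x k = 0 := fun k hk x hx => by
    have := hx.2 k
    rw [hk, hx.1.1] at this
    linarith
  by_cases hj : ∃ j, w j ≠ j ∧ j ≠ i ∧ j ≠ -i
  · obtain ⟨j, hj, hj1, hj2⟩ := hj
    have hn' : |j| ≤ n := by
      by_contra hn
      exact hj (hs.2 j (by omega))
    have h0' : j ≠ 0 := fun h0 => hj (by rw [h0, hs.map_zero])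
    exact ⟨i, j, ⟨h0, h0', hn, hn', by omega, by omega⟩, fun x hx' => by
      rw [hx i hwi x hx', hx j (h j hj) x hx']⟩
  · push Not at hj
    refine absurd hw ?_
    have : w = balanced i := by
      ext k
      rw [balanced, Equiv.swap_apply_def]
      split_ifs with k1 k2
      · rw [k1, hwi]
      · rw [k2, hs.1, hwi, neg_neg]
      · by_contra hk
        exact k2 (hj k hk k1)
    rw [this]
    exact balanced_notMem h0 hn

theorem absLength_root_mul_le {n : ℕ} {a b : ℤ} (h : Root n a b) {w : Equiv.Perm ℤ}
    (hw : w ∈ W n) : absLength n w ≤ absLength n (paired a b * w) + 1 := by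
  have h1 := wordLength_mul_le refl_inv h.mem (mul_mem h.mem hw)
  have h2 := wordLength_le (T := refl n) [paired a b] (by simpa using h.mem_refl)
  rw [← mul_assoc, h.sq, one_mul] at h1
  simp only [List.prod_singleton, List.length_singleton] at h2
  simp only [absLength]
  omega

/-- The absolute length is the codimension of the fixed space. -/
theorem absLength_add {n : ℕ} {w : Equiv.Perm ℤ} (hw : w ∈ W n) :
    absLength n w + finrank ℚ (fixed n w) = finrank ℚ (vec n) := by
  refine le_antisymm ?_ (le_absLength_add hw)
  -- Induction on the codimension of Fix w: multiplication by a reflection whose hyperplane contains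
  -- Fix w lowers the codimension and changes the length by at most one.
  induction hk : finrank ℚ (vec n) - finrank ℚ (fixed n w) using Nat.strong_induction_on
    generalizing w with
  | _ k ih =>
    by_cases h1 : w = 1
    · rw [h1, absLength, wordLength_one, zero_add]
      exact finrank_fixed_le n 1
    · obtain ⟨a, b, hab, hf⟩ := exists_root hw h1
      have h2 := finrank_fixed_lt (isSigned_of_mem hw) hab hf
      have h3 := finrank_fixed_le n (paired a b * w)
      have h4 := ih _ (by omega) (mul_mem hab.mem hw) rfl
      have h5 := absLength_root_mul_le hab hw
      omega

/-- If lengths add, so do codimensions; this forces Fix w = Fix v ∩ Fix(v⁻¹w). -/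
theorem fixed_le_of_absLE {n : ℕ} {v w : Equiv.Perm ℤ} (hv : v ∈ W n) (hw : w ∈ W n)
    (h : AbsLE n v w) : fixed n w ≤ fixed n v := by
  have h0 := mul_mem (inv_mem hv) hw
  have h1 := absLength_add hv
  have h2 := absLength_add hw
  have h3 := absLength_add h0
  have h4 := finrank_fixed_add_le n v (v⁻¹ * w)
  have h5 := fixed_inf_le n v (v⁻¹ * w)
  rw [mul_inv_cancel_left] at h5
  rw [AbsLE] at h
  rw [← Submodule.eq_of_le_of_finrank_le h5 (by omega)]
  exact inf_le_left

theorem absLength_root {n : ℕ} {a b : ℤ} (h : Root n a b) : absLength n (paired a b) = 1 := by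
  have h1 := wordLength_le (T := refl n) [paired a b] (by simpa using h.mem_refl)
  simp only [List.prod_singleton, List.length_singleton] at h1
  refine le_antisymm h1 (Nat.one_le_iff_ne_zero.mpr fun h2 => ?_)
  have h3 := congrFun (congrArg DFunLike.coe (eq_one_of_wordLength refl_inv h.mem h2)) a
  rw [h.apply, if_pos rfl] at h3
  exact h.2.2.2.2.1 h3.symm

/-- If Fix w lies in the hyperplane, multiplication by the reflection enlarges the fixed space, so
the length drops, and it can drop only by one. -/
theorem absLE_root_iff {n : ℕ} {a b : ℤ} (h : Root n a b) {w : Equiv.Perm ℤ} (hw : w ∈ W n) :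
    AbsLE n (paired a b) w ↔ ∀ x ∈ fixed n w, x a = x b := by
  refine ⟨fun hl x hx => (h.mem_fixed hx.1).mp (fixed_le_of_absLE h.mem hw hl hx), fun hf => ?_⟩
  have h1 := finrank_fixed_lt (isSigned_of_mem hw) h hf
  have h2 := absLength_add hw
  have h3 := absLength_add (mul_mem h.mem hw)
  have h4 := absLength_root_mul_le h hw
  rw [AbsLE, h.inv, absLength_root h]
  omega

theorem eq_one_of_fixed {n : ℕ} {w : Equiv.Perm ℤ} (hw : w ∈ W n) (h : vec n ≤ fixed n w) :
    w = 1 := by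
  by_contra h1
  obtain ⟨a, b, hab, hf⟩ := exists_root hw h1
  have := hf _ (h (unitVec_mem hab.2.2.1))
  obtain ⟨h1, h2, h3, h4, h5, h6⟩ := hab
  rw [unitVec_apply, unitVec_apply, if_pos rfl, if_neg (by omega), if_neg (by omega),
    if_neg (by omega)] at this
  norm_num at this

/-! ### The Coxeter element -/

theorem prod_paired_succ_odd (k : ℕ) (x : ℤ) :
    ((List.range k).map fun j : ℕ => paired ((j : ℤ) + 1) ((j : ℤ) + 2)).prod (-x) =
      -((List.range k).map fun j : ℕ => paired ((j : ℤ) + 1) ((j : ℤ) + 2)).prod x := by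
  induction k generalizing x with
  | zero => simp
  | succ k ih =>
    rw [List.range_succ, List.map_append, List.prod_append, List.map_singleton, List.prod_singleton,
      Equiv.Perm.mul_apply, Equiv.Perm.mul_apply, paired_apply_neg (by omega) (by omega), ih]

theorem prod_paired_succ_apply (k : ℕ) (x : ℤ) (hx : 1 ≤ x) :
    ((List.range k).map fun j : ℕ => paired ((j : ℤ) + 1) ((j : ℤ) + 2)).prod x =
      if x ≤ k then x + 1 else if x = k + 1 then 1 else x := by
  induction k generalizing x with
  | zero =>
    simp only [List.range_zero, List.map_nil, List.prod_nil, Equiv.Perm.one_apply]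
    split_ifs <;> omega
  | succ k ih =>
    rw [List.range_succ, List.map_append, List.prod_append, List.map_singleton, List.prod_singleton,
      Equiv.Perm.mul_apply, paired_apply _ _ _ (by omega) (by omega) (by omega) (by omega)]
    push_cast
    rw [ih]
    · split_ifs <;> omega
    · split_ifs <;> omega

theorem cox_apply {n : ℕ} (hn : 2 ≤ n) {k : ℤ} (h1 : 1 ≤ k) (h2 : k < (n : ℤ) - 1) :
    cox n k = k + 1 := by
  rw [cox, Equiv.Perm.mul_apply, paired_apply _ _ _ (by omega) (by omega) (by omega) (by omega),
    if_neg (by omega), if_neg (by omega), if_neg (by omega), if_neg (by omega),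
    prod_paired_succ_apply _ _ h1, if_pos (by omega)]

theorem cox_apply_pred {n : ℕ} (hn : 2 ≤ n) : cox n ((n : ℤ) - 1) = -1 := by
  rw [cox, Equiv.Perm.mul_apply, paired_apply _ _ _ (by omega) (by omega) (by omega) (by omega),
    if_neg (by omega), if_neg (by omega), if_pos (by omega), prod_paired_succ_odd,
    prod_paired_succ_apply _ _ (by omega), if_neg (by omega), if_pos (by omega)]

theorem cox_apply_self {n : ℕ} (hn : 2 ≤ n) : cox n n = -n := by
  rw [cox, Equiv.Perm.mul_apply, paired_apply _ _ _ (by omega) (by omega) (by omega) (by omega),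
    if_neg (by omega), if_pos rfl, prod_paired_succ_odd,
    prod_paired_succ_apply _ _ (by omega), if_pos (by omega)]
  omega

/-- The cyclic enumeration `1, 2, …, n - 1, -1, -2, …` of the long cycle of the Coxeter element. -/
def pos (n : ℕ) (k : ℤ) : ℤ := (cox n ^ k) 1

theorem cox_pos (n : ℕ) (k : ℤ) : cox n (pos n k) = pos n (k + 1) := by
  rw [pos, pos, add_comm, zpow_add, zpow_one, Equiv.Perm.mul_apply]

theorem pos_natCast {n : ℕ} (hn : 2 ≤ n) (k : ℕ) (hk : k + 2 ≤ n) : pos n k = k + 1 := by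
  induction k with
  | zero => simp [pos]
  | succ k ih =>
    push_cast
    rw [← cox_pos, ih (by omega), cox_apply hn (by omega) (by omega)]

theorem pos_eq {n : ℕ} (hn : 2 ≤ n) {k : ℤ} (h1 : 0 ≤ k) (h2 : k < (n : ℤ) - 1) :
    pos n k = k + 1 := by
  lift k to ℕ using h1
  exact pos_natCast hn k (by omega)

theorem isSigned_cox {n : ℕ} (hn : 2 ≤ n) : IsSigned n (cox n) := isSigned_of_mem (cox_mem hn)

/-- c sends n - 1 to -1, so n - 1 steps along the cycle lead from 1 to -1; powers of c are odd maps.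
Thus the indices matter modulo 2(n - 1), and a half turn is a change of sign. -/
theorem pos_add {n : ℕ} (hn : 2 ≤ n) (k : ℤ) : pos n (k + ((n : ℤ) - 1)) = -pos n k := by
  have h : pos n ((n : ℤ) - 1) = -1 := by
    have := cox_pos n ((n : ℤ) - 2)
    rw [pos_eq hn (by omega) (by omega), show (n : ℤ) - 2 + 1 = n - 1 by ring,
      cox_apply_pred hn] at this
    exact this.symm
  rw [pos, zpow_add, Equiv.Perm.mul_apply]
  change (cox n ^ k) (pos n ((n : ℤ) - 1)) = _
  rw [h, (isSigned_of_mem (zpow_mem (cox_mem hn) k)).1]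
  rfl

theorem pos_add' {n : ℕ} (hn : 2 ≤ n) {j k : ℤ} (h : j = k + ((n : ℤ) - 1)) :
    pos n j = -pos n k := h ▸ pos_add hn k

theorem pos_periodic {n : ℕ} (hn : 2 ≤ n) : Function.Periodic (pos n) (2 * ((n : ℤ) - 1)) :=
  fun k => by
    rw [two_mul, ← add_assoc, pos_add hn, pos_add hn, neg_neg]

theorem pos_emod {n : ℕ} (hn : 2 ≤ n) (k : ℤ) : pos n (k % (2 * ((n : ℤ) - 1))) = pos n k := by
  have h := (pos_periodic hn).int_mul (k / (2 * ((n : ℤ) - 1))) (k % (2 * ((n : ℤ) - 1)))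
  rw [Int.cast_id, Int.emod_add_ediv_mul] at h
  exact h.symm

/-- It suffices to treat p_r = 1 with 0 ≤ r < 2(n - 1). The first half of the period runs through 1,
…, n - 1 and the second half through their negatives, so r = 0. -/
theorem dvd_of_pos_eq {n : ℕ} (hn : 2 ≤ n) {j k : ℤ} (h : pos n j = pos n k) :
    2 * ((n : ℤ) - 1) ∣ j - k := by
  have h1 : pos n (j - k) = 1 := by
    have := congrArg (cox n ^ (-k)) h
    simp only [pos, ← Equiv.Perm.mul_apply, ← zpow_add] at this
    rw [show -k + j = j - k by ring, neg_add_cancel] at this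
    exact this
  rw [← pos_emod hn] at h1
  have h2 := Int.emod_nonneg (j - k) (b := 2 * ((n : ℤ) - 1)) (by omega)
  have h3 := Int.emod_lt_of_pos (j - k) (b := 2 * ((n : ℤ) - 1)) (by omega)
  refine Int.dvd_of_emod_eq_zero ?_
  generalize (j - k) % (2 * ((n : ℤ) - 1)) = r at *
  rcases lt_or_ge r ((n : ℤ) - 1) with hr | hr
  · rw [pos_eq hn h2 hr] at h1
    omega
  · rw [pos_add' hn (show r = (r - ((n : ℤ) - 1)) + ((n : ℤ) - 1) by ring),
      pos_eq hn (by omega) (by omega)] at h1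
    omega

theorem pos_ne {n : ℕ} (hn : 2 ≤ n) {j k : ℤ} (h1 : j < k) (h2 : k < j + 2 * ((n : ℤ) - 1)) :
    pos n j ≠ pos n k := fun h => by
  have := Int.le_of_dvd (by omega) (dvd_of_pos_eq hn h.symm)
  omega

theorem pos_ne_neg {n : ℕ} (hn : 2 ≤ n) {j k : ℤ} (h1 : j - ((n : ℤ) - 1) < k)
    (h2 : k < j + ((n : ℤ) - 1)) : pos n j ≠ -pos n k := fun h => by
  rw [← pos_add hn] at h
  exact pos_ne hn (by omega) (by omega) h

theorem exists_pos {n : ℕ} (hn : 2 ≤ n) (i : ℤ) {a : ℤ} (h0 : a ≠ 0) (ha : |a| ≤ (n : ℤ) - 1) :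
    ∃ k, i ≤ k ∧ k < i + 2 * ((n : ℤ) - 1) ∧ pos n k = a := by
  have h : ∃ k, pos n k = a := by
    rcases lt_or_gt_of_ne h0 with h | h
    · rw [abs_of_neg h] at ha
      exact ⟨(-a - 1) + ((n : ℤ) - 1), by
        rw [pos_add hn, pos_eq hn (by omega) (by omega)]; ring⟩
    · rw [abs_of_pos h] at ha
      exact ⟨a - 1, by rw [pos_eq hn (by omega) (by omega)]; ring⟩
  obtain ⟨k, hk⟩ := h
  have h2 := Int.emod_nonneg (k - i) (b := 2 * ((n : ℤ) - 1)) (by omega)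
  have h3 := Int.emod_lt_of_pos (k - i) (b := 2 * ((n : ℤ) - 1)) (by omega)
  refine ⟨i + (k - i) % (2 * ((n : ℤ) - 1)), by omega, by omega, ?_⟩
  have h := (pos_periodic hn).int_mul ((k - i) / (2 * ((n : ℤ) - 1)))
    (i + (k - i) % (2 * ((n : ℤ) - 1)))
  rw [Int.cast_id, add_assoc, Int.emod_add_ediv_mul, add_sub_cancel, hk] at h
  exact h.symm

theorem pos_ne_zero {n : ℕ} (hn : 2 ≤ n) (k : ℤ) : pos n k ≠ 0 :=
  (isSigned_of_mem (zpow_mem (cox_mem hn) k)).ne_zero one_ne_zero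

theorem abs_pos_le {n : ℕ} (hn : 2 ≤ n) (k : ℤ) : |pos n k| ≤ (n : ℤ) - 1 := by
  rw [← pos_emod hn]
  have h2 := Int.emod_nonneg k (b := 2 * ((n : ℤ) - 1)) (by omega)
  have h3 := Int.emod_lt_of_pos k (b := 2 * ((n : ℤ) - 1)) (by omega)
  generalize k % (2 * ((n : ℤ) - 1)) = r at *
  rcases lt_or_ge r ((n : ℤ) - 1) with hr | hr
  · rw [pos_eq hn h2 hr, abs_of_pos] <;> omega
  · rw [pos_add' hn (show r = (r - ((n : ℤ) - 1)) + ((n : ℤ) - 1) by ring),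
      pos_eq hn (by omega) (by omega), abs_neg, abs_of_pos] <;> omega

theorem pos_ne_last {n : ℕ} (hn : 2 ≤ n) (k : ℤ) : pos n k ≠ n ∧ pos n k ≠ -n := by
  have := abs_pos_le hn k
  rcases abs_cases (pos n k) with h | h <;> omega

theorem root_pos {n : ℕ} (hn : 2 ≤ n) {j k : ℤ} (h1 : j < k) (h2 : k < j + ((n : ℤ) - 1)) :
    Root n (pos n j) (pos n k) := by
  have h3 := abs_pos_le hn j
  have h4 := abs_pos_le hn k
  exact ⟨pos_ne_zero hn j, pos_ne_zero hn k, by omega, by omega, pos_ne hn h1 (by omega),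
    pos_ne_neg hn (by omega) h2⟩

theorem root_last {n : ℕ} (hn : 2 ≤ n) (k : ℤ) : Root n (pos n k) n := by
  have h3 := abs_pos_le hn k
  have h4 := pos_ne_last hn k
  exact ⟨pos_ne_zero hn k, by omega, by omega, by rw [abs_of_pos (by omega)], h4.1, h4.2⟩

/-- Every reflection is `((pᵢ pⱼ))` with `i < j < i + n - 1`, or `((pᵢ n))`. -/
theorem refl_cases {n : ℕ} (hn : 2 ≤ n) {t : Equiv.Perm ℤ} (ht : t ∈ refl n) :
    (∃ i j, i < j ∧ j < i + ((n : ℤ) - 1) ∧ t = paired (pos n i) (pos n j)) ∨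
      ∃ i, t = paired (pos n i) n := by
  obtain ⟨a, b, h1, h2, h3, rfl⟩ := ht
  have hb0 : b ≠ 0 := by rintro rfl; simp at h2; omega
  have ha : |a| = a := abs_of_pos (by omega)
  obtain ⟨i, -, -, rfl⟩ := exists_pos hn 0 (a := a) (by omega) (by omega)
  by_cases hb : |b| = n
  · rcases abs_choice b with h | h
    · exact Or.inr ⟨i, by rw [← hb, h]⟩
    · have hR := (root_last hn (i + ((n : ℤ) - 1))).neg
      refine Or.inr ⟨i + ((n : ℤ) - 1), ?_⟩
      rw [← paired_neg _ _ (pos_ne_zero hn _) (by omega) (pos_ne_last hn _).1 (pos_ne_last hn _).2,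
        pos_add hn, neg_neg, show -(n : ℤ) = b by omega]
  · left
    obtain ⟨j, hj1, hj2, rfl⟩ := exists_pos hn i hb0 (by omega)
    have hj3 : j ≠ i := by rintro rfl; omega
    have hj4 : j ≠ i + ((n : ℤ) - 1) := by
      rintro rfl
      rw [pos_add hn, abs_neg, ha] at h2
      omega
    rcases lt_or_gt_of_ne hj4 with h | h
    · exact ⟨i, j, by omega, h, rfl⟩
    · refine ⟨j, i + 2 * ((n : ℤ) - 1), by omega, by omega, ?_⟩
      rw [pos_periodic hn, paired_comm]

theorem eq_zero_of_pos {n : ℕ} (hn : 2 ≤ n) {x : ℤ → ℚ} (hx : x ∈ vec n) (h : x n = 0) (i : ℤ)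
    (hi : ∀ j, i ≤ j → j < i + ((n : ℤ) - 1) → x (pos n j) = 0) : x = 0 := by
  refine vec_ext hx fun k h1 h2 => ?_
  rcases eq_or_lt_of_le h2 with rfl | h2
  · exact h
  obtain ⟨j, hj1, hj2, rfl⟩ := exists_pos hn i (a := k) (by omega)
    (by rw [abs_of_pos (by omega)]; omega)
  rcases lt_or_ge j (i + ((n : ℤ) - 1)) with hj | hj
  · exact hi j hj1 hj
  · rw [pos_add' hn (show j = (j - ((n : ℤ) - 1)) + ((n : ℤ) - 1) by ring), hx.1,
      hi _ (by omega) (by omega), neg_zero]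

/-- A fixed vector is constant along the long cycle, but a half turn changes its sign, so it
vanishes there; it vanishes at n because c negates n. -/
theorem fixed_cox {n : ℕ} (hn : 2 ≤ n) : fixed n (cox n) = ⊥ := by
  rw [Submodule.eq_bot_iff]
  intro x hx
  have h1 : ∀ k : ℤ, x (pos n (k + 1)) = x (pos n k) := fun k => by rw [← cox_pos, hx.2]
  have h2 : ∀ k : ℕ, x (pos n k) = x (pos n 0) := fun k => by
    induction k with
    | zero => rfl
    | succ k ih => push_cast; rw [h1, ih]
  have h3 := h2 (n - 1)
  rw [pos_add' hn (show ((n - 1 : ℕ) : ℤ) = 0 + ((n : ℤ) - 1) by omega), hx.1.1] at h3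
  refine eq_zero_of_pos hn hx.1 ?_ 0 fun j hj _ => ?_
  · have := hx.2 n
    rw [cox_apply_self hn, hx.1.1] at this
    linarith
  · lift j to ℕ using hj
    rw [h2]
    linarith

theorem root_le_cox {n : ℕ} (hn : 2 ≤ n) {a b : ℤ} (h : Root n a b) :
    AbsLE n (paired a b) (cox n) := by
  refine (absLE_root_iff h (cox_mem hn)).mpr fun x hx => ?_
  rw [fixed_cox hn, Submodule.mem_bot] at hx
  rw [hx]
  rfl

theorem absLength_cox {n : ℕ} (hn : 2 ≤ n) : absLength n (cox n) = finrank ℚ (vec n) := by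
  have := absLength_add (cox_mem hn)
  rwa [fixed_cox hn, finrank_bot, add_zero] at this

/-! ### Fixed vectors of the coatoms -/

theorem exists_fixed_ne_zero {n : ℕ} (hn : 2 ≤ n) {a b : ℤ} (h : Root n a b) :
    ∃ x ∈ fixed n (paired a b * cox n), x ≠ 0 := by
  have h1 := finrank_fixed_lt (isSigned_cox hn) h fun x hx => by
    rw [fixed_cox hn, Submodule.mem_bot] at hx
    rw [hx]
    rfl
  refine Submodule.exists_mem_ne_zero_of_ne_bot fun h2 => ?_
  rw [h2, finrank_bot] at h1
  omega

/-- Multiplication by ((p_i p_l)) splits the long balanced cycle of c into the paired cycle through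
p_i, …, p_{l-1} and the balanced cycle through p_l, …, p_{i+n-2}; the cycle [n] is unchanged. Fixed
vectors are constant on cycles and vanish on balanced ones, so they form a line. -/
theorem chord_fixed {n : ℕ} (hn : 2 ≤ n) {i l : ℤ} (h1 : i < l) (h2 : l < i + ((n : ℤ) - 1))
    {x : ℤ → ℚ} (hx : x ∈ fixed n (paired (pos n i) (pos n l) * cox n)) :
    (∀ j, i ≤ j → j < l → x (pos n j) = x (pos n i)) ∧
      (∀ j, l ≤ j → j < i + ((n : ℤ) - 1) → x (pos n j) = 0) ∧ x n = 0 := by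
  have hR := root_pos hn h1 h2
  have hn' : ((n : ℕ) : ℤ) ≠ pos n i ∧ (n : ℤ) ≠ pos n l ∧ (n : ℤ) ≠ -pos n i ∧
      (n : ℤ) ≠ -pos n l := by
    have := pos_ne_last hn i
    have := pos_ne_last hn l
    omega
  have step : ∀ j, i < j → j < i + ((n : ℤ) - 1) → j ≠ l → x (pos n j) = x (pos n (j - 1)) := by
    intro j hj1 hj2 hj3
    have := hx.2 (pos n (j - 1))
    rw [Equiv.Perm.mul_apply, cox_pos, sub_add_cancel, hR.apply, if_neg, if_neg, if_neg,
      if_neg] at this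
    · exact this
    · exact pos_ne_neg hn (by omega) (by omega)
    · exact pos_ne_neg hn (by omega) (by omega)
    · rcases lt_or_gt_of_ne hj3 with h | h
      · exact pos_ne hn h (by omega)
      · exact (pos_ne hn h (by omega)).symm
    · exact (pos_ne hn hj1 (by omega)).symm
  have hA : ∀ e : ℕ, i + e < l → x (pos n (i + e)) = x (pos n i) := fun e => by
    induction e with
    | zero => simp
    | succ e ih =>
      intro he
      push_cast at he ⊢
      rw [step _ (by omega) (by omega) (by omega), show i + ((e : ℤ) + 1) - 1 = i + e by ring,
        ih (by omega)]
  have hB : ∀ e : ℕ, l + e < i + ((n : ℤ) - 1) → x (pos n (l + e)) = x (pos n l) := fun e => by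
    induction e with
    | zero => simp
    | succ e ih =>
      intro he
      push_cast at he ⊢
      rw [step _ (by omega) (by omega) (by omega), show l + ((e : ℤ) + 1) - 1 = l + e by ring,
        ih (by omega)]
  -- The product sends p_{i+n-2} to -p_l, which closes the cycle through p_l with a change of sign.
  have hl : x (pos n l) = 0 := by
    have h3 := hx.2 (pos n (i + ((n : ℤ) - 1) - 1))
    rw [Equiv.Perm.mul_apply, cox_pos, sub_add_cancel, pos_add hn,
      paired_apply_neg hR.1 hR.2.1, hR.apply, if_pos rfl, hx.1.1] at h3
    have h4 := hB (i + ((n : ℤ) - 1) - 1 - l).toNat (by omega)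
    rw [show l + ((i + ((n : ℤ) - 1) - 1 - l).toNat : ℤ) = i + ((n : ℤ) - 1) - 1 by omega] at h4
    linarith
  refine ⟨fun j hj1 hj2 => ?_, fun j hj1 hj2 => ?_, ?_⟩
  · have := hA (j - i).toNat (by omega)
    rwa [show i + ((j - i).toNat : ℤ) = j by omega] at this
  · have := hB (j - l).toNat (by omega)
    rwa [show l + ((j - l).toNat : ℤ) = j by omega, hl] at this
  · have := hx.2 n
    rw [Equiv.Perm.mul_apply, cox_apply_self hn, paired_apply_neg hR.1 hR.2.1, hR.apply,
      if_neg hn'.1, if_neg hn'.2.1, if_neg hn'.2.2.1, if_neg hn'.2.2.2, hx.1.1] at this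
    linarith

theorem exists_chord_fixed {n : ℕ} (hn : 2 ≤ n) {i l : ℤ} (h1 : i < l)
    (h2 : l < i + ((n : ℤ) - 1)) :
    ∃ x ∈ fixed n (paired (pos n i) (pos n l) * cox n), x (pos n i) ≠ 0 := by
  obtain ⟨x, hx, hx0⟩ := exists_fixed_ne_zero hn (root_pos hn h1 h2)
  refine ⟨x, hx, fun h0 => hx0 ?_⟩
  obtain ⟨hA, hB, hC⟩ := chord_fixed hn h1 h2 hx
  refine eq_zero_of_pos hn hx.1 hC i fun j hj1 hj2 => ?_
  rcases lt_or_ge j l with h | h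
  · rw [hA j hj1 h, h0]
  · exact hB j h hj2

/-- Multiplication by ((p_i n)) merges the two balanced cycles of c into the single paired cycle
p_i, …, p_{i+n-2}, -n, on which fixed vectors are constant. -/
theorem spoke_fixed {n : ℕ} (hn : 2 ≤ n) (i : ℤ) {x : ℤ → ℚ}
    (hx : x ∈ fixed n (paired (pos n i) n * cox n)) :
    (∀ j, i ≤ j → j < i + ((n : ℤ) - 1) → x (pos n j) = x (pos n i)) ∧ x n = -x (pos n i) := by
  have hR := root_last hn i
  have hA : ∀ e : ℕ, i + e < i + ((n : ℤ) - 1) → x (pos n (i + e)) = x (pos n i) := fun e => by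
    induction e with
    | zero => simp
    | succ e ih =>
      intro he
      push_cast at he ⊢
      have := hx.2 (pos n (i + e))
      rw [Equiv.Perm.mul_apply, cox_pos, hR.apply, if_neg, if_neg (pos_ne_last hn _).1, if_neg,
        if_neg (pos_ne_last hn _).2] at this
      · rw [← add_assoc, this, ih (by omega)]
      · exact pos_ne_neg hn (by omega) (by omega)
      · exact (pos_ne hn (by omega) (by omega)).symm
  have hB : ∀ j, i ≤ j → j < i + ((n : ℤ) - 1) → x (pos n j) = x (pos n i) := fun j hj1 hj2 => by
    have := hA (j - i).toNat (by omega)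
    rwa [show i + ((j - i).toNat : ℤ) = j by omega] at this
  refine ⟨hB, ?_⟩
  have h3 := hx.2 (pos n (i + ((n : ℤ) - 1) - 1))
  rw [Equiv.Perm.mul_apply, cox_pos, sub_add_cancel, pos_add hn,
    paired_apply_neg hR.1 hR.2.1, hR.apply, if_pos rfl, hx.1.1, hB _ (by omega) (by omega)] at h3
  linarith

theorem exists_spoke_fixed {n : ℕ} (hn : 2 ≤ n) (i : ℤ) :
    ∃ x ∈ fixed n (paired (pos n i) n * cox n), x (pos n i) ≠ 0 := by
  obtain ⟨x, hx, hx0⟩ := exists_fixed_ne_zero hn (root_last hn i)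
  refine ⟨x, hx, fun h0 => hx0 ?_⟩
  obtain ⟨hA, hC⟩ := spoke_fixed hn i hx
  refine eq_zero_of_pos hn hx.1 (by rw [hC, h0, neg_zero]) i fun j hj1 hj2 => ?_
  rw [hA j hj1 hj2, h0]

/-! ### The poset `NC(D_n)` -/

/-- The rank of a non-crossing partition. -/
def rk {n : ℕ} (w : NC n) : ℕ := absLength n w.1

theorem le_iff {n : ℕ} {v w : NC n} : v ≤ w ↔ AbsLE n v.1 w.1 := Iff.rfl

theorem fixed_anti {n : ℕ} {v w : NC n} (h : v ≤ w) : fixed n w.1 ≤ fixed n v.1 :=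
  fixed_le_of_absLE v.2.1 w.2.1 h

theorem rk_add {n : ℕ} (w : NC n) : rk w + finrank ℚ (fixed n w.1) = finrank ℚ (vec n) :=
  absLength_add w.2.1

theorem fixed_inv_apply {n : ℕ} {w : Equiv.Perm ℤ} {x : ℤ → ℚ} (hx : x ∈ fixed n w) (k : ℤ) :
    x (w⁻¹ k) = x k := by
  have := hx.2 (w⁻¹ k)
  rw [perm_apply_inv] at this
  exact this.symm

/-- The two spaces meet in Fix c = 0, and v ≤ c says that their codimensions add up to the full
dimension; hence so do their dimensions. -/
theorem fixed_sup_fixed {n : ℕ} (hn : 2 ≤ n) (v : NC n) :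
    fixed n v.1 ⊔ fixed n (v.1⁻¹ * cox n) = vec n := by
  have h1 := fixed_inf_le n v.1 (v.1⁻¹ * cox n)
  rw [mul_inv_cancel_left, fixed_cox hn, le_bot_iff] at h1
  have h2 := Submodule.finrank_sup_add_finrank_inf_eq (fixed n v.1) (fixed n (v.1⁻¹ * cox n))
  rw [h1, finrank_bot] at h2
  have h3 := absLength_add v.2.1
  have h4 := absLength_add (mul_mem (inv_mem v.2.1) (cox_mem hn))
  have h5 : AbsLE n v.1 (cox n) := v.2.2
  rw [AbsLE, absLength_cox hn] at h5
  exact Submodule.eq_of_le_of_finrank_le (sup_le (fixed_le_vec _ _) (fixed_le_vec _ _)) (by omega)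

/-- A non-crossing partition is determined by its fixed space. -/
theorem ext_fixed {n : ℕ} (hn : 2 ≤ n) {v w : NC n} (h : fixed n v.1 = fixed n w.1) : v = w := by
  -- For y in Fix(w⁻¹c) one has cy = wy. The vector (w - 1)y is orthogonal to Fix w = Fix v, so it
  -- equals (v - 1)y₀. Splitting y₀ = b + a with b in Fix v and a in Fix(v⁻¹c) gives (c - 1)y = (v -
  -- 1)a = (c - 1)a, and y = a because Fix c = 0.
  have key : fixed n (w.1⁻¹ * cox n) ≤ fixed n (v.1⁻¹ * cox n) := by
    intro y hy
    have hc : ∀ k, y ((cox n)⁻¹ k) = y (w.1⁻¹ k) := fun k => by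
      rw [← fixed_inv_apply hy (w.1⁻¹ k), ← Equiv.Perm.mul_apply]
      congr 2
      group
    have hz : (fun k => y (w.1⁻¹ k) - y k) ∈ vec n :=
      sub_mem (vec_comp (isSigned_of_mem w.2.1).inv hy.1) hy.1
    obtain ⟨y0, hy0, hyz⟩ := exists_sub_of_pairing (isSigned_of_mem v.2.1) hz fun x hx =>
      pairing_sub_eq_zero (isSigned_of_mem w.2.1) (h ▸ hx)
    rw [← fixed_sup_fixed hn v, Submodule.mem_sup] at hy0
    obtain ⟨b, hb, a, ha, rfl⟩ := hy0
    have hac : ∀ k, a ((cox n)⁻¹ k) = a (v.1⁻¹ k) := fun k => by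
      rw [← fixed_inv_apply ha (v.1⁻¹ k), ← Equiv.Perm.mul_apply]
      congr 2
      group
    have hya : y - a ∈ fixed n (cox n) := by
      refine ⟨sub_mem hy.1 ha.1, fun i => ?_⟩
      have h1 := hyz (cox n i)
      have h2 := hc (cox n i)
      have h3 := hac (cox n i)
      rw [perm_inv_apply] at h2 h3
      rw [Pi.add_apply, Pi.add_apply, fixed_inv_apply hb, ← h3, ← h2] at h1
      rw [Pi.sub_apply, Pi.sub_apply]
      linarith
    rw [fixed_cox hn, Submodule.mem_bot, sub_eq_zero] at hya
    rwa [hya]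
  -- v and w agree on Fix w, where both are the identity, and on Fix(w⁻¹c), where both agree with c.
  -- These two spaces span `vec n`.
  refine Subtype.ext (inv_mul_eq_one.mp (eq_one_of_fixed (mul_mem (inv_mem v.2.1) w.2.1) ?_))
  have h1 := fixed_sup_fixed hn w
  rw [← h1, sup_le_iff]
  constructor
  · intro x hx
    refine ⟨hx.1, fun k => ?_⟩
    have hx' : x ∈ fixed n v.1 := h ▸ hx
    rw [Equiv.Perm.mul_apply, fixed_inv_apply hx', hx.2]
  · intro x hx
    refine ⟨hx.1, fun k => ?_⟩
    have h2 := fixed_inv_apply (key hx) (v.1⁻¹ (w.1 k))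
    have h3 := fixed_inv_apply hx k
    have h4 : (v.1⁻¹ * cox n)⁻¹ (v.1⁻¹ (w.1 k)) = (w.1⁻¹ * cox n)⁻¹ k := by
      rw [← Equiv.Perm.mul_apply, ← Equiv.Perm.mul_apply]
      congr 1
      group
    rw [h4, h3] at h2
    exact h2.symm

theorem exists_root_of_rk {n : ℕ} {s : NC n} (hs : rk s = 1) :
    ∃ a b, Root n a b ∧ s.1 = paired a b := by
  obtain ⟨L, hL, hp, hl⟩ := exists_word refl_inv s.2.1
  rw [show wordLength (refl n) s.1 = 1 from hs, List.length_eq_one_iff] at hl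
  obtain ⟨t, rfl⟩ := hl
  rw [List.prod_singleton] at hp
  rw [← hp]
  exact exists_root_of_refl (hL t (by simp))

theorem rk_of_root {n : ℕ} {s : NC n} {a b : ℤ} (h : Root n a b) (hs : s.1 = paired a b) :
    rk s = 1 := by
  rw [rk, hs, absLength_root h]

theorem root_le_iff {n : ℕ} {s w : NC n} {a b : ℤ} (h : Root n a b) (hs : s.1 = paired a b) :
    s ≤ w ↔ ∀ x ∈ fixed n w.1, x a = x b := by
  rw [le_iff, hs, absLE_root_iff h w.2.1]

theorem atom_le_iff {n : ℕ} {s w : NC n} (hs : rk s = 1) :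
    s ≤ w ↔ fixed n w.1 ≤ fixed n s.1 := by
  refine ⟨fixed_anti, fun h => ?_⟩
  obtain ⟨a, b, hab, e⟩ := exists_root_of_rk hs
  rw [root_le_iff hab e]
  intro x hx
  rw [← hab.mem_fixed hx.1, ← e]
  exact h hx

theorem rk_le_of_le {n : ℕ} {v w : NC n} (h : v ≤ w) : rk v ≤ rk w := by
  have : rk w = rk v + absLength n (v.1⁻¹ * w.1) := h
  omega

theorem rk_lt_of_lt {n : ℕ} {v w : NC n} (h : v < w) : rk v < rk w := by
  refine lt_of_le_of_ne (rk_le_of_le h.le) fun he => h.ne ?_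
  have h1 : rk w = rk v + absLength n (v.1⁻¹ * w.1) := h.le
  have h2 := eq_one_of_wordLength refl_inv (mul_mem (inv_mem v.2.1) w.2.1)
    (show absLength n (v.1⁻¹ * w.1) = 0 by omega)
  exact Subtype.ext (inv_mul_eq_one.mp h2)

theorem absLE_trans {n : ℕ} {u v w : Equiv.Perm ℤ} (hu : u ∈ W n) (hv : v ∈ W n) (hw : w ∈ W n)
    (huv : AbsLE n u v) (hvw : AbsLE n v w) : AbsLE n u w := by
  have h1 := wordLength_mul_le refl_inv (mul_mem (inv_mem hu) hv) (mul_mem (inv_mem hv) hw)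
  have h2 := wordLength_mul_le refl_inv hu (mul_mem (inv_mem hu) hw)
  rw [mul_inv_cancel_left] at h2
  rw [show (u⁻¹ * v) * (v⁻¹ * w) = u⁻¹ * w by group] at h1
  simp only [AbsLE, absLength] at huv hvw ⊢
  omega

/-- For s take a reflection whose hyperplane contains Fix w, and put v = sw; then v⁻¹w = w⁻¹sw is
again a reflection. The last clause allows Fix w to be recovered from s and v in inductions on the
rank. -/
theorem exists_lt {n : ℕ} (hn : 2 ≤ n) {w : NC n} (hw : rk w ≠ 0) :
    ∃ s v : NC n, rk s = 1 ∧ s ≤ w ∧ v < w ∧ rk w = rk v + 1 ∧ fixed n s.1 ⊓ fixed n v.1 ≤ fixed n w.1 := by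
  have h1 : w.1 ≠ 1 := fun h => hw (by rw [rk, h, absLength, wordLength_one])
  obtain ⟨a, b, hab, hf⟩ := exists_root w.2.1 h1
  have hs := (absLE_root_iff hab w.2.1).mpr hf
  have hv := mul_mem hab.mem w.2.1
  have h2 : absLength n w.1 = absLength n (paired a b) + absLength n (paired a b * w.1) := by
    have := hs
    rwa [AbsLE, hab.inv] at this
  have h5 := absLength_root hab
  have h3 : AbsLE n (paired a b * w.1) w.1 := by
    rw [AbsLE, show (paired a b * w.1)⁻¹ * w.1 = w.1⁻¹ * (paired a b)⁻¹ * w.1⁻¹⁻¹ by group, hab.inv]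
    have h4 := wordLength_conj_le refl_inv
      (conj_refl (isSigned_of_mem (inv_mem w.2.1))) (show paired a b ∈ Subgroup.closure (refl n) from hab.mem)
    have h6 := wordLength_mul_le refl_inv hv (mul_mem (inv_mem hv) w.2.1)
    rw [mul_inv_cancel_left, show (paired a b * w.1)⁻¹ * w.1 =
      w.1⁻¹ * (paired a b)⁻¹ * w.1⁻¹⁻¹ by group, hab.inv] at h6
    simp only [absLength] at *
    omega
  have hc := absLE_trans hv w.2.1 (cox_mem hn) h3 w.2.2
  let v : NC n := ⟨paired a b * w.1, hv, hc⟩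
  have hvw : v ≤ w := h3
  have hr : rk w = rk v + 1 := by
    change absLength n w.1 = absLength n (paired a b * w.1) + 1
    omega
  refine ⟨⟨paired a b, hab.mem, root_le_cox hn hab⟩, v, h5, hs,
    lt_of_le_of_ne hvw fun e => ?_, hr, ?_⟩
  · rw [e] at hr
    omega
  · have := fixed_inf_le n (paired a b) (paired a b * w.1)
    rwa [← mul_assoc, hab.sq, one_mul] at this

/-- Below an element of rank k there is a strict chain through all smaller ranks. Its image is a
strict chain, so the rank cannot drop under ψ, nor under its inverse. -/
theorem rk_apply {n : ℕ} (hn : 2 ≤ n) (ψ : NC n ≃o NC n) (w : NC n) : rk (ψ w) = rk w := by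
  have key : ∀ (ψ : NC n ≃o NC n) (k : ℕ) (w : NC n), rk w = k → k ≤ rk (ψ w) := by
    intro ψ k
    induction k with
    | zero => intros; omega
    | succ k ih =>
      intro w hw
      obtain ⟨-, v, -, -, hv, hr, -⟩ := exists_lt hn (w := w) (by omega)
      have h1 := ih v (by omega)
      have h2 := rk_lt_of_lt (ψ.lt_iff_lt.mpr hv)
      omega
  refine le_antisymm ?_ (key ψ _ w rfl)
  have := key ψ.symm _ (ψ w) rfl
  rwa [ψ.symm_apply_apply] at this

/-- An automorphism that fixes the atoms is trivial. -/
theorem eq_one_of_fix_atoms {n : ℕ} (hn : 2 ≤ n) {ψ : NC n ≃o NC n}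
    (h : ∀ s, rk s = 1 → ψ s = s) : ψ = 1 := by
  have key : ∀ (k : ℕ) (w : NC n), rk w = k → ψ w = w := by
    intro k
    induction k with
    | zero =>
      intro w hw
      have h1 := rk_apply hn ψ w
      rw [hw] at h1
      exact Subtype.ext ((eq_one_of_wordLength refl_inv (ψ w).2.1 h1).trans
        (eq_one_of_wordLength refl_inv w.2.1 hw).symm)
    | succ k ih =>
      intro w hw
      obtain ⟨s, v, hs, hsw, hv, hr, hf⟩ := exists_lt hn (w := w) (by omega)
      -- ψ fixes s and, by induction, v; so ψ w lies above both, and its fixed space lies in Fix s ∩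
      -- Fix v ≤ Fix w. Equal ranks give equality.
      have h1 : fixed n (ψ w).1 ≤ fixed n w.1 := by
        refine le_trans (le_inf ?_ ?_) hf
        · rw [← h s hs]
          exact fixed_anti (ψ.monotone hsw)
        · rw [← ih v (by omega)]
          exact fixed_anti (ψ.monotone hv.le)
      have h2 := rk_add w
      have h3 := rk_add (ψ w)
      rw [rk_apply hn] at h3
      exact ext_fixed hn (Submodule.eq_of_le_of_finrank_le h1 (by omega))
  exact RelIso.ext fun w => key _ w rfl

/-! ### Pairs of reflections -/

theorem refl_eq_of_apply_ne {n : ℕ} {t : Equiv.Perm ℤ} (ht : t ∈ refl n) {x : ℤ} (hx : t x ≠ x) :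
    Root n x (t x) ∧ t = paired x (t x) := by
  obtain ⟨a, b, h, rfl⟩ := exists_root_of_refl ht
  have hn := paired_neg a b h.1 h.2.1 h.2.2.2.2.1 h.2.2.2.2.2
  have e := h.apply x
  rw [e] at hx ⊢
  split_ifs at hx ⊢ with h1 h2 h3 h4
  · subst h1; exact ⟨h, rfl⟩
  · subst h2; exact ⟨h.symm, paired_comm _ _⟩
  · subst h3; exact ⟨h.neg, hn.symm⟩
  · subst h4; exact ⟨h.symm.neg, by rw [paired_comm (-b), hn]⟩
  · exact absurd rfl hx

theorem unitVec_self {x : ℤ} (hx : x ≠ 0) : unitVec x x = 1 := by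
  rw [unitVec_apply, if_pos rfl, if_neg (by omega), sub_zero]

theorem unitVec_of_ne {x y : ℤ} (h : y ≠ x) (h' : y ≠ -x) : unitVec x y = 0 := by
  rw [unitVec_apply, if_neg h, if_neg h', sub_zero]

theorem unitVec_neg_self {x : ℤ} (hx : x ≠ 0) : unitVec x (-x) = -1 := by
  rw [unitVec_apply, if_pos rfl, if_neg (by omega), zero_sub]

theorem unitVec_add_eq_one {x b y : ℤ} (hx : x ≠ 0) (hb : b ≠ 0) (h1 : x ≠ b) (h2 : x ≠ -b)
    (h : (unitVec x + unitVec b) y = 1) : y = x ∨ y = b := by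
  by_contra! hc
  rw [Pi.add_apply] at h
  by_cases c1 : y = -x
  · rw [c1, unitVec_neg_self hx, unitVec_of_ne (by omega) (by omega)] at h
    norm_num at h
  rw [unitVec_of_ne hc.1 c1] at h
  by_cases c2 : y = -b
  · rw [c2, unitVec_neg_self hb] at h
    norm_num at h
  · rw [unitVec_of_ne hc.2 c2] at h
    norm_num at h

theorem unitVec_add_add_eq_one {x b q y : ℤ} (hx : x ≠ 0) (hb : b ≠ 0) (hq : q ≠ 0) (h1 : x ≠ b)
    (h2 : x ≠ -b) (h3 : x ≠ q) (h4 : x ≠ -q) (h5 : b ≠ q) (h6 : b ≠ -q)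
    (h : (unitVec x + unitVec b + unitVec q) y = 1) : y = x ∨ y = b ∨ y = q := by
  by_contra! hc
  by_cases c1 : y = q
  · exact hc.2.2 c1
  by_cases c2 : y = -q
  · rw [Pi.add_apply, Pi.add_apply, c2, unitVec_neg_self hq, unitVec_of_ne (by omega) (by omega),
      unitVec_of_ne (by omega) (by omega)] at h
    norm_num at h
  · rw [Pi.add_apply, unitVec_of_ne c1 c2, add_zero] at h
    rcases unitVec_add_eq_one hx hb h1 h2 h with h | h
    · exact hc.1 h
    · exact hc.2.1 h

theorem unitVec_add_add_apply {x b q : ℤ} (hx : x ≠ 0) (hb : b ≠ 0) (hq : q ≠ 0) (h1 : x ≠ b)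
    (h2 : x ≠ -b) (h3 : x ≠ q) (h4 : x ≠ -q) (h5 : b ≠ q) (h6 : b ≠ -q) :
    (unitVec x + unitVec b + unitVec q) x = 1 ∧ (unitVec x + unitVec b + unitVec q) b = 1 ∧
      (unitVec x + unitVec b + unitVec q) q = 1 := by
  simp only [Pi.add_apply]
  rw [unitVec_self hx, unitVec_self hb, unitVec_self hq, unitVec_of_ne h1 h2,
    unitVec_of_ne h3 h4, unitVec_of_ne (x := x) (y := b) (by omega) (by omega),
    unitVec_of_ne (x := x) (y := q) (by omega) (by omega), unitVec_of_ne h5 h6,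
    unitVec_of_ne (x := b) (y := q) (by omega) (by omega)]
  norm_num

/-- The reflections that do not move `x` fix the vector `e_x`. -/
theorem unitVec_mem_fixed {n : ℕ} {r : Equiv.Perm ℤ} (hr : r ∈ refl n) {x : ℤ} (hxn : |x| ≤ n)
    (hrx : r x = x) : unitVec x ∈ fixed n r := by
  obtain ⟨p, q, hT, rfl⟩ := exists_root_of_refl hr
  obtain ⟨p0, q0, pn, qn, pq, pq'⟩ := id hT
  have hp : x ≠ p ∧ x ≠ q ∧ x ≠ -p ∧ x ≠ -q := by
    rw [hT.apply] at hrx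
    split_ifs at hrx <;> omega
  rw [hT.mem_fixed (unitVec_mem hxn), unitVec_of_ne (by omega) (by omega),
    unitVec_of_ne (by omega) (by omega)]

/-- Let s = ((x b)) and u = ((x y)). The inclusion of fixed spaces is tested on sums of a few basis
vectors that s and t fix. Each relative position of t leads to a contradiction, except t = ((b q))
with y = q; then u is the asserted conjugate. -/
theorem triangle_aux {n : ℕ} {s t u : Equiv.Perm ℤ} (hs : s ∈ refl n) (ht : t ∈ refl n)
    (hu : u ∈ refl n) (hst : s ≠ t) (hsu : s ≠ u) (htu : t ≠ u)
    (h : fixed n s ⊓ fixed n t ≤ fixed n u) {x : ℤ} (hx : u x ≠ x) (hsx : s x ≠ x) :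
    u = s * t * s ∧ u = t * s * t := by
  obtain ⟨hR, es⟩ := refl_eq_of_apply_ne hs hsx
  obtain ⟨hU, eu⟩ := refl_eq_of_apply_ne hu hx
  set b := s x
  set y := u x
  have hby : b ≠ y := fun e => hsu (by rw [es, eu, e])
  have h0 : ∀ f ∈ vec n, f x = f b → f ∈ fixed n t → f x = f y := fun f hf h1 h2 => by
    have h3 : f ∈ fixed n s := by rw [es]; exact (hR.mem_fixed hf).mpr h1
    have h4 := h ⟨h3, h2⟩
    rw [eu] at h4
    exact (hU.mem_fixed hf).mp h4
  obtain ⟨x0, b0, xn, bn, xb, xb'⟩ := id hR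
  obtain ⟨-, y0, -, yn, xy, xy'⟩ := id hU
  have hTs := (isSigned_of_mem (Subgroup.subset_closure ht : t ∈ W n)).1
  -- The test vector is e_x + e_b if t fixes x and b, and e_x + e_b + e_q if t sends b to q, or x to
  -- q ≠ -b. If t sends x to -b, it is e_y.
  by_cases htx : t x = x
  · by_cases htb : t b = b
    · exfalso
      have h1 := h0 (unitVec x + unitVec b) (add_mem (unitVec_mem xn) (unitVec_mem bn)) (by
        rw [Pi.add_apply, Pi.add_apply, unitVec_self x0, unitVec_self b0, unitVec_of_ne xb xb',
          unitVec_of_ne (by omega) (by omega), add_comm])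
        (add_mem (unitVec_mem_fixed ht xn htx) (unitVec_mem_fixed ht bn htb))
      rw [Pi.add_apply, unitVec_self x0, unitVec_of_ne xb xb', add_zero] at h1
      rcases unitVec_add_eq_one x0 b0 xb xb' h1.symm with h | h <;> omega
    · obtain ⟨hT, et⟩ := refl_eq_of_apply_ne ht htb
      set q := t b
      obtain ⟨-, q0, -, qn, bq, bq'⟩ := id hT
      have hxq : x ≠ q ∧ x ≠ -q := by
        rw [et, hT.apply] at htx
        split_ifs at htx <;> omega
      have hm := add_mem (add_mem (unitVec_mem xn) (unitVec_mem bn)) (unitVec_mem qn)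
      obtain ⟨v1, v2, v3⟩ := unitVec_add_add_apply (x := x) (b := b) (q := q) x0 b0 q0 xb xb'
        (by omega) (by omega) (by omega) (by omega)
      have h1 := h0 _ hm (by rw [v1, v2]) (by
        rw [et, hT.mem_fixed hm, v3]
        assumption)
      rw [v1] at h1
      have h2 := unitVec_add_add_eq_one (x := x) (b := b) (q := q) x0 b0 q0 xb xb'
        (by omega) (by omega) (by omega) (by omega) h1.symm
      have hyq : y = q := by omega
      have hss := (isSigned_of_mem hR.mem).1
      have c1 := conj_paired (paired x b) hss b q
      have c2 := conj_paired (paired b q) (isSigned_of_mem hT.mem).1 x b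
      rw [hR.inv, hR.apply, hR.apply, if_neg xb.symm, if_pos rfl, if_neg hxq.1.symm,
        if_neg bq.symm, if_neg (by omega), if_neg (by omega)] at c1
      rw [hT.inv, hT.apply, hT.apply, if_neg xb, if_neg hxq.1, if_neg xb', if_neg hxq.2,
        if_pos rfl] at c2
      rw [es, et, eu, hyq]
      exact ⟨c1.symm, c2.symm⟩
  · obtain ⟨hT, et⟩ := refl_eq_of_apply_ne ht htx
    set q := t x
    obtain ⟨-, q0, -, qn, xq, xq'⟩ := id hT
    have hqb : q ≠ b := fun e => hst (by rw [es, et, e])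
    have hqy : q ≠ y := fun e => htu (by rw [eu, et, e])
    exfalso
    by_cases hq : q = -b
    · by_cases hyb : y = -b
      · omega
      · have v1 := unitVec_of_ne (x := y) (y := x) (by omega) (by omega)
        have v2 := unitVec_of_ne (x := y) (y := b) (by omega) (by omega)
        have h1 := h0 (unitVec y) (unitVec_mem yn) (by rw [v1, v2]) (by
          rw [et, hT.mem_fixed (unitVec_mem yn), v1, hq, (unitVec_mem yn).1, v2, neg_zero])
        rw [v1, unitVec_self y0] at h1
        norm_num at h1
    · have hm := add_mem (add_mem (unitVec_mem xn) (unitVec_mem bn)) (unitVec_mem qn)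
      obtain ⟨v1, v2, v3⟩ := unitVec_add_add_apply (x := x) (b := b) (q := q) x0 b0 q0 xb xb'
        (by omega) (by omega) (by omega) (by omega)
      have h1 := h0 _ hm (by rw [v1, v2]) (by
        rw [et, hT.mem_fixed hm, v3]
        assumption)
      rw [v1] at h1
      have h2 := unitVec_add_add_eq_one (x := x) (b := b) (q := q) x0 b0 q0 xb xb'
        (by omega) (by omega) (by omega) (by omega) h1.symm
      omega

/-- Three reflections of rank two are the reflections of a root system of type `A₂`. -/
theorem triangle {n : ℕ} {s t u : Equiv.Perm ℤ} (hs : s ∈ refl n) (ht : t ∈ refl n)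
    (hu : u ∈ refl n) (hst : s ≠ t) (hsu : s ≠ u) (htu : t ≠ u)
    (h : fixed n s ⊓ fixed n t ≤ fixed n u) : u = s * t * s ∧ u = t * s * t := by
  obtain ⟨x, y, hR, eu⟩ := exists_root_of_refl hu
  have hx : u x ≠ x := by
    rw [eu, hR.apply, if_pos rfl]
    exact hR.2.2.2.2.1.symm
  by_cases hsx : s x = x
  · by_cases htx : t x = x
    · exfalso
      have h1 := h ⟨unitVec_mem_fixed hs hR.2.2.1 hsx, unitVec_mem_fixed ht hR.2.2.1 htx⟩
      rw [eu, hR.mem_fixed (unitVec_mem hR.2.2.1)] at h1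
      obtain ⟨x0, y0, xn, yn, xy, xy'⟩ := id hR
      rw [unitVec_self x0, unitVec_of_ne (by omega) (by omega)] at h1
      norm_num at h1
    · exact (triangle_aux ht hs hu hst.symm htu hsu (by rwa [inf_comm]) hx htx).symm
  · exact triangle_aux hs ht hu hst hsu htu h hx hsx

/-! ### Elements of rank two -/

/-- Two non-crossing partitions have a common upper bound of rank two. -/
def Comp {n : ℕ} (s t : NC n) : Prop := ∃ w : NC n, rk w = 2 ∧ s ≤ w ∧ t ≤ w

/-- Three distinct atoms have a common upper bound of rank two. -/
def Tri {n : ℕ} (s t u : NC n) : Prop :=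
  (rk s = 1 ∧ rk t = 1 ∧ rk u = 1) ∧ (s ≠ t ∧ s ≠ u ∧ t ≠ u) ∧
    ∃ w : NC n, rk w = 2 ∧ s ≤ w ∧ t ≤ w ∧ u ≤ w

theorem Comp.symm {n : ℕ} {s t : NC n} (h : Comp s t) : Comp t s := by
  obtain ⟨w, h1, h2, h3⟩ := h
  exact ⟨w, h1, h3, h2⟩

theorem Tri.swap₁₂ {n : ℕ} {s t u : NC n} (h : Tri s t u) : Tri t s u := by
  obtain ⟨⟨h1, h2, h3⟩, ⟨h4, h5, h6⟩, w, h7, h8, h9, h10⟩ := h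
  exact ⟨⟨h2, h1, h3⟩, ⟨h4.symm, h6, h5⟩, w, h7, h9, h8, h10⟩

theorem Tri.swap₂₃ {n : ℕ} {s t u : NC n} (h : Tri s t u) : Tri s u t := by
  obtain ⟨⟨h1, h2, h3⟩, ⟨h4, h5, h6⟩, w, h7, h8, h9, h10⟩ := h
  exact ⟨⟨h1, h3, h2⟩, ⟨h5, h4, h6.symm⟩, w, h7, h8, h10, h9⟩

theorem Comp.map {n : ℕ} (hn : 2 ≤ n) (ψ : NC n ≃o NC n) {s t : NC n} (h : Comp s t) :
    Comp (ψ s) (ψ t) := by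
  obtain ⟨w, h1, h2, h3⟩ := h
  exact ⟨ψ w, by rw [rk_apply hn, h1], ψ.monotone h2, ψ.monotone h3⟩

theorem comp_map_iff {n : ℕ} (hn : 2 ≤ n) (ψ : NC n ≃o NC n) {s t : NC n} :
    Comp (ψ s) (ψ t) ↔ Comp s t :=
  ⟨fun h => by simpa using h.map hn ψ.symm, fun h => h.map hn ψ⟩

theorem Tri.map {n : ℕ} (hn : 2 ≤ n) (ψ : NC n ≃o NC n) {s t u : NC n} (h : Tri s t u) :
    Tri (ψ s) (ψ t) (ψ u) := by
  obtain ⟨⟨h1, h2, h3⟩, ⟨h4, h5, h6⟩, w, h7, h8, h9, h10⟩ := h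
  refine ⟨⟨?_, ?_, ?_⟩, ⟨ψ.injective.ne h4, ψ.injective.ne h5, ψ.injective.ne h6⟩, ψ w, ?_,
    ψ.monotone h8, ψ.monotone h9, ψ.monotone h10⟩ <;> rwa [rk_apply hn]

theorem mem_refl_of_rk {n : ℕ} {s : NC n} (hs : rk s = 1) : s.1 ∈ refl n := by
  obtain ⟨a, b, hab, e⟩ := exists_root_of_rk hs
  rw [e]
  exact hab.mem_refl

/-- The intersection of two distinct hyperplanes has codimension at least two, and it contains Fix
w, which has codimension two. -/
theorem fixed_inf_le_of_le {n : ℕ} (hn : 2 ≤ n) {s t w : NC n} (hs : rk s = 1) (ht : rk t = 1)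
    (hst : s ≠ t) (hw : rk w = 2) (h1 : s ≤ w) (h2 : t ≤ w) :
    fixed n s.1 ⊓ fixed n t.1 ≤ fixed n w.1 := by
  have a1 := rk_add s
  have a2 := rk_add t
  have a3 := rk_add w
  refine (Submodule.eq_of_le_of_finrank_le (le_inf (fixed_anti h1) (fixed_anti h2)) ?_).ge
  by_contra hc
  have b1 := Submodule.eq_of_le_of_finrank_le
    (inf_le_left : fixed n s.1 ⊓ fixed n t.1 ≤ _) (by omega)
  have b2 := Submodule.eq_of_le_of_finrank_le
    (inf_le_right : fixed n s.1 ⊓ fixed n t.1 ≤ _) (by omega)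
  exact hst (ext_fixed hn (b1.symm.trans b2))

theorem refl_inv_eq {n : ℕ} {t : Equiv.Perm ℤ} (ht : t ∈ refl n) : t⁻¹ = t := by
  obtain ⟨a, b, hab, rfl⟩ := exists_root_of_refl ht
  exact hab.inv

theorem Tri.eq {n : ℕ} (hn : 2 ≤ n) {s t u : NC n} (h : Tri s t u) :
    u.1 = s.1 * t.1 * s.1 ∧ u.1 = t.1 * s.1 * t.1 := by
  obtain ⟨⟨h1, h2, h3⟩, ⟨h4, h5, h6⟩, w, h7, h8, h9, h10⟩ := h
  refine triangle (mem_refl_of_rk h1) (mem_refl_of_rk h2) (mem_refl_of_rk h3)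
    (fun e => h4 (Subtype.ext e)) (fun e => h5 (Subtype.ext e)) (fun e => h6 (Subtype.ext e)) ?_
  exact (fixed_inf_le_of_le hn h1 h2 h4 h7 h8 h9).trans (fixed_anti h10)

theorem Comp.tri {n : ℕ} {s t u : NC n} (hs : rk s = 1) (ht : rk t = 1)
    (hu : rk u = 1) (hst : s ≠ t) (hsu : s ≠ u) (htu : t ≠ u) (h : Comp s t)
    (hf : fixed n s.1 ⊓ fixed n t.1 ≤ fixed n u.1) : Tri s t u := by
  obtain ⟨w, hw, h1, h2⟩ := h
  refine ⟨⟨hs, ht, hu⟩, ⟨hst, hsu, htu⟩, w, hw, h1, h2, (atom_le_iff hu).mpr ?_⟩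
  exact (le_inf (fixed_anti h1) (fixed_anti h2)).trans hf

/-- Both sides express t ≤ sc, because sc has length one less than c. -/
theorem absLE_of_root_mul {n : ℕ} (hn : 2 ≤ n) {s t : Equiv.Perm ℤ} (hs : s ∈ refl n)
    (ht : t ∈ refl n) :
    fixed n (s * cox n) ≤ fixed n t ↔ absLength n (t * (s * cox n)) + 2 = finrank ℚ (vec n) := by
  obtain ⟨a, b, hab, rfl⟩ := exists_root_of_refl hs
  obtain ⟨p, q, hpq, rfl⟩ := exists_root_of_refl ht
  have hc := absLength_cox hn
  have hsc := mul_mem hab.mem (cox_mem hn)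
  have h1 : absLength n (paired a b * cox n) + 1 = finrank ℚ (vec n) := by
    have := root_le_cox hn hab
    rw [AbsLE, hab.inv, absLength_root hab, hc] at this
    omega
  have h2 := absLE_root_iff hpq hsc
  rw [AbsLE, hpq.inv, absLength_root hpq] at h2
  have h3 : fixed n (paired a b * cox n) ≤ fixed n (paired p q) ↔
      ∀ x ∈ fixed n (paired a b * cox n), x p = x q :=
    ⟨fun h x hx => (hpq.mem_fixed hx.1).mp (h hx), fun h x hx => (hpq.mem_fixed hx.1).mpr (h x hx)⟩
  rw [h3, ← h2]
  omega

/-- The inclusion means t ≤ sc, which is equivalent to st ≤ c; the common upper bound is st. -/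
theorem comp_of_fixed_le {n : ℕ} (hn : 2 ≤ n) {s t : NC n} (hs : rk s = 1) (ht : rk t = 1)
    (h : fixed n (s.1 * cox n) ≤ fixed n t.1) : Comp s t := by
  rw [absLE_of_root_mul hn (mem_refl_of_rk hs) (mem_refl_of_rk ht)] at h
  obtain ⟨a, b, hab, es⟩ := exists_root_of_rk hs
  obtain ⟨p, q, hpq, et⟩ := exists_root_of_rk ht
  have hw := mul_mem s.2.1 t.2.1
  have e1 : (s.1 * t.1)⁻¹ * cox n = t.1 * (s.1 * cox n) := by
    rw [mul_inv_rev, es, et, hab.inv, hpq.inv, mul_assoc]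
  have h1 := wordLength_mul_le refl_inv s.2.1 t.2.1
  have h2 := wordLength_mul_le refl_inv hw (mul_mem (inv_mem hw) (cox_mem hn))
  rw [mul_inv_cancel_left, e1] at h2
  have h3 := absLength_cox hn
  have hl : absLength n (s.1 * t.1) = 2 := by
    simp only [rk, absLength] at *
    omega
  let w : NC n := ⟨s.1 * t.1, hw, by rw [AbsLE, e1, hl, h3]; omega⟩
  have hsw : s ≤ w := by
    change AbsLE n s.1 (s.1 * t.1)
    rw [AbsLE, inv_mul_cancel_left, hl]
    simp only [rk] at hs ht
    omega
  refine ⟨w, hl, hsw, (atom_le_iff ht).mpr fun x hx => ⟨hx.1, fun k => ?_⟩⟩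
  have h4 := fixed_anti hsw hx
  have h5 := hx.2 k
  change x ((s.1 * t.1) k) = x k at h5
  rwa [Equiv.Perm.mul_apply, h4.2] at h5

/-- An element of rank two above s and t is su for a reflection u. Either u = t, or u = sts by
`triangle`, so the element is st or ts. Now st ≤ c amounts to t ≤ sc, a condition on Fix(sc), and ts
≤ c is symmetric. -/
theorem comp_iff {n : ℕ} (hn : 2 ≤ n) {s t : NC n} (hs : rk s = 1) (ht : rk t = 1) (hst : s ≠ t) :
    Comp s t ↔ fixed n (s.1 * cox n) ≤ fixed n t.1 ∨ fixed n (t.1 * cox n) ≤ fixed n s.1 := by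
  refine ⟨?_, fun h => h.elim (comp_of_fixed_le hn hs ht) fun h =>
    (comp_of_fixed_le hn ht hs h).symm⟩
  rintro ⟨w, hw, h1, h2⟩
  have hsr := mem_refl_of_rk hs
  have htr := mem_refl_of_rk ht
  have si := refl_inv_eq hsr
  have ti := refl_inv_eq htr
  have hl : absLength n (s.1⁻¹ * w.1) = 1 := by
    have : rk w = rk s + absLength n (s.1⁻¹ * w.1) := h1
    omega
  have hu := mul_mem (inv_mem s.2.1) w.2.1
  obtain ⟨L, hL, hp, hl'⟩ := exists_word refl_inv hu
  rw [show wordLength (refl n) (s.1⁻¹ * w.1) = 1 from hl, List.length_eq_one_iff] at hl'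
  obtain ⟨u, rfl⟩ := hl'
  rw [List.prod_singleton] at hp
  have hur : u ∈ refl n := hL u (by simp)
  have ew : w.1 = s.1 * u := by rw [hp, mul_inv_cancel_left]
  have hwu : fixed n s.1 ⊓ fixed n t.1 ≤ fixed n u := by
    intro x hx
    have h3 := fixed_inf_le_of_le hn hs ht hst hw h1 h2 hx
    refine ⟨hx.1.1, fun k => ?_⟩
    have h4 := h3.2 k
    rwa [ew, Equiv.Perm.mul_apply, hx.1.2] at h4
  have hsu : s.1 ≠ u := fun e => by
    have hss : s.1 * s.1 = 1 := inv_eq_iff_mul_eq_one.mp si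
    rw [← e, hss] at ew
    rw [rk, ew, absLength, wordLength_one] at hw
    omega
  have key : w.1 = s.1 * t.1 ∨ w.1 = t.1 * s.1 := by
    by_cases htu : t.1 = u
    · left
      rw [ew, htu]
    · right
      have h3 := (triangle hsr htr hur (fun e => hst (Subtype.ext e)) hsu htu hwu).1
      rw [ew, h3, ← mul_assoc, ← mul_assoc]
      nth_rewrite 1 [← si]
      rw [inv_mul_cancel, one_mul]
  have hwc : AbsLE n w.1 (cox n) := w.2.2
  rw [AbsLE, absLength_cox hn, show absLength n w.1 = 2 from hw] at hwc
  rcases key with e | e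
  · left
    rw [absLE_of_root_mul hn hsr htr, ← mul_assoc, hwc, e, mul_inv_rev, si, ti, add_comm]
  · right
    rw [absLE_of_root_mul hn htr hsr, ← mul_assoc, hwc, e, mul_inv_rev, si, ti, add_comm]

/-! ### Chords and spokes -/

/-- `s` is the reflection `((pᵢ pⱼ))`, `i < j < i + n - 1`. -/
def IsChord {n : ℕ} (s : NC n) (i j : ℤ) : Prop :=
  i < j ∧ j < i + ((n : ℤ) - 1) ∧ s.1 = paired (pos n i) (pos n j)

/-- `s` is the reflection `((pᵢ n))`. -/
def IsSpoke {n : ℕ} (s : NC n) (i : ℤ) : Prop := s.1 = paired (pos n i) n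

theorem exists_chord {n : ℕ} (hn : 2 ≤ n) {i j : ℤ} (h1 : i < j) (h2 : j < i + ((n : ℤ) - 1)) :
    ∃ s : NC n, IsChord s i j :=
  ⟨⟨_, (root_pos hn h1 h2).mem, root_le_cox hn (root_pos hn h1 h2)⟩, h1, h2, rfl⟩

/-- The reflection `((pᵢ n))`. -/
def spoke {n : ℕ} (hn : 2 ≤ n) (i : ℤ) : NC n :=
  ⟨_, (root_last hn i).mem, root_le_cox hn (root_last hn i)⟩

theorem isSpoke_spoke {n : ℕ} (hn : 2 ≤ n) (i : ℤ) : IsSpoke (spoke hn i) i := rfl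

theorem IsSpoke.eq_spoke {n : ℕ} (hn : 2 ≤ n) {s : NC n} {i : ℤ} (h : IsSpoke s i) :
    s = spoke hn i := Subtype.ext h

theorem IsChord.rk {n : ℕ} (hn : 2 ≤ n) {s : NC n} {i j : ℤ} (h : IsChord s i j) : rk s = 1 :=
  rk_of_root (root_pos hn h.1 h.2.1) h.2.2

theorem IsSpoke.rk {n : ℕ} (hn : 2 ≤ n) {s : NC n} {i : ℤ} (h : IsSpoke s i) : rk s = 1 :=
  rk_of_root (root_last hn i) h

theorem IsChord.eq {n : ℕ} {s t : NC n} {i j : ℤ} (h : IsChord s i j) (h' : IsChord t i j) :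
    s = t := Subtype.ext (h.2.2.trans h'.2.2.symm)

theorem atom_cases {n : ℕ} (hn : 2 ≤ n) {s : NC n} (hs : rk s = 1) :
    (∃ i j, IsChord s i j) ∨ ∃ i, IsSpoke s i := by
  rcases refl_cases hn (mem_refl_of_rk hs) with ⟨i, j, h1, h2, h⟩ | ⟨i, h⟩
  · exact Or.inl ⟨i, j, h1, h2, h⟩
  · exact Or.inr ⟨i, h⟩

theorem IsChord.shift {n : ℕ} (hn : 2 ≤ n) {s : NC n} {i j : ℤ} (h : IsChord s i j) (q : ℤ) :
    IsChord s (i + q * ((n : ℤ) - 1)) (j + q * ((n : ℤ) - 1)) := by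
  have step : ∀ {i j : ℤ}, IsChord s (i + ((n : ℤ) - 1)) (j + ((n : ℤ) - 1)) ↔ IsChord s i j := by
    intro i j
    have h1 : i < j → j < i + ((n : ℤ) - 1) →
        paired (pos n (i + ((n : ℤ) - 1))) (pos n (j + ((n : ℤ) - 1))) =
          paired (pos n i) (pos n j) := fun h1 h2 => by
      have hR := root_pos hn h1 h2
      rw [pos_add hn, pos_add hn, paired_neg _ _ hR.1 hR.2.1 hR.2.2.2.2.1 hR.2.2.2.2.2]
    constructor
    · rintro ⟨h2, h3, h4⟩
      exact ⟨by omega, by omega, by rw [h4, h1 (by omega) (by omega)]⟩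
    · rintro ⟨h2, h3, h4⟩
      exact ⟨by omega, by omega, by rw [h4, h1 (by omega) (by omega)]⟩
  induction q with
  | zero => simpa using h
  | succ q ih =>
    rw [← step] at ih
    convert ih using 1 <;> ring
  | pred q ih =>
    rw [← step]
    convert ih using 1 <;> ring

theorem IsSpoke.congr {n : ℕ} {s : NC n} {i j : ℤ} (h : IsSpoke s i) (e : pos n j = pos n i) :
    IsSpoke s j := by
  rw [IsSpoke, e]
  exact h

/-- A chord has a representative with its first index in a prescribed window. -/
theorem IsChord.normalize {n : ℕ} (hn : 2 ≤ n) {s : NC n} {k l : ℤ} (h : IsChord s k l) (i : ℤ) :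
    ∃ k' l', i ≤ k' ∧ k' < i + ((n : ℤ) - 1) ∧ l' - k' = l - k ∧ IsChord s k' l' := by
  have h2 := Int.emod_nonneg (k - i) (b := (n : ℤ) - 1) (by omega)
  have h3 := Int.emod_lt_of_pos (k - i) (b := (n : ℤ) - 1) (by omega)
  have h4 := Int.emod_add_ediv_mul (k - i) ((n : ℤ) - 1)
  refine ⟨_, _, ?_, ?_, ?_, h.shift hn (-((k - i) / ((n : ℤ) - 1)))⟩
  · rw [neg_mul]; omega
  · rw [neg_mul]; omega
  · ring

/-- The window is twice as long as for chords: a half turn negates both ends of a chord, which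
leaves the reflection unchanged, but it takes ((p_k n)) to the different reflection ((-p_k n)). -/
theorem IsSpoke.normalize {n : ℕ} (hn : 2 ≤ n) {s : NC n} {k : ℤ} (h : IsSpoke s k) (i : ℤ) :
    ∃ k', i ≤ k' ∧ k' < i + 2 * ((n : ℤ) - 1) ∧ IsSpoke s k' := by
  obtain ⟨k', h1, h2, h3⟩ := exists_pos hn i (pos_ne_zero hn k) (abs_pos_le hn k)
  exact ⟨k', h1, h2, h.congr h3⟩

theorem Root.paired_inj {n : ℕ} {a b c d : ℤ} (h : Root n a b)
    (h' : Root n c d) (e : paired a b = paired c d) :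
    (a = c ∧ b = d) ∨ (a = d ∧ b = c) ∨ (a = -c ∧ b = -d) ∨ (a = -d ∧ b = -c) := by
  have h1 : paired c d a = b := by rw [← e, h.apply, if_pos rfl]
  rw [h'.apply] at h1
  obtain ⟨x1, x2, -, -, x3, x4⟩ := h
  split_ifs at h1 <;> omega

theorem IsChord.ne_spoke {n : ℕ} (hn : 2 ≤ n) {s t : NC n} {i j k : ℤ} (h : IsChord s i j)
    (h' : IsSpoke t k) : s ≠ t := fun e => by
  have h1 := pos_ne_last hn i
  have h2 := pos_ne_last hn j
  have e' : paired (pos n i) (pos n j) = paired (pos n k) n := by rw [← h.2.2, e, h']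
  rcases (root_pos hn h.1 h.2.1).paired_inj (root_last hn k) e' with h | h | h | h <;> omega

/-! ### Compatibility of chords and spokes -/

theorem IsChord.comp_of_left {n : ℕ} (hn : 2 ≤ n) {s t : NC n} {i j : ℤ} (h : IsChord s i j)
    (ht : NCD.rk t = 1) (hf : ∀ x ∈ vec n,
      (∀ k, i ≤ k → k < j → x (pos n k) = x (pos n i)) →
      (∀ k, j ≤ k → k < i + ((n : ℤ) - 1) → x (pos n k) = 0) → x n = 0 → x ∈ fixed n t.1) :
    Comp s t := by
  refine comp_of_fixed_le hn (h.rk hn) ht fun x hx => ?_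
  rw [h.2.2] at hx
  obtain ⟨h1, h2, h3⟩ := chord_fixed hn h.1 h.2.1 hx
  exact hf x hx.1 h1 h2 h3

theorem IsSpoke.comp_of_left {n : ℕ} (hn : 2 ≤ n) {s t : NC n} {i : ℤ} (h : IsSpoke s i)
    (ht : NCD.rk t = 1) (hf : ∀ x ∈ vec n,
      (∀ k, i ≤ k → k < i + ((n : ℤ) - 1) → x (pos n k) = x (pos n i)) → x n = -x (pos n i) →
      x ∈ fixed n t.1) : Comp s t := by
  refine comp_of_fixed_le hn (h.rk hn) ht fun x hx => ?_
  rw [h] at hx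
  obtain ⟨h1, h2⟩ := spoke_fixed hn i hx
  exact hf x hx.1 h1 h2

theorem IsChord.mem_fixed {n : ℕ} (hn : 2 ≤ n) {s : NC n} {i j : ℤ} (h : IsChord s i j)
    {x : ℤ → ℚ} (hx : x ∈ vec n) : x ∈ fixed n s.1 ↔ x (pos n i) = x (pos n j) := by
  rw [h.2.2, (root_pos hn h.1 h.2.1).mem_fixed hx]

theorem IsSpoke.mem_fixed {n : ℕ} (hn : 2 ≤ n) {s : NC n} {i : ℤ} (h : IsSpoke s i)
    {x : ℤ → ℚ} (hx : x ∈ vec n) : x ∈ fixed n s.1 ↔ x (pos n i) = x n := by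
  rw [h, (root_last hn i).mem_fixed hx]

theorem vec_pos_add {n : ℕ} (hn : 2 ≤ n) {x : ℤ → ℚ} (hx : x ∈ vec n) (k : ℤ) :
    x (pos n (k + ((n : ℤ) - 1))) = -x (pos n k) := by
  rw [pos_add hn, hx.1]

/-- A side is compatible with every other atom, apart from one chord. -/
theorem IsChord.side_comp {n : ℕ} (hn : 3 ≤ n) {s t : NC n} {i : ℤ} (h : IsChord s i (i + 1))
    (ht : NCD.rk t = 1) (hst : s ≠ t) (hne : ¬IsChord t (i + 1) (i + ((n : ℤ) - 1))) :
    Comp s t := by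
  have hn' : 2 ≤ n := by omega
  -- For the side s, the line Fix(sc) is spanned by the basis vector at p_i, so every t that does
  -- not move p_i passes the test on it. If t moves p_i, the test on Fix(tc) is used: the vectors
  -- there agree at p_i and p_{i+1}, except for the excluded chord.
  rcases atom_cases hn' ht with ⟨k, l, hk⟩ | ⟨k, hk⟩
  · obtain ⟨k, l, h1, h2, -, hk⟩ := hk.normalize hn' i
    obtain ⟨h3, h4, -⟩ := id hk
    rcases eq_or_lt_of_le h1 with rfl | h1
    · have hl : l ≠ i + 1 := fun e => hst (h.eq (e ▸ hk))
      refine (hk.comp_of_left hn' (h.rk hn') fun x hx x1 x2 x3 => ?_).symm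
      rw [h.mem_fixed hn' hx, x1 (i + 1) (by omega) (by omega)]
    rcases lt_trichotomy l (i + ((n : ℤ) - 1)) with hl | hl | hl
    · refine h.comp_of_left hn' ht fun x hx x1 x2 x3 => ?_
      rw [hk.mem_fixed hn' hx, x2 _ (by omega) (by omega), x2 _ (by omega) (by omega)]
    · have hk1 : k ≠ i + 1 := fun e => hne (hl ▸ e ▸ hk)
      refine (hk.comp_of_left hn' (h.rk hn') fun x hx x1 x2 x3 => ?_).symm
      have a1 := x2 (i + ((n : ℤ) - 1)) (by omega) (by omega)
      have a2 := x2 (i + 1 + ((n : ℤ) - 1)) (by omega) (by omega)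
      rw [vec_pos_add hn' hx] at a1 a2
      rw [h.mem_fixed hn' hx]
      linarith
    · refine h.comp_of_left hn' ht fun x hx x1 x2 x3 => ?_
      have a1 := vec_pos_add hn' hx (l - ((n : ℤ) - 1))
      rw [sub_add_cancel, x2 (l - ((n : ℤ) - 1)) (by omega) (by omega)] at a1
      rw [hk.mem_fixed hn' hx, x2 k (by omega) (by omega), a1, neg_zero]
  · obtain ⟨k, h1, h2, hk⟩ := hk.normalize hn' i
    rcases eq_or_lt_of_le h1 with rfl | h1
    · refine (hk.comp_of_left hn' (h.rk hn') fun x hx x1 x2 => ?_).symm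
      rw [h.mem_fixed hn' hx, x1 (i + 1) (by omega) (by omega)]
    rcases lt_trichotomy k (i + ((n : ℤ) - 1)) with hl | hl | hl
    · refine h.comp_of_left hn' ht fun x hx x1 x2 x3 => ?_
      rw [hk.mem_fixed hn' hx, x2 _ (by omega) (by omega), x3]
    · refine (hk.comp_of_left hn' (h.rk hn') fun x hx x1 x2 => ?_).symm
      have a1 := x1 (i + 1 + ((n : ℤ) - 1)) (by omega) (by omega)
      rw [hl, vec_pos_add hn' hx, vec_pos_add hn' hx] at a1
      rw [h.mem_fixed hn' hx]
      linarith
    · refine h.comp_of_left hn' ht fun x hx x1 x2 x3 => ?_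
      have a1 := vec_pos_add hn' hx (k - ((n : ℤ) - 1))
      rw [sub_add_cancel, x2 (k - ((n : ℤ) - 1)) (by omega) (by omega)] at a1
      rw [hk.mem_fixed hn' hx, a1, x3, neg_zero]

/-- `s` and `t` are distinct and incompatible. -/
def Inc {n : ℕ} (s t : NC n) : Prop := s ≠ t ∧ ¬Comp s t

theorem Inc.symm {n : ℕ} {s t : NC n} (h : Inc s t) : Inc t s :=
  ⟨h.1.symm, fun h' => h.2 h'.symm⟩

/-- These are ((p_i p_j)) and ((p_i -p_j)). A nonzero vector of either line vanishes at exactly one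
of p_i and p_j, so the other reflection does not fix it. -/
theorem IsChord.inc_opposite {n : ℕ} (hn : 2 ≤ n) {s t : NC n} {i j : ℤ} (h : IsChord s i j)
    (h' : IsChord t j (i + ((n : ℤ) - 1))) : Inc s t := by
  obtain ⟨h1, h2, e⟩ := id h
  obtain ⟨h1', h2', e'⟩ := id h'
  have hst : s ≠ t := fun hst => by
    have i0 := pos_ne_zero hn i
    have j0 := pos_ne_zero hn j
    have ij := pos_ne hn h1 (by omega)
    have ij' := pos_ne_neg hn (by omega) h2
    have e2 : paired (pos n i) (pos n j) = paired (pos n j) (pos n (i + ((n : ℤ) - 1))) := by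
      rw [← e, ← e', hst]
    have := (root_pos hn h1 h2).paired_inj (root_pos hn h1' h2') e2
    rw [pos_add hn] at this
    omega
  refine ⟨hst, ?_⟩
  rw [comp_iff hn (h.rk hn) (h'.rk hn) hst]
  rintro (hc | hc)
  · obtain ⟨x, hx, hx0⟩ := exists_chord_fixed hn h1 h2
    obtain ⟨x1, x2, x3⟩ := chord_fixed hn h1 h2 hx
    have := hc (by rw [e]; exact hx)
    rw [h'.mem_fixed hn hx.1, x2 _ le_rfl h2, vec_pos_add hn hx.1] at this
    exact hx0 (by linarith)
  · obtain ⟨x, hx, hx0⟩ := exists_chord_fixed hn h1' h2'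
    obtain ⟨x1, x2, x3⟩ := chord_fixed hn h1' h2' hx
    have := hc (by rw [e']; exact hx)
    have a1 := x2 _ le_rfl h2'
    rw [vec_pos_add hn hx.1] at a1
    rw [h.mem_fixed hn hx.1] at this
    exact hx0 (by linarith)

/-- The chord's line is nonzero at p_k but zero at n. The spoke's line takes opposite nonzero values
at p_i and p_j, since a sign change occurs between p_i and p_k. -/
theorem IsChord.inc_spoke {n : ℕ} (hn : 2 ≤ n) {s t : NC n} {i j k : ℤ} (h : IsChord s i j)
    (h' : IsSpoke t k) (h1 : i < k) (h2 : k < j) : Inc s t := by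
  have h3 := h.2.1
  refine ⟨h.ne_spoke hn h', ?_⟩
  rw [comp_iff hn (h.rk hn) (h'.rk hn) (h.ne_spoke hn h')]
  rintro (hc | hc)
  · obtain ⟨x, hx, hx0⟩ := exists_chord_fixed hn h.1 h.2.1
    obtain ⟨x1, x2, x3⟩ := chord_fixed hn h.1 h.2.1 hx
    have := hc (by rw [h.2.2]; exact hx)
    rw [h'.mem_fixed hn hx.1, x1 k h1.le h2, x3] at this
    exact hx0 this
  · obtain ⟨x, hx, hx0⟩ := exists_spoke_fixed hn k
    obtain ⟨x1, x2⟩ := spoke_fixed hn k hx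
    have := hc (by rw [h']; exact hx)
    have a1 := x1 (i + ((n : ℤ) - 1)) (by omega) (by omega)
    rw [vec_pos_add hn hx.1] at a1
    rw [h.mem_fixed hn hx.1, x1 j h2.le (by omega)] at this
    exact hx0 (by linarith)

/-- With the later spoke at most a half turn ahead, its line takes opposite values at p_j and p_i,
and thus equal values at p_i and n. Beyond a half turn the roles are exchanged. -/
theorem IsSpoke.comp {n : ℕ} (hn : 2 ≤ n) {s t : NC n} {i j : ℤ} (h : IsSpoke s i)
    (h' : IsSpoke t j) (hst : s ≠ t) : Comp s t := by
  obtain ⟨j, h1, h2, h'⟩ := h'.normalize hn i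
  have hij : j ≠ i := fun e => hst (Subtype.ext (h.trans (e ▸ h').symm))
  rcases lt_or_ge j (i + ((n : ℤ) - 1)) with hj | hj
  · refine (h'.comp_of_left hn (h.rk hn) fun x hx x1 x2 => ?_).symm
    have a1 := x1 (i + ((n : ℤ) - 1)) (by omega) (by omega)
    rw [vec_pos_add hn hx] at a1
    rw [h.mem_fixed hn hx]
    linarith
  · refine h.comp_of_left hn (h'.rk hn) fun x hx x1 x2 => ?_
    have a1 := vec_pos_add hn hx (j - ((n : ℤ) - 1))
    rw [sub_add_cancel, x1 (j - ((n : ℤ) - 1)) (by omega) (by omega)] at a1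
    rw [h'.mem_fixed hn hx, a1, x2]

theorem tri_chords {n : ℕ} (hn : 2 ≤ n) {s t u : NC n} {i j k : ℤ} (hs : IsChord s i j)
    (ht : IsChord t j k) (hu : IsChord u i k) : Tri s t u := by
  obtain ⟨s1, s2, es⟩ := id hs
  obtain ⟨t1, t2, et⟩ := id ht
  obtain ⟨u1, u2, eu⟩ := id hu
  have p1 := pos_ne hn s1 (by omega)
  have p2 := pos_ne hn t1 (by omega)
  have p3 := pos_ne hn u1 (by omega)
  have p4 := pos_ne_neg hn (by omega) s2
  have p5 := pos_ne_neg hn (by omega) t2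
  have p6 := pos_ne_neg hn (by omega) u2
  have p7 := pos_ne_zero hn i
  have p8 := pos_ne_zero hn k
  refine Comp.tri (hs.rk hn) (ht.rk hn) (hu.rk hn) ?_ ?_ ?_ ?_ ?_
  · intro e
    have := (root_pos hn s1 s2).paired_inj (root_pos hn t1 t2) (by rw [← es, ← et, e])
    omega
  · intro e
    have := (root_pos hn s1 s2).paired_inj (root_pos hn u1 u2) (by rw [← es, ← eu, e])
    omega
  · intro e
    have := (root_pos hn t1 t2).paired_inj (root_pos hn u1 u2) (by rw [← et, ← eu, e])
    omega
  · refine hs.comp_of_left hn (ht.rk hn) fun x hx x1 x2 x3 => ?_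
    rw [ht.mem_fixed hn hx, x2 _ le_rfl s2, x2 _ t1.le u2]
  · intro x hx
    have h1 := (hs.mem_fixed hn hx.1.1).mp hx.1
    have h2 := (ht.mem_fixed hn hx.1.1).mp hx.2
    exact (hu.mem_fixed hn hx.1.1).mpr (h1.trans h2)

theorem tri_spokes {n : ℕ} (hn : 2 ≤ n) {s t u : NC n} {i j : ℤ} (hs : IsSpoke s i)
    (ht : IsSpoke t j) (hu : IsChord u i j) : Tri s t u := by
  have hst : s ≠ t := fun e => by
    have p := pos_ne_last hn i
    have := (root_last hn i).paired_inj (root_last hn j) (by rw [← hs, ← ht, e])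
    have := pos_ne hn hu.1 (by have := hu.2.1; omega)
    omega
  refine Comp.tri (hs.rk hn) (ht.rk hn) (hu.rk hn) hst (hu.ne_spoke hn hs).symm
    (hu.ne_spoke hn ht).symm (hs.comp hn ht hst) fun x hx => ?_
  have h1 := (hs.mem_fixed hn hx.1.1).mp hx.1
  have h2 := (ht.mem_fixed hn hx.1.1).mp hx.2
  exact (hu.mem_fixed hn hx.1.1).mpr (h1.trans h2.symm)

/-- The third atom of a triple with two spokes. -/
theorem Tri.spokes_eq {n : ℕ} (hn : 2 ≤ n) {s t u : NC n} {i j : ℤ} (h : Tri s t u)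
    (hs : IsSpoke s i) (ht : IsSpoke t j) :
    Root n (pos n i) (pos n j) ∧ u.1 = paired (pos n i) (pos n j) := by
  have hR := root_last hn i
  have hT := root_last hn j
  have p := pos_ne_last hn j
  have e := (h.eq hn).1
  have c := conj_paired (paired (pos n i) n) (isSigned_of_mem hR.mem).1 (pos n j) n
  rw [hR.inv] at c
  rw [hs, ht, c, hR.apply n, if_neg hR.2.2.2.2.1.symm, if_pos rfl] at e
  by_cases h1 : pos n j = pos n i
  · refine absurd (Subtype.ext ?_) h.2.1.1
    rw [hs, ht, h1]
  by_cases h2 : pos n j = -pos n i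
  · refine absurd (Subtype.ext ?_) h.2.1.2.2
    rw [ht, e, hR.apply, if_neg h1, if_neg p.1, if_pos h2, h2, paired_comm,
      ← paired_neg _ _ (by omega) (by omega) (by omega) (by omega), neg_neg]
  · refine ⟨⟨hR.1, hT.1, hR.2.2.1, hT.2.2.1, Ne.symm h1, by omega⟩, ?_⟩
    rw [e, hR.apply, if_neg h1, if_neg p.1, if_neg h2, if_neg p.2, paired_comm]

/-- Sides that form a triple with a spoke meet it. -/
theorem Tri.side_of_spoke {n : ℕ} (hn : 3 ≤ n) {s t u : NC n} {i k : ℤ} (h : Tri s t u)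
    (hs : IsSpoke s i) (ht : IsChord t k (k + 1)) : IsChord t i (i + 1) ∨ IsChord t (i - 1) i := by
  have hn' : 2 ≤ n := by omega
  obtain ⟨k, l, h1, h2, hl, ht⟩ := ht.normalize hn' i
  obtain rfl : l = k + 1 := by omega
  rcases eq_or_lt_of_le h1 with rfl | h1
  · exact Or.inl ht
  rcases eq_or_lt_of_le (show k + 1 ≤ i + ((n : ℤ) - 1) by omega) with h3 | h3
  · right
    have := ht.shift hn' (-1)
    convert this using 1 <;> omega
  -- A side that does not touch p_i commutes with the spoke, so the third atom of the triple, being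
  -- the conjugate of the side by the spoke, would be the side itself.
  · exfalso
    have hR := root_last hn' i
    have c := conj_paired (paired (pos n i) n) (isSigned_of_mem hR.mem).1 (pos n k) (pos n (k + 1))
    have hfix : ∀ j, i < j → j < i + ((n : ℤ) - 1) → paired (pos n i) n (pos n j) = pos n j := by
      intro j hj1 hj2
      rw [hR.apply, if_neg (pos_ne hn' hj1 (by omega)).symm, if_neg (pos_ne_last hn' j).1,
        if_neg (pos_ne_neg hn' (by omega) (by omega)), if_neg (pos_ne_last hn' j).2]
    rw [hR.inv, hfix _ h1 (by omega), hfix _ (by omega) h3, ← ht.2.2, ← hs] at c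
    exact h.2.1.2.2 (Subtype.ext (c.symm.trans (h.eq hn').1.symm))

/-! ### Automorphisms preserve the spokes -/

/-- `s` is an atom with exactly one incompatible atom. -/
def UniqueInc {n : ℕ} (s : NC n) : Prop := rk s = 1 ∧ ∃! t : NC n, rk t = 1 ∧ Inc s t

/-- `s` is an atom that behaves towards the atoms with a unique incompatible atom like a spoke. -/
def SpokeLike {n : ℕ} (s : NC n) : Prop :=
  rk s = 1 ∧ ¬UniqueInc s ∧ (∀ t, UniqueInc t → Comp s t) ∧
    ¬∃ t₁ t₂ t₃ : NC n, (t₁ ≠ t₂ ∧ t₁ ≠ t₃ ∧ t₂ ≠ t₃) ∧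
      (UniqueInc t₁ ∧ UniqueInc t₂ ∧ UniqueInc t₃) ∧
        (∃ u, Tri s t₁ u) ∧ (∃ u, Tri s t₂ u) ∧ ∃ u, Tri s t₃ u

theorem inc_map_iff {n : ℕ} (hn : 2 ≤ n) (ψ : NC n ≃o NC n) {s t : NC n} :
    Inc (ψ s) (ψ t) ↔ Inc s t := by
  rw [Inc, Inc, comp_map_iff hn, ψ.injective.ne_iff]

theorem UniqueInc.map {n : ℕ} (hn : 2 ≤ n) (ψ : NC n ≃o NC n) {s : NC n} (h : UniqueInc s) :
    UniqueInc (ψ s) := by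
  obtain ⟨h1, t, ⟨h2, h3⟩, h4⟩ := h
  refine ⟨by rwa [rk_apply hn], ψ t, ⟨by rwa [rk_apply hn], (inc_map_iff hn ψ).mpr h3⟩, ?_⟩
  rintro u ⟨h5, h6⟩
  rw [← h4 (ψ.symm u), ψ.apply_symm_apply]
  refine ⟨by rwa [rk_apply hn], ?_⟩
  rwa [← inc_map_iff hn ψ, ψ.apply_symm_apply]

theorem uniqueInc_map_iff {n : ℕ} (hn : 2 ≤ n) (ψ : NC n ≃o NC n) {s : NC n} :
    UniqueInc (ψ s) ↔ UniqueInc s :=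
  ⟨fun h => by simpa using h.map hn ψ.symm, fun h => h.map hn ψ⟩

theorem SpokeLike.map {n : ℕ} (hn : 2 ≤ n) (ψ : NC n ≃o NC n) {s : NC n} (h : SpokeLike s) :
    SpokeLike (ψ s) := by
  obtain ⟨h1, h2, h3, h4⟩ := h
  refine ⟨by rwa [rk_apply hn], by rwa [uniqueInc_map_iff hn], fun t ht => ?_, ?_⟩
  · rw [← ψ.apply_symm_apply t, comp_map_iff hn]
    exact h3 _ (ht.map hn ψ.symm)
  · rintro ⟨t₁, t₂, t₃, ⟨a1, a2, a3⟩, ⟨b1, b2, b3⟩, ⟨u₁, c1⟩, ⟨u₂, c2⟩, u₃, c3⟩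
    have d : ∀ t u, Tri (ψ s) t u → ∃ u, Tri s (ψ.symm t) u := fun t u h =>
      ⟨ψ.symm u, by simpa using h.map hn ψ.symm⟩
    exact h4 ⟨ψ.symm t₁, ψ.symm t₂, ψ.symm t₃,
      ⟨ψ.symm.injective.ne a1, ψ.symm.injective.ne a2, ψ.symm.injective.ne a3⟩,
      ⟨b1.map hn ψ.symm, b2.map hn ψ.symm, b3.map hn ψ.symm⟩, d _ _ c1, d _ _ c2, d _ _ c3⟩

theorem IsChord.uniqueInc {n : ℕ} (hn : 3 ≤ n) {s : NC n} {i : ℤ} (h : IsChord s i (i + 1)) :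
    UniqueInc s := by
  have hn' : 2 ≤ n := by omega
  obtain ⟨t, ht⟩ := exists_chord hn' (i := i + 1) (j := i + ((n : ℤ) - 1)) (by omega) (by omega)
  refine ⟨h.rk hn', t, ⟨ht.rk hn', h.inc_opposite hn' ht⟩, fun u ⟨hu, hi⟩ => ?_⟩
  by_contra hne
  exact hi.2 (h.side_comp hn hu hi.1 fun hu' => hne (hu'.eq ht))

/-- Such a chord skips p_{i+1}, so it is incompatible with the spoke there as well as with the
opposite chord. -/
theorem IsChord.not_uniqueInc {n : ℕ} (hn : 3 ≤ n) {s : NC n} {i j : ℤ} (h : IsChord s i j)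
    (hj : j ≠ i + 1) : ¬UniqueInc s := by
  have hn' : 2 ≤ n := by omega
  obtain ⟨h1, h2, -⟩ := id h
  rintro ⟨-, t, -, h4⟩
  obtain ⟨u, hu⟩ := exists_chord hn' (i := j) (j := i + ((n : ℤ) - 1)) (by omega) (by omega)
  have hv := isSpoke_spoke hn' (i + 1)
  have e1 := h4 u ⟨hu.rk hn', h.inc_opposite hn' hu⟩
  have e2 := h4 _ ⟨hv.rk hn', h.inc_spoke hn' hv (by omega) (by omega)⟩
  exact hu.ne_spoke hn' hv (e1.trans e2.symm)

/-- The condition n ≠ 4 is essential here. For n = 3 all chords are sides and a spoke is compatible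
with every atom. For n ≥ 5 at least two chords skip over p_i, but for n = 4 only ((p_{i-1} p_{i+1}))
does. -/
theorem IsSpoke.not_uniqueInc {n : ℕ} (hn : 3 ≤ n) (hn4 : n ≠ 4) {s : NC n} {i : ℤ}
    (h : IsSpoke s i) : ¬UniqueInc s := by
  have hn' : 2 ≤ n := by omega
  rintro ⟨-, t, ⟨ht, hi⟩, h4⟩
  by_cases hn3 : n = 3
  · rcases atom_cases hn' ht with ⟨k, l, hk⟩ | ⟨k, hk⟩
    · obtain ⟨h1, h2, -⟩ := id hk
      obtain rfl : l = k + 1 := by omega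
      exact hi.symm.2 (hk.side_comp hn (h.rk hn') hi.1.symm fun hc => hc.ne_spoke hn' h rfl)
    · exact hi.2 (h.comp hn' hk hi.1)
  · obtain ⟨u, hu⟩ := exists_chord hn' (i := i - 1) (j := i + 1) (by omega) (by omega)
    obtain ⟨v, hv⟩ := exists_chord hn' (i := i - 1) (j := i + 2) (by omega) (by omega)
    have e1 := h4 u ⟨hu.rk hn', (hu.inc_spoke hn' h (by omega) (by omega)).symm⟩
    have e2 := h4 v ⟨hv.rk hn', (hv.inc_spoke hn' h (by omega) (by omega)).symm⟩
    have p1 := pos_ne hn' (j := i + 1) (k := i + 2) (by omega) (by omega)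
    have p2 := pos_ne hn' hv.1 (by omega)
    have p3 := pos_ne_neg hn' (j := i - 1) (k := i + 2) (by omega) (by omega)
    have p4 := pos_ne_zero hn' (i - 1)
    have := (root_pos hn' hu.1 hu.2.1).paired_inj (root_pos hn' hv.1 hv.2.1)
      (by rw [← hu.2.2, ← hv.2.2, e1, e2])
    omega

theorem uniqueInc_iff {n : ℕ} (hn : 3 ≤ n) (hn4 : n ≠ 4) {s : NC n} :
    UniqueInc s ↔ ∃ i, IsChord s i (i + 1) := by
  refine ⟨fun h => ?_, fun ⟨i, h⟩ => h.uniqueInc hn⟩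
  rcases atom_cases (by omega) h.1 with ⟨i, j, hc⟩ | ⟨i, hs⟩
  · by_cases hj : j = i + 1
    · exact ⟨i, hj ▸ hc⟩
    · exact absurd h (hc.not_uniqueInc hn hj)
  · exact absurd h (hs.not_uniqueInc hn hn4)

/-- A spoke forms triples only with the two sides at its end p_i, so three distinct sides cannot
occur. -/
theorem IsSpoke.spokeLike {n : ℕ} (hn : 3 ≤ n) (hn4 : n ≠ 4) {s : NC n} {i : ℤ}
    (h : IsSpoke s i) : SpokeLike s := by
  have hn' : 2 ≤ n := by omega
  refine ⟨h.rk hn', h.not_uniqueInc hn hn4, fun t ht => ?_, ?_⟩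
  · obtain ⟨k, hk⟩ := (uniqueInc_iff hn hn4).mp ht
    exact (hk.side_comp hn (h.rk hn') (hk.ne_spoke hn' h) fun hc => hc.ne_spoke hn' h rfl).symm
  · rintro ⟨t₁, t₂, t₃, ⟨a1, a2, a3⟩, ⟨b1, b2, b3⟩, ⟨u₁, c1⟩, ⟨u₂, c2⟩, u₃, c3⟩
    have d : ∀ t u, UniqueInc t → Tri s t u → IsChord t i (i + 1) ∨ IsChord t (i - 1) i := by
      intro t u ht hu
      obtain ⟨k, hk⟩ := (uniqueInc_iff hn hn4).mp ht
      exact hu.side_of_spoke hn h hk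
    rcases d _ _ b1 c1 with d1 | d1 <;> rcases d _ _ b2 c2 with d2 | d2 <;>
      rcases d _ _ b3 c3 with d3 | d3
    all_goals first
      | exact a1 (d1.eq d2)
      | exact a2 (d1.eq d3)
      | exact a3 (d2.eq d3)

/-- A side has a unique incompatible atom. A chord whose opposite is a side is incompatible with
that side. Any other chord forms triples with three distinct sides: it can be lengthened at either
end and shortened at one. -/
theorem IsChord.not_spokeLike {n : ℕ} (hn : 3 ≤ n) {s : NC n} {i j : ℤ}
    (h : IsChord s i j) : ¬SpokeLike s := by
  have hn' : 2 ≤ n := by omega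
  rintro ⟨-, h1, h2, h3⟩
  obtain ⟨c1, c2, -⟩ := id h
  have hj : j ≠ i + 1 := fun e => h1 (IsChord.uniqueInc hn (e ▸ h))
  by_cases hj' : i + ((n : ℤ) - 1) = j + 1
  · obtain ⟨t, ht⟩ := exists_chord hn' (i := j) (j := j + 1) (by omega) (by omega)
    exact (h.inc_opposite hn' (hj' ▸ ht)).2 (h2 t (ht.uniqueInc hn))
  obtain ⟨t₁, d1⟩ := exists_chord hn' (i := i - 1) (j := i) (by omega) (by omega)
  obtain ⟨t₂, d2⟩ := exists_chord hn' (i := i) (j := i + 1) (by omega) (by omega)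
  obtain ⟨t₃, d3⟩ := exists_chord hn' (i := j) (j := j + 1) (by omega) (by omega)
  obtain ⟨u₁, e1⟩ := exists_chord hn' (i := i - 1) (j := j) (by omega) (by omega)
  obtain ⟨u₂, e2⟩ := exists_chord hn' (i := i + 1) (j := j) (by omega) (by omega)
  obtain ⟨u₃, e3⟩ := exists_chord hn' (i := i) (j := j + 1) (by omega) (by omega)
  have q : ∀ (k l : ℤ) (t t' : NC n), IsChord t k (k + 1) → IsChord t' l (l + 1) → k < l →
      l < k + ((n : ℤ) - 1) → t ≠ t' := by
    intro k l t t' ht ht' hkl hlk e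
    have p1 := pos_ne hn' hkl (by omega)
    have p2 := pos_ne_neg hn' (by omega) hlk
    have p3 := pos_ne hn' (j := k) (k := l + 1) (by omega) (by omega)
    have := (root_pos hn' ht.1 ht.2.1).paired_inj (root_pos hn' ht'.1 ht'.2.1)
      (by rw [← ht.2.2, ← ht'.2.2, e])
    have p4 := pos_ne hn' (j := l) (k := k + 1 + ((n : ℤ) - 1)) (by omega) (by omega)
    rw [pos_add hn'] at p4
    omega
  have d1' : IsChord t₁ (i - 1) (i - 1 + 1) := by rwa [sub_add_cancel]
  exact h3 ⟨t₁, t₂, t₃, ⟨q _ _ _ _ d1' d2 (by omega) (by omega), q _ _ _ _ d1' d3 (by omega) (by omega),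
    q _ _ _ _ d2 d3 (by omega) (by omega)⟩, ⟨d1'.uniqueInc hn, d2.uniqueInc hn, d3.uniqueInc hn⟩,
    ⟨u₁, (tri_chords hn' d1 h e1).swap₁₂⟩, ⟨u₂, (tri_chords hn' d2 e2 h).swap₂₃.swap₁₂⟩,
    ⟨u₃, tri_chords hn' h d3 e3⟩⟩

theorem exists_spoke_map {n : ℕ} (hn : 3 ≤ n) (hn4 : n ≠ 4) (ψ : NC n ≃o NC n) {s : NC n} {i : ℤ}
    (h : IsSpoke s i) : ∃ j, IsSpoke (ψ s) j := by
  have hn' : 2 ≤ n := by omega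
  have h1 := (h.spokeLike hn hn4).map hn' ψ
  rcases atom_cases hn' h1.1 with ⟨i, j, hc⟩ | hs
  · exact absurd h1 (hc.not_spokeLike hn)
  · exact hs

/-- Two spokes that form a triple with a side are adjacent. -/
theorem Tri.adjacent {n : ℕ} (hn : 2 ≤ n) {s t u : NC n} {i j k : ℤ} (h : Tri s t u)
    (hs : IsSpoke s i) (ht : IsSpoke t j) (hu : IsChord u k (k + 1)) :
    pos n j = pos n (i + 1) ∨ pos n j = pos n (i - 1) := by
  obtain ⟨hR, e⟩ := h.spokes_eq hn hs ht
  rw [hu.2.2] at e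
  have hsg := (isSigned_cox hn).1
  rw [← cox_pos n i]
  have hi : pos n i = cox n (pos n (i - 1)) := by rw [cox_pos, sub_add_cancel]
  have hk := cox_pos n k
  have inj := (cox n).injective
  rcases (root_pos hn hu.1 hu.2.1).paired_inj hR e with
    ⟨a, b⟩ | ⟨a, b⟩ | ⟨a, b⟩ | ⟨a, b⟩
  · left; rw [← a, hk, b]
  · right; apply inj; rw [← hi, ← b, ← a, hk]
  · left
    rw [show pos n i = -pos n k by omega, hsg, hk]
    omega
  · right
    apply inj
    rw [← hi, show pos n j = -pos n k by omega, hsg, hk]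
    omega

/-- An automorphism that fixes two adjacent spokes is trivial. -/
theorem eq_one_of_fix_spokes {n : ℕ} (hn : 3 ≤ n) (hn4 : n ≠ 4) {ψ : NC n ≃o NC n}
    (hn' : 2 ≤ n) (h0 : ψ (spoke hn' 0) = spoke hn' 0) (h1 : ψ (spoke hn' 1) = spoke hn' 1) :
    ψ = 1 := by
  -- Induction around the cycle: the image of spoke k + 2 is a neighbour of the fixed spoke k + 1,
  -- and it is not spoke k, which is already the image of itself.
  have hk : ∀ k : ℕ, ψ (spoke hn' k) = spoke hn' k ∧ ψ (spoke hn' (k + 1)) = spoke hn' (k + 1) := by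
    intro k
    induction k with
    | zero => exact ⟨h0, h1⟩
    | succ k ih =>
      push_cast
      refine ⟨ih.2, ?_⟩
      obtain ⟨u, hu⟩ := exists_chord hn' (i := (k : ℤ) + 1) (j := (k : ℤ) + 1 + 1) (by omega)
        (by omega)
      have ht := (tri_spokes hn' (isSpoke_spoke hn' _) (isSpoke_spoke hn' _) hu).map hn' ψ
      obtain ⟨j, hj⟩ := exists_spoke_map hn hn4 ψ (isSpoke_spoke hn' ((k : ℤ) + 1 + 1))
      obtain ⟨l, hl⟩ := (uniqueInc_iff hn hn4).mp ((hu.uniqueInc hn).map hn' ψ)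
      rw [ih.2] at ht
      rcases ht.adjacent hn' (isSpoke_spoke hn' _) hj hl with e | e
      · exact (hj.congr e.symm).eq_spoke hn'
      · exfalso
        rw [add_sub_cancel_right] at e
        have := (hj.congr e.symm).eq_spoke hn'
        rw [← ih.1] at this
        have := congrArg Subtype.val (ψ.injective this)
        have p := pos_ne_last hn' (k : ℤ)
        have p' := pos_ne hn' (j := (k : ℤ)) (k := (k : ℤ) + 1 + 1) (by omega) (by omega)
        have := (root_last hn' _).paired_inj (root_last hn' _) this
        omega
  have hs : ∀ i, ψ (spoke hn' i) = spoke hn' i := by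
    intro i
    obtain ⟨k, h1, h2, h3⟩ := (isSpoke_spoke hn' i).normalize hn' 0
    lift k to ℕ using h1
    rw [h3.eq_spoke hn']
    exact (hk k).1
  refine eq_one_of_fix_atoms hn' fun s hsr => ?_
  rcases atom_cases hn' hsr with ⟨i, j, hc⟩ | ⟨i, hi⟩
  · have ht := (tri_spokes hn' (isSpoke_spoke hn' i) (isSpoke_spoke hn' j) hc).map hn' ψ
    rw [hs, hs] at ht
    exact Subtype.ext ((ht.spokes_eq hn' (isSpoke_spoke hn' i) (isSpoke_spoke hn' j)).2.trans
      hc.2.2.symm)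
  · rw [hi.eq_spoke hn', hs]

/-! ### Bipartitions of the Coxeter element -/

/-- The reversal of [a, b] is ((a b))((a+1 b-1))⋯; k only bounds the length of the interval for the
induction. -/
theorem exists_reversal (n k : ℕ) (a b : ℤ) (ha : 1 ≤ a) (hb : b ≤ n) (hk : b - a < k) :
    ∃ g ∈ W n, ∀ x, 1 ≤ x → g x = if a ≤ x ∧ x ≤ b then a + b - x else x := by
  induction k generalizing a b with
  | zero =>
    refine ⟨1, one_mem _, fun x _ => ?_⟩
    rw [if_neg (by omega)]
    rfl
  | succ k ih =>
    by_cases hab : a < b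
    · obtain ⟨g, hg, h⟩ := ih (a + 1) (b - 1) (by omega) (by omega) (by omega)
      have hR : Root n a b := by
        refine ⟨?_, ?_, ?_, ?_, ?_, ?_⟩ <;> first | omega | (rw [abs_of_pos (by omega)]; omega)
      refine ⟨paired a b * g, mul_mem hR.mem hg, fun x hx => ?_⟩
      rw [Equiv.Perm.mul_apply, h x hx, hR.apply]
      split_ifs <;> omega
    · refine ⟨1, one_mem _, fun x _ => ?_⟩
      rw [Equiv.Perm.one_apply]
      split_ifs <;> omega

theorem perm_ext_pos {g h : Equiv.Perm ℤ} (hg : ∀ x, g (-x) = -g x) (hh : ∀ x, h (-x) = -h x)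
    (H : ∀ x, 1 ≤ x → g x = h x) : g = h := by
  ext x
  rcases lt_trichotomy x 0 with h0 | rfl | h0
  · have := H (-x) (by omega)
    rw [hg, hh] at this
    omega
  · have h1 := hg 0
    have h2 := hh 0
    rw [neg_zero] at h1 h2
    omega
  · exact H x (by omega)

/-- Take for l the reversal x ↦ n - x of 1, …, n - 1 that fixes n. It inverts c, so r = lc is an
involution as well. -/
theorem exists_isBipartition {n : ℕ} (hn : 3 ≤ n) : ∃ l r : Equiv.Perm ℤ, IsBipartition n l r := by
  have hn' : 2 ≤ n := by omega
  obtain ⟨l, hl, h⟩ := exists_reversal n n 1 ((n : ℤ) - 1) le_rfl (by omega) (by omega)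
  have ls := (isSigned_of_mem hl).1
  have cs := isSigned_cox hn'
  have hl2 : l * l = 1 := by
    refine perm_ext_pos (fun x => by simp only [Equiv.Perm.mul_apply, ls]) (fun x => rfl)
      fun x hx => ?_
    rw [Equiv.Perm.mul_apply, h x hx, Equiv.Perm.one_apply, h]
    · split_ifs <;> omega
    · split_ifs <;> omega
  have hr2 : l * cox n * (l * cox n) = 1 := by
    refine perm_ext_pos (fun x => by simp only [Equiv.Perm.mul_apply, ls, cs.1]) (fun x => rfl)
      fun x hx => ?_
    simp only [Equiv.Perm.mul_apply, Equiv.Perm.one_apply]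
    rcases lt_trichotomy x ((n : ℤ) - 1) with hx' | rfl | hx'
    · rw [cox_apply hn' hx hx', h (x + 1) (by omega), if_pos (by omega),
        cox_apply hn' (k := 1 + ((n : ℤ) - 1) - (x + 1)) (by omega) (by omega),
        h (1 + ((n : ℤ) - 1) - (x + 1) + 1) (by omega), if_pos (by omega)]
      ring
    · rw [cox_apply_pred hn', ls, h _ le_rfl, if_pos (by omega), cs.1,
        show 1 + ((n : ℤ) - 1) - 1 = n - 1 by ring, cox_apply_pred hn', neg_neg, h _ le_rfl,
        if_pos (by omega)]
      ring
    · rcases eq_or_lt_of_le (show (n : ℤ) ≤ x by omega) with rfl | hx''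
      · rw [cox_apply_self hn', ls, h _ hx, if_neg (by omega), cs.1, cox_apply_self hn', neg_neg,
          h _ hx, if_neg (by omega)]
      · have e := cs.2 x (by rw [abs_of_pos (by omega)]; exact hx'')
        rw [e, h _ hx, if_neg (by omega), e, h _ hx, if_neg (by omega)]
  exact ⟨l, l * cox n, hl, mul_mem hl (cox_mem hn'), hl2, hr2, by rw [← mul_assoc, hl2, one_mul]⟩

theorem IsBipartition.left_cox {n : ℕ} {l r : Equiv.Perm ℤ} (h : IsBipartition n l r) (x : ℤ) :
    cox n (l (cox n x)) = l x := by
  have h1 := h.conj_left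
  rw [mul_inv_eq_iff_eq_mul] at h1
  have h2 := congrArg (fun g : Equiv.Perm ℤ => g (cox n x)) h1
  simp only [Equiv.Perm.mul_apply] at h2
  rw [perm_inv_apply] at h2
  exact h2.symm

theorem IsBipartition.left_left {n : ℕ} {l r : Equiv.Perm ℤ} (h : IsBipartition n l r) (x : ℤ) :
    l (l x) = x := by
  rw [← Equiv.Perm.mul_apply, h.left_sq, Equiv.Perm.one_apply]

/-- From clc = l it follows that c negates l(n). On the long cycle c moves by one step while
negation is n - 1 ≥ 2 steps, so l(n) is not there. -/
theorem IsBipartition.left_last {n : ℕ} (hn : 3 ≤ n) {l r : Equiv.Perm ℤ}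
    (h : IsBipartition n l r) : l n = n ∨ l n = -n := by
  have hn' : 2 ≤ n := by omega
  have ls := isSigned_of_mem h.left_mem
  have h1 := h.left_cox n
  rw [cox_apply_self hn', ls.1, (isSigned_cox hn').1] at h1
  have h2 := ls.ne_zero (x := n) (by omega)
  have h3 := ls.abs_le (x := n) (by rw [abs_of_pos (by omega)])
  by_contra hc
  obtain ⟨i, -, -, hi⟩ := exists_pos hn' 0 h2 (by
    rcases abs_cases (l n) with h4 | h4 <;> omega)
  rw [← hi, cox_pos] at h1
  exact pos_ne_neg hn' (j := i + 1) (k := i) (by omega) (by omega) (by omega)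

/-- l preserves the long cycle and inverts c, which shifts the indices by one; so l reflects the
indices. -/
theorem IsBipartition.exists_left_pos {n : ℕ} (hn : 3 ≤ n) {l r : Equiv.Perm ℤ}
    (h : IsBipartition n l r) : ∃ κ, ∀ k, l (pos n k) = pos n (κ - k) := by
  have hn' : 2 ≤ n := by omega
  have ls := isSigned_of_mem h.left_mem
  have h2 := ls.ne_zero (pos_ne_zero hn' 0)
  have h3 := ls.abs_le (x := pos n 0) (by have := abs_pos_le hn' 0; omega)
  have h4 : l (pos n 0) ≠ n ∧ l (pos n 0) ≠ -n := by
    have p := pos_ne_last hn' 0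
    have e := h.left_left (pos n 0)
    have e2 := ls.1 n
    constructor <;> intro hc <;> rw [hc] at e <;> rcases h.left_last hn with h5 | h5 <;> omega
  obtain ⟨κ, -, -, hκ⟩ := exists_pos hn' 0 h2 (by
    rcases abs_cases (l (pos n 0)) with h4 | h4 <;> omega)
  refine ⟨κ, fun k => ?_⟩
  induction k with
  | zero => rw [sub_zero, hκ]
  | succ k ih =>
    apply (cox n).injective
    rw [← cox_pos, h.left_cox, ih, cox_pos]
    congr 1
    ring
  | pred k ih =>
    rw [← h.left_cox, cox_pos, sub_add_cancel, ih, cox_pos]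
    congr 1
    ring

/-! ### The action of `D*` on the spokes -/

theorem exists_phiL_spoke {n : ℕ} (hn : 3 ≤ n) (hn' : 2 ≤ n) {l r : Equiv.Perm ℤ}
    (h : IsBipartition n l r) : ∃ κ, ∀ i, phiL h (spoke hn' i) = spoke hn' (κ - i) := by
  obtain ⟨κ, hκ⟩ := h.exists_left_pos hn
  have key : ∀ i, (phiL h (spoke hn' i)).1 = paired (pos n (κ - i)) (l n) := fun i => by
    rw [coe_phiL]
    change l * (paired (pos n i) n)⁻¹ * l = _
    have hl : l⁻¹ = l := inv_eq_of_mul_eq_one_left h.left_sq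
    have := conj_paired l (isSigned_of_mem h.left_mem).1 (pos n i) n
    rw [hl, hκ] at this
    rw [(root_last hn' i).inv, this]
  rcases h.left_last hn with h1 | h1
  -- If l negates n, the sign is moved to the other entry, where it is a half turn of the index.
  · exact ⟨κ, fun i => IsSpoke.eq_spoke hn' (by rw [IsSpoke, key, h1])⟩
  · refine ⟨κ + ((n : ℤ) - 1), fun i => IsSpoke.eq_spoke hn' ?_⟩
    have p := pos_ne_last hn' (κ - i)
    rw [IsSpoke, key, h1, pos_add' hn' (show κ + ((n : ℤ) - 1) - i = (κ - i) + ((n : ℤ) - 1) by ring),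
      ← paired_neg _ _ (pos_ne_zero hn' _) (by omega) (by omega) (by omega), neg_neg]

theorem phiL_mul_self {n : ℕ} {l r : Equiv.Perm ℤ} (h : IsBipartition n l r) :
    phiL h * phiL h = 1 := by
  refine RelIso.ext fun w => Subtype.ext ?_
  have hl : l⁻¹ = l := inv_eq_of_mul_eq_one_left h.left_sq
  rw [RelIso.mul_apply, coe_phiL, coe_phiL]
  change l * (l * w.1⁻¹ * l)⁻¹ * l = w.1
  rw [mul_inv_rev, mul_inv_rev, inv_inv, hl, ← mul_assoc, h.left_sq, one_mul, mul_assoc, h.left_sq,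
    mul_one]

/-- r sends n to ±n, hence commutes with [n], and φ_r and φ_n are commuting involutions. -/
theorem phiR_phiN_mul_self {n : ℕ} (hn : 3 ≤ n) (hn' : 2 ≤ n) {l r : Equiv.Perm ℤ}
    (h : IsBipartition n l r) : (phiR h * phiN hn') * (phiR h * phiN hn') = 1 := by
  have hr : r⁻¹ = r := inv_eq_of_mul_eq_one_left h.right_sq
  have rs := (isSigned_of_mem h.right_mem).1
  have e : r = l * cox n := by rw [← h.mul_eq, ← mul_assoc, h.left_sq, one_mul]
  have rn : r n = n ∨ r n = -n := by
    rw [e, Equiv.Perm.mul_apply, cox_apply_self hn', (isSigned_of_mem h.left_mem).1]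
    rcases h.left_last hn with h1 | h1 <;> omega
  have hb : r * balanced n * r = balanced n := by
    have : r * balanced n * r⁻¹ = balanced n := by
      rw [balanced, Equiv.mul_swap_eq_swap_mul, mul_inv_cancel_right, rs]
      rcases rn with h1 | h1 <;> rw [h1]
      rw [neg_neg, Equiv.swap_comm]
    rwa [hr] at this
  refine RelIso.ext fun w => Subtype.ext ?_
  simp only [RelIso.mul_apply, coe_phiR, coe_phiN]
  change _ = w.1
  have hbi := balanced_inv (n : ℤ)
  simp only [mul_inv_rev, inv_inv, hr, hbi]
  calc r * (balanced n * (r * (balanced n * w.1 * balanced n) * r) * balanced n) * r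
      = (r * balanced n * r) * balanced n * w.1 * (balanced n * (r * balanced n * r)) := by group
    _ = w.1 := by rw [hb, balanced_sq, one_mul, mul_one]

/-- The product `c [n]`, a cycle of length `2 (n - 1)`. -/
def rot (n : ℕ) : Equiv.Perm ℤ := cox n * balanced n

theorem rot_neg {n : ℕ} (hn : 2 ≤ n) (x : ℤ) : rot n (-x) = -rot n x := by
  rw [rot, Equiv.Perm.mul_apply, Equiv.Perm.mul_apply, (balanced_signed hn).1, (isSigned_cox hn).1]

theorem rot_pos {n : ℕ} (hn : 2 ≤ n) (k : ℤ) : rot n (pos n k) = pos n (k + 1) := by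
  rw [rot, Equiv.Perm.mul_apply, balanced,
    Equiv.swap_apply_of_ne_of_ne (pos_ne_last hn k).1 (pos_ne_last hn k).2, cox_pos]

theorem rot_last {n : ℕ} (hn : 2 ≤ n) : rot n n = n := by
  rw [rot, Equiv.Perm.mul_apply, balanced, Equiv.swap_apply_left, (isSigned_cox hn).1,
    cox_apply_self hn, neg_neg]

/-- The rotation `φ_l ∘ φ_r ∘ φ_n`. -/
def rho {n : ℕ} (hn : 2 ≤ n) {l r : Equiv.Perm ℤ} (h : IsBipartition n l r) : NC n ≃o NC n :=
  phiL h * (phiR h * phiN hn)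

/-- The inversions in φ_l and φ_r cancel, which leaves conjugation by lr[n] = c[n]. -/
theorem coe_rho {n : ℕ} (hn : 2 ≤ n) {l r : Equiv.Perm ℤ} (h : IsBipartition n l r) (w : NC n) :
    (rho hn h w).1 = rot n * w.1 * (rot n)⁻¹ := by
  have hr : r⁻¹ = r := inv_eq_of_mul_eq_one_left h.right_sq
  have hl : l⁻¹ = l := inv_eq_of_mul_eq_one_left h.left_sq
  simp only [rho, RelIso.mul_apply, coe_phiL, coe_phiR, coe_phiN, rot, ← h.mul_eq, mul_inv_rev,
    inv_inv, hr, hl, balanced_inv]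
  group

theorem coe_rho_pow {n : ℕ} (hn : 2 ≤ n) {l r : Equiv.Perm ℤ} (h : IsBipartition n l r) (k : ℕ)
    (w : NC n) : ((rho hn h ^ k) w).1 = rot n ^ k * w.1 * (rot n ^ k)⁻¹ := by
  induction k with
  | zero => simp
  | succ k ih =>
    rw [pow_succ', RelIso.mul_apply, coe_rho, ih, pow_succ']
    group

theorem rot_pow_pos {n : ℕ} (hn : 2 ≤ n) (j : ℕ) (k : ℤ) : (rot n ^ j) (pos n k) = pos n (k + j) := by
  induction j with
  | zero => simp
  | succ j ih =>
    rw [pow_succ', Equiv.Perm.mul_apply, ih, rot_pos hn]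
    congr 1
    push_cast
    ring

theorem rot_pow_eq_one {n : ℕ} (hn : 2 ≤ n) : rot n ^ (2 * (n - 1)) = 1 := by
  have hneg : ∀ (j : ℕ) x, (rot n ^ j) (-x) = -(rot n ^ j) x := fun j => by
    induction j with
    | zero => intro x; rfl
    | succ j ih =>
      intro x
      rw [pow_succ', Equiv.Perm.mul_apply, ih, rot_neg hn, Equiv.Perm.mul_apply]
  refine perm_ext_pos (hneg _) (fun _ => rfl) fun x hx => ?_
  rw [Equiv.Perm.one_apply]
  have hfix : rot n x = x → (rot n ^ (2 * (n - 1))) x = x := fun h => by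
    generalize 2 * (n - 1) = j
    induction j with
    | zero => rfl
    | succ j ih => rw [pow_succ', Equiv.Perm.mul_apply, ih, h]
  rcases lt_trichotomy x n with h | rfl | h
  · obtain ⟨k, -, -, rfl⟩ := exists_pos hn 0 (a := x) (by omega) (by rw [abs_of_pos (by omega)]; omega)
    rw [rot_pow_pos hn]
    have e : ((2 * (n - 1) : ℕ) : ℤ) = 2 * ((n : ℤ) - 1) := by omega
    rw [e]
    exact pos_periodic hn k
  · exact hfix (rot_last hn)
  · refine hfix ?_
    rw [rot, Equiv.Perm.mul_apply, (balanced_signed hn).2 x (by rwa [abs_of_pos (by omega)]),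
      (isSigned_cox hn).2 x (by rwa [abs_of_pos (by omega)])]

theorem rho_spoke {n : ℕ} (hn : 2 ≤ n) {l r : Equiv.Perm ℤ} (h : IsBipartition n l r) (i : ℤ) :
    rho hn h (spoke hn i) = spoke hn (i + 1) := by
  refine Subtype.ext ?_
  rw [coe_rho]
  change rot n * paired (pos n i) n * (rot n)⁻¹ = paired (pos n (i + 1)) n
  rw [conj_paired _ (rot_neg hn), rot_pos hn, rot_last hn]

theorem rho_zpow_spoke {n : ℕ} (hn : 2 ≤ n) {l r : Equiv.Perm ℤ} (h : IsBipartition n l r)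
    (k i : ℤ) : (rho hn h ^ k) (spoke hn i) = spoke hn (i + k) := by
  induction k generalizing i with
  | zero => simp
  | succ k ih =>
    rw [zpow_add, zpow_one, RelIso.mul_apply, rho_spoke, ih]
    congr 1
    ring
  | pred k ih =>
    have e : spoke hn i = rho hn h (spoke hn (i - 1)) := by rw [rho_spoke, sub_add_cancel]
    rw [e, ← RelIso.mul_apply, ← zpow_add_one, sub_add_cancel, ih]
    congr 1
    ring

theorem spoke_eq_iff {n : ℕ} (hn : 2 ≤ n) {i j : ℤ} :
    spoke hn i = spoke hn j ↔ pos n i = pos n j := by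
  refine ⟨fun h => ?_, fun h => Subtype.ext (by simp only [spoke, h])⟩
  have p := pos_ne_last hn i
  have := (root_last hn i).paired_inj (root_last hn j) (congrArg Subtype.val h)
  omega

/-- The order divides that of c[n]; conversely, a power that fixes spoke 0 has exponent divisible by
the number 2(n - 1) of spokes. -/
theorem orderOf_rho {n : ℕ} (hn : 2 ≤ n) {l r : Equiv.Perm ℤ} (h : IsBipartition n l r) :
    orderOf (rho hn h) = 2 * (n - 1) := by
  refine Nat.dvd_antisymm (orderOf_dvd_of_pow_eq_one ?_) ?_
  · refine RelIso.ext fun w => Subtype.ext ?_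
    rw [coe_rho_pow, rot_pow_eq_one hn, one_mul, inv_one, mul_one]
    rfl
  · have h1 := rho_zpow_spoke hn h (orderOf (rho hn h) : ℕ) 0
    rw [zpow_natCast, pow_orderOf_eq_one, RelIso.one_apply, spoke_eq_iff] at h1
    have h2 := dvd_of_pos_eq hn h1.symm
    have e : ((2 * (n - 1) : ℕ) : ℤ) = 2 * ((n : ℤ) - 1) := by omega
    rw [← e, zero_add, sub_zero] at h2
    exact_mod_cast h2

/-! ### Dihedral groups -/

/-- A group generated by two involutions whose product has order `N > 2` is dihedral. -/
theorem nonempty_mulEquiv_dihedral {G : Type*} [Group G] {x z : G} {N : ℕ} (hx : x * x = 1)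
    (hz : z * z = 1) (ho : orderOf (x * z) = N) (hN : 2 < N) :
    Nonempty (Subgroup.closure {x, z} ≃* DihedralGroup N) := by
  have : NeZero N := ⟨by omega⟩
  set ρ := x * z with hρ
  have hxi : x⁻¹ = x := inv_eq_of_mul_eq_one_left hx
  have hzi : z⁻¹ = z := inv_eq_of_mul_eq_one_left hz
  let e : ZMod N → G := fun i => ρ ^ i.val
  have e_add : ∀ i j, e i * e j = e (i + j) := fun i j => by
    simp only [e]
    have h1 := pow_mod_orderOf ρ (i.val + j.val)
    rw [ho] at h1
    rw [← pow_add, ZMod.val_add, h1]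
  have e_zero : e 0 = 1 := by simp [e]
  have e_neg : ∀ i, e (-i) = (e i)⁻¹ := fun i => by
    rw [eq_inv_iff_mul_eq_one, e_add, neg_add_cancel, e_zero]
  have xρ : x * ρ * x = ρ⁻¹ := by
    rw [hρ, mul_inv_rev, hxi, hzi, ← mul_assoc, hx, one_mul]
  have x_e : ∀ i, x * e i * x = e (-i) := fun i => by
    have h1 := conj_pow (i := i.val) (a := x) (b := ρ)
    rw [hxi, xρ, inv_pow] at h1
    rw [e_neg]
    exact h1.symm
  have e_x : ∀ i, e i * x = x * e (-i) := fun i => by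
    rw [← x_e, ← mul_assoc, ← mul_assoc, hx, one_mul]
  have e_inj : Function.Injective e := fun i j hij => by
    refine ZMod.val_injective N (pow_injOn_Iio_orderOf ?_ ?_ hij) <;> rw [ho] <;>
      exact ZMod.val_lt _
  -- If x were a power of ρ, it would commute with ρ while also inverting it, so ρ² = 1, against N >
  -- 2.
  have x_ne : ∀ i, e i ≠ x := fun i hi => by
    have h1 : ρ * x = x * ρ := by
      rw [← hi]
      exact (pow_mul_comm' ρ i.val).symm
    have h2 : ρ * ρ = 1 := by
      rw [← h1, mul_assoc, hx, mul_one] at xρ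
      nth_rewrite 2 [xρ]
      exact mul_inv_cancel ρ
    have h3 := Nat.le_of_dvd (by norm_num) (orderOf_dvd_of_pow_eq_one ((sq ρ).trans h2))
    omega
  let F : DihedralGroup N → G := fun d => match d with
    | .r i => e i
    | .sr i => x * e i
  let f : DihedralGroup N →* G :=
    { toFun := F
      map_one' := e_zero
      map_mul' := by
        rintro (i | i) (j | j)
        · rw [DihedralGroup.r_mul_r]
          exact (e_add i j).symm
        · rw [DihedralGroup.r_mul_sr]
          change x * e (j - i) = e i * (x * e j)
          rw [← mul_assoc, e_x, mul_assoc, e_add, sub_eq_neg_add]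
        · rw [DihedralGroup.sr_mul_r]
          change x * e (i + j) = x * e i * e j
          rw [mul_assoc, e_add]
        · rw [DihedralGroup.sr_mul_sr]
          change e (j - i) = x * e i * (x * e j)
          rw [← mul_assoc, x_e, e_add, sub_eq_neg_add] }
  have f_inj : Function.Injective f := by
    rintro (i | i) (j | j) h
    · exact congrArg DihedralGroup.r (e_inj h)
    · exfalso
      have h1 : e i = x * e j := h
      refine x_ne (i - j) ?_
      rw [sub_eq_add_neg, ← e_add, e_neg, h1, mul_inv_cancel_right]
    · exfalso
      have h1 : x * e i = e j := h
      refine x_ne (j - i) ?_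
      rw [sub_eq_add_neg, ← e_add, e_neg, ← h1, mul_inv_cancel_right]
    · have h1 : x * e i = x * e j := h
      exact congrArg DihedralGroup.sr (e_inj (mul_left_cancel h1))
  have hrange : f.range = Subgroup.closure {x, z} := by
    have hxc : x ∈ Subgroup.closure {x, z} := Subgroup.subset_closure (by simp)
    have hzc : z ∈ Subgroup.closure {x, z} := Subgroup.subset_closure (by simp)
    apply le_antisymm
    · rintro _ ⟨i | i, rfl⟩
      · exact pow_mem (mul_mem hxc hzc) _
      · exact mul_mem hxc (pow_mem (mul_mem hxc hzc) _)
    · rw [Subgroup.closure_le]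
      rintro y (rfl | rfl)
      · refine ⟨.sr 0, ?_⟩
        change y * e 0 = y
        rw [e_zero, mul_one]
      · refine ⟨.sr 1, ?_⟩
        change x * e 1 = y
        have : e 1 = ρ := by
          have : Fact (1 < N) := ⟨by omega⟩
          simp only [e]
          rw [ZMod.val_one, pow_one]
        rw [this, hρ, ← mul_assoc, hx, one_mul]
  exact ⟨((MonoidHom.ofInjective f_inj).trans (MulEquiv.subgroupCongr hrange)).symm⟩

/-! ### D* is dihedral, and is the full automorphism group for n ≠ 4 -/

theorem nonempty_dStar_mulEquiv {n : ℕ} (hn : 3 ≤ n) (hn' : 2 ≤ n) {l r : Equiv.Perm ℤ}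
    (h : IsBipartition n l r) : Nonempty (DStar hn' h ≃* DihedralGroup (2 * (n - 1))) :=
  nonempty_mulEquiv_dihedral (phiL_mul_self h) (phiR_phiN_mul_self hn hn' h) (orderOf_rho hn' h)
    (by omega)

theorem phiL_mem {n : ℕ} (hn : 2 ≤ n) {l r : Equiv.Perm ℤ} (h : IsBipartition n l r) :
    phiL h ∈ DStar hn h := Subgroup.subset_closure (by simp)

theorem rho_mem {n : ℕ} (hn : 2 ≤ n) {l r : Equiv.Perm ℤ} (h : IsBipartition n l r) :
    rho hn h ∈ DStar hn h :=
  mul_mem (phiL_mem hn h) (Subgroup.subset_closure (by simp))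

/-- A rotation brings the image of spoke 0 back to spoke 0; then spoke 1 goes to a neighbour, spoke
1 or spoke -1. In the second case a reflection from D* corrects it, and rigidity on two adjacent
spokes finishes the proof. -/
theorem dStar_eq_top {n : ℕ} (hn : 3 ≤ n) (hn4 : n ≠ 4) (hn' : 2 ≤ n) {l r : Equiv.Perm ℤ}
    (h : IsBipartition n l r) : DStar hn' h = ⊤ := by
  refine (Subgroup.eq_top_iff' _).mpr fun ψ => ?_
  obtain ⟨a, ha⟩ := exists_spoke_map hn hn4 ψ (isSpoke_spoke hn' 0)
  have ha := ha.eq_spoke hn'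
  have hm : ∀ k : ℤ, rho hn' h ^ k ∈ DStar hn' h := fun k => zpow_mem (rho_mem hn' h) k
  set ψ₁ := rho hn' h ^ (-a) * ψ with hψ
  have h0 : ψ₁ (spoke hn' 0) = spoke hn' 0 := by
    rw [hψ, RelIso.mul_apply, ha, rho_zpow_spoke, add_neg_cancel]
  suffices hmem : ψ₁ ∈ DStar hn' h by
    rw [hψ] at hmem
    exact (Subgroup.mul_mem_cancel_left _ (hm _)).mp hmem
  obtain ⟨b, hb⟩ := exists_spoke_map hn hn4 ψ₁ (isSpoke_spoke hn' 1)
  obtain ⟨u, hu⟩ := exists_chord hn' (i := 0) (j := 0 + 1) (by omega) (by omega)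
  have ht := (tri_spokes hn' (isSpoke_spoke hn' 0) (isSpoke_spoke hn' (0 + 1)) hu).map hn' ψ₁
  obtain ⟨k, hk⟩ := (uniqueInc_iff hn hn4).mp ((hu.uniqueInc hn).map hn' ψ₁)
  rw [h0] at ht
  rcases ht.adjacent hn' (isSpoke_spoke hn' 0) hb hk with e | e
  · have h1 := (hb.congr e.symm).eq_spoke hn'
    rw [zero_add] at h1
    rw [eq_one_of_fix_spokes hn hn4 hn' h0 h1]
    exact one_mem _
  · have h1 := (hb.congr e.symm).eq_spoke hn'
    rw [zero_sub] at h1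
    obtain ⟨κ, hκ⟩ := exists_phiL_spoke hn hn' h
    -- φ_l acts on the spokes by i ↦ κ - i, so following it by the rotation by -κ gives i ↦ -i.
    have h2 : rho hn' h ^ (-κ) * (phiL h * ψ₁) = 1 := by
      refine eq_one_of_fix_spokes hn hn4 hn' ?_ ?_
      · rw [RelIso.mul_apply, RelIso.mul_apply, h0, hκ, rho_zpow_spoke]
        congr 1
        ring
      · rw [RelIso.mul_apply, RelIso.mul_apply, h1, hκ, rho_zpow_spoke]
        congr 1
        ring
    refine (Subgroup.mul_mem_cancel_left _ (phiL_mem hn' h)).mp ?_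
    refine (Subgroup.mul_mem_cancel_left _ (hm (-κ))).mp ?_
    rw [h2]
    exact one_mem _

/-- This holds for n = 4 too, where it separates D* from the exotic automorphism. -/
theorem exists_spoke_of_mem_dStar {n : ℕ} (hn : 3 ≤ n) (hn' : 2 ≤ n) {l r : Equiv.Perm ℤ}
    (h : IsBipartition n l r) {ψ : NC n ≃o NC n} (hψ : ψ ∈ DStar hn' h) (i : ℤ) :
    ∃ j, ψ (spoke hn' i) = spoke hn' j := by
  have hL : ∀ i, ∃ j, phiL h (spoke hn' i) = spoke hn' j := fun i => by
    obtain ⟨κ, hκ⟩ := exists_phiL_spoke hn hn' h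
    exact ⟨_, hκ i⟩
  have hz : ∀ i, ∃ j, (phiR h * phiN hn') (spoke hn' i) = spoke hn' j := fun i => by
    have e : phiR h * phiN hn' = phiL h * rho hn' h := by
      rw [rho, ← mul_assoc, phiL_mul_self, one_mul]
    rw [e, RelIso.mul_apply, rho_spoke]
    exact hL _
  have hi : ∀ φ : NC n ≃o NC n, φ * φ = 1 → φ⁻¹ = φ := fun φ => inv_eq_of_mul_eq_one_left
  -- The statement includes the inverse so that the induction over the generated subgroup passes
  -- through inverses.
  have key : (∀ i, ∃ j, ψ (spoke hn' i) = spoke hn' j) ∧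
      ∀ i, ∃ j, ψ⁻¹ (spoke hn' i) = spoke hn' j := by
    induction hψ using Subgroup.closure_induction with
    | mem φ hφ =>
      rcases hφ with rfl | rfl
      · rw [hi _ (phiL_mul_self h)]
        exact ⟨hL, hL⟩
      · rw [hi _ (phiR_phiN_mul_self hn hn' h)]
        exact ⟨hz, hz⟩
    | one => exact ⟨fun i => ⟨i, rfl⟩, fun i => ⟨i, by rw [inv_one]; rfl⟩⟩
    | mul a b _ _ ha hb =>
      refine ⟨fun i => ?_, fun i => ?_⟩
      · obtain ⟨j, hj⟩ := hb.1 i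
        rw [RelIso.mul_apply, hj]
        exact ha.1 j
      · obtain ⟨j, hj⟩ := ha.2 i
        rw [mul_inv_rev, RelIso.mul_apply, hj]
        exact hb.2 j
    | inv a _ ha => exact ⟨ha.2, by rw [inv_inv]; exact ha.1⟩
  exact key.1 i

/-! ### The exotic automorphism of `NC(D_4)` -/

/-- An orthogonal involution of the root system of type `D₄` that is not a signed permutation. -/
def spin (x : ℤ → ℚ) : ℤ → ℚ :=
  ((x 1 - x 2 - x 3 - x 4) / 2) • unitVec 1 + ((-x 1 - x 2 - x 3 + x 4) / 2) • unitVec 2 +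
    ((-x 1 - x 2 + x 3 - x 4) / 2) • unitVec 3 + ((-x 1 + x 2 - x 3 - x 4) / 2) • unitVec 4

theorem spin_mem (x : ℤ → ℚ) : spin x ∈ vec 4 := by
  refine add_mem (add_mem (add_mem ?_ ?_) ?_) ?_ <;>
    exact Submodule.smul_mem _ _ (unitVec_mem (by norm_num))

theorem spin_apply (x : ℤ → ℚ) :
    spin x 1 = (x 1 - x 2 - x 3 - x 4) / 2 ∧ spin x 2 = (-x 1 - x 2 - x 3 + x 4) / 2 ∧
      spin x 3 = (-x 1 - x 2 + x 3 - x 4) / 2 ∧ spin x 4 = (-x 1 + x 2 - x 3 - x 4) / 2 := by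
  simp [spin, unitVec_apply]

theorem vec_four_ext {x y : ℤ → ℚ} (hx : x ∈ vec 4) (hy : y ∈ vec 4) (h1 : x 1 = y 1)
    (h2 : x 2 = y 2) (h3 : x 3 = y 3) (h4 : x 4 = y 4) : x = y := by
  rw [← sub_eq_zero]
  refine vec_ext (sub_mem hx hy) fun k hk hk' => ?_
  push_cast at hk'
  have : k = 1 ∨ k = 2 ∨ k = 3 ∨ k = 4 := by omega
  rw [Pi.sub_apply, sub_eq_zero]
  rcases this with rfl | rfl | rfl | rfl <;> assumption

theorem spin_spin {x : ℤ → ℚ} (hx : x ∈ vec 4) : spin (spin x) = x := by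
  obtain ⟨a1, a2, a3, a4⟩ := spin_apply x
  obtain ⟨b1, b2, b3, b4⟩ := spin_apply (spin x)
  refine vec_four_ext (spin_mem _) hx ?_ ?_ ?_ ?_
  · rw [b1, a1, a2, a3, a4]; ring
  · rw [b2, a1, a2, a3, a4]; ring
  · rw [b3, a1, a2, a3, a4]; ring
  · rw [b4, a1, a2, a3, a4]; ring

/-- Conjugation by `spin` carries `w` to `w'`. -/
def SpinConj (w w' : Equiv.Perm ℤ) : Prop :=
  w ∈ W 4 ∧ w' ∈ W 4 ∧ ∀ x ∈ vec 4, ∀ k, spin x (w' k) = spin (fun i => x (w i)) k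

theorem SpinConj.mul {v v' w w' : Equiv.Perm ℤ} (hv : SpinConj v v') (hw : SpinConj w w') :
    SpinConj (v * w) (v' * w') := by
  refine ⟨mul_mem hv.1 hw.1, mul_mem hv.2.1 hw.2.1, fun x hx k => ?_⟩
  rw [Equiv.Perm.mul_apply, hv.2.2 x hx, hw.2.2 _ (vec_comp (isSigned_of_mem hv.1) hx)]
  rfl

theorem SpinConj.inv {w w' : Equiv.Perm ℤ} (hw : SpinConj w w') : SpinConj w⁻¹ w'⁻¹ := by
  refine ⟨inv_mem hw.1, inv_mem hw.2.1, fun x hx k => ?_⟩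
  have h := hw.2.2 _ (vec_comp (isSigned_of_mem (inv_mem hw.1)) hx) (w'⁻¹ k)
  rw [perm_apply_inv] at h
  rw [h]
  simp only [perm_inv_apply]

theorem SpinConj.symm {w w' : Equiv.Perm ℤ} (hw : SpinConj w w') : SpinConj w' w := by
  refine ⟨hw.2.1, hw.1, fun x hx k => ?_⟩
  have h : (fun i => x (w' i)) = spin (fun i => spin x (w i)) := by
    funext i
    rw [← hw.2.2 _ (spin_mem x), spin_spin hx]
  rw [h, spin_spin (vec_comp (isSigned_of_mem hw.1) (spin_mem x))]

/-- `spin` maps `vec 4` onto itself and W(D_4) acts faithfully on it. So the conjugate chosen later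
does not depend on the choice. -/
theorem SpinConj.unique {w v v' : Equiv.Perm ℤ} (hv : SpinConj w v) (hv' : SpinConj w v') :
    v = v' := by
  have h : ∀ x ∈ vec 4, ∀ k, x (v k) = x (v' k) := fun x hx k => by
    rw [← spin_spin hx, hv.2.2 _ (spin_mem x), hv'.2.2 _ (spin_mem x)]
  refine mul_inv_eq_one.mp (eq_one_of_fixed (mul_mem hv.2.1 (inv_mem hv'.2.1)) fun x hx =>
    ⟨hx, fun k => ?_⟩)
  rw [Equiv.Perm.mul_apply, h x hx, perm_apply_inv]

theorem spinConj_of_apply {a b a' b' : ℤ} (h : Root 4 a b) (h' : Root 4 a' b')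
    (H : ∀ x ∈ vec 4, spin x (paired a' b' 1) = spin (fun i => x (paired a b i)) 1 ∧
      spin x (paired a' b' 2) = spin (fun i => x (paired a b i)) 2 ∧
      spin x (paired a' b' 3) = spin (fun i => x (paired a b i)) 3 ∧
      spin x (paired a' b' 4) = spin (fun i => x (paired a b i)) 4) :
    SpinConj (paired a b) (paired a' b') := by
  refine ⟨h.mem, h'.mem, fun x hx => ?_⟩
  obtain ⟨h1, h2, h3, h4⟩ := H x hx
  exact fun k => congrFun (vec_four_ext (vec_comp (isSigned_of_mem h'.mem) (spin_mem x))
    (spin_mem _) h1 h2 h3 h4) k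

theorem root_four {a b : ℤ} (h : a ≠ 0 ∧ b ≠ 0 ∧ |a| ≤ 4 ∧ |b| ≤ 4 ∧ a ≠ b ∧ a ≠ -b) :
    Root 4 a b := h

theorem spinConj_exotic : ∀ p ∈ exoticPairs, SpinConj p.1 p.2 := by
  -- The vectors x, `spin x` and the permuted x are replaced by odd functions known only through
  -- four coordinates, which turns each pair into four linear identities.
  have key : ∀ a b a' b' : ℤ, Root 4 a b → Root 4 a' b' → (∀ x : ℤ → ℚ, (∀ i, x (-i) = -x i) →
      (∀ y : ℤ → ℚ, (∀ i, y (-i) = -y i) → y 1 = (x 1 - x 2 - x 3 - x 4) / 2 →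
        y 2 = (-x 1 - x 2 - x 3 + x 4) / 2 → y 3 = (-x 1 - x 2 + x 3 - x 4) / 2 →
        y 4 = (-x 1 + x 2 - x 3 - x 4) / 2 →
      ∀ z : ℤ → ℚ, (∀ i, z i = x (paired a b i)) →
      y (paired a' b' 1) = (z 1 - z 2 - z 3 - z 4) / 2 ∧
      y (paired a' b' 2) = (-z 1 - z 2 - z 3 + z 4) / 2 ∧
      y (paired a' b' 3) = (-z 1 - z 2 + z 3 - z 4) / 2 ∧
      y (paired a' b' 4) = (-z 1 + z 2 - z 3 - z 4) / 2)) →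
      SpinConj (paired a b) (paired a' b') := by
    intro a b a' b' h h' H
    refine spinConj_of_apply h h' fun x hx => ?_
    obtain ⟨a1, a2, a3, a4⟩ := spin_apply x
    obtain ⟨b1, b2, b3, b4⟩ := spin_apply fun i => x (paired a b i)
    rw [b1, b2, b3, b4]
    exact H x hx.1 _ (spin_mem x).1 a1 a2 a3 a4 _ fun i => rfl
  intro p hp
  simp only [exoticPairs, List.mem_cons, List.not_mem_nil, or_false] at hp
  rcases hp with rfl | rfl | rfl | rfl | rfl | rfl | rfl <;>
  · refine key _ _ _ _ (root_four (by norm_num)) (root_four (by norm_num)) ?_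
    intro x hx y hy y1 y2 y3 y4 z hz
    norm_num [hz, paired_apply, hx, hy, y1, y2, y3, y4]
    try ring_nf
    try norm_num

/-- Read in both directions, the seven pairs (five exchanges and two fixed reflections) cover all
twelve reflections of W(D_4). -/
theorem exists_spinConj_refl {t : Equiv.Perm ℤ} (ht : t ∈ refl 4) :
    ∃ t' ∈ refl 4, SpinConj t t' := by
  have key : ∀ p ∈ exoticPairs, ∃ t' ∈ refl 4, SpinConj p.1 t' := fun p hp =>
    ⟨p.2, by
      simp only [exoticPairs, List.mem_cons, List.not_mem_nil, or_false] at hp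
      rcases hp with rfl | rfl | rfl | rfl | rfl | rfl | rfl <;>
        exact (root_four (by norm_num)).mem_refl, spinConj_exotic p hp⟩
  have key' : ∀ p ∈ exoticPairs, ∃ t' ∈ refl 4, SpinConj p.2 t' := fun p hp =>
    ⟨p.1, by
      simp only [exoticPairs, List.mem_cons, List.not_mem_nil, or_false] at hp
      rcases hp with rfl | rfl | rfl | rfl | rfl | rfl | rfl <;>
        exact (root_four (by norm_num)).mem_refl, (spinConj_exotic p hp).symm⟩
  simp only [exoticPairs, List.forall_mem_cons] at key key'
  obtain ⟨k1, k2, k3, k4, k5, k6, k7, -⟩ := key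
  obtain ⟨l1, l2, l3, l4, l5, l6, l7, -⟩ := key'
  have hneg : ∀ i : ℤ, i ≠ 0 → i ≠ 4 → i ≠ -4 → paired i (-4) = paired (-i) 4 := fun i h1 h2 h3 => by
    rw [← paired_neg i (-4) h1 (by norm_num) h3 (by omega), neg_neg]
  obtain ⟨i, j, h1, h2, h3, rfl⟩ := ht
  obtain ⟨h4, h5⟩ := abs_le.mp h3
  push_cast at h4 h5
  have hi : i = 1 ∨ i = 2 ∨ i = 3 := by push_cast at h3; omega
  have hj : j = 1 ∨ j = 2 ∨ j = 3 ∨ j = 4 ∨ j = -1 ∨ j = -2 ∨ j = -3 ∨ j = -4 := by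
    have : j ≠ 0 := by rintro rfl; simp at h2; omega
    omega
  rcases hi with rfl | rfl | rfl <;>
    rcases hj with rfl | rfl | rfl | rfl | rfl | rfl | rfl | rfl <;>
    first
      | (exfalso; norm_num at h2; done)
      | assumption
      | (rw [hneg _ (by norm_num) (by norm_num) (by norm_num)]; assumption)

theorem exists_spinConj {w : Equiv.Perm ℤ} (hw : w ∈ W 4) : ∃ w', SpinConj w w' := by
  induction hw using Subgroup.closure_induction with
  | mem t ht => exact (exists_spinConj_refl ht).imp fun _ h => h.2
  | one => exact ⟨1, one_mem _, one_mem _, fun x _ k => rfl⟩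
  | mul a b _ _ ha hb =>
    obtain ⟨a', ha⟩ := ha
    obtain ⟨b', hb⟩ := hb
    exact ⟨_, ha.mul hb⟩
  | inv a _ ha =>
    obtain ⟨a', ha⟩ := ha
    exact ⟨_, ha.inv⟩

/-- Conjugation carries a shortest word in reflections, letter by letter, to a word of the same
length. -/
theorem SpinConj.absLength_le {w w' : Equiv.Perm ℤ} (h : SpinConj w w') :
    absLength 4 w' ≤ absLength 4 w := by
  obtain ⟨L, hL, hp, hl⟩ := exists_word refl_inv h.1
  have key : ∀ L : List (Equiv.Perm ℤ), (∀ t ∈ L, t ∈ refl 4) →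
      ∃ M : List (Equiv.Perm ℤ), (∀ t ∈ M, t ∈ refl 4) ∧ M.length = L.length ∧
        SpinConj L.prod M.prod := by
    intro L
    induction L with
    | nil => exact fun _ => ⟨[], by simp, rfl, one_mem _, one_mem _, fun x _ k => rfl⟩
    | cons t L ih =>
      intro hL
      obtain ⟨M, hM, hlen, hc⟩ := ih fun s hs => hL s (by simp [hs])
      obtain ⟨t', ht', hct⟩ := exists_spinConj_refl (hL t (by simp))
      refine ⟨t' :: M, ?_, by simp [hlen], by simpa using hct.mul hc⟩
      intro s hs
      rcases List.mem_cons.mp hs with rfl | hs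
      · exact ht'
      · exact hM s hs
  obtain ⟨M, hM, hlen, hc⟩ := key L hL
  rw [hp] at hc
  rw [h.unique hc]
  have := wordLength_le M hM
  simp only [absLength] at *
  omega

theorem SpinConj.absLength_eq {w w' : Equiv.Perm ℤ} (h : SpinConj w w') :
    absLength 4 w' = absLength 4 w := le_antisymm h.absLength_le h.symm.absLength_le

theorem SpinConj.absLE {v v' w w' : Equiv.Perm ℤ} (hv : SpinConj v v') (hw : SpinConj w w')
    (h : AbsLE 4 v w) : AbsLE 4 v' w' := by
  rw [AbsLE, hv.absLength_eq, hw.absLength_eq, (hv.inv.mul hw).absLength_eq]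
  exact h

theorem cox_four : cox 4 = paired 1 2 * (paired 2 3 * (paired 3 4 * paired (-3) 4)) := by
  simp only [cox, show List.range (4 - 1) = [0, 1, 2] from rfl, List.map_cons, List.map_nil,
    List.prod_cons, List.prod_nil, mul_one, mul_assoc]
  norm_num

/-- Letter by letter, ((1 2))((2 3))((3 4))((-3 4)) becomes ((1 4))((3 4))((2 3))((-1 4)), which is
the inverse of c. Conjugation must therefore be combined with inversion to preserve the interval
below c. -/
theorem spinConj_cox : SpinConj (cox 4) (cox 4)⁻¹ := by
  have h := spinConj_exotic
  simp only [exoticPairs, List.forall_mem_cons] at h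
  obtain ⟨k1, k2, k3, k4, k5, k6, k7, -⟩ := h
  have hc := k1.mul (k2.mul (k2.symm.mul k4.symm))
  rw [← cox_four] at hc
  have R12 : Root 4 1 2 := root_four (by norm_num)
  have R23 : Root 4 2 3 := root_four (by norm_num)
  have R34 : Root 4 3 4 := root_four (by norm_num)
  have R34' : Root 4 (-3) 4 := root_four (by norm_num)
  have e : (cox 4)⁻¹ = paired 1 4 * (paired 3 4 * (paired 2 3 * paired (-1) 4)) := by
    rw [inv_eq_iff_mul_eq_one, cox_four]
    refine perm_ext_pos (fun x => ?_) (fun x => rfl) fun x hx => ?_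
    · simp only [Equiv.Perm.mul_apply, paired_apply_neg, ne_eq, OfNat.ofNat_ne_zero,
        one_ne_zero, neg_eq_zero, not_false_eq_true]
    · simp only [Equiv.Perm.mul_apply, Equiv.Perm.one_apply]
      by_cases hx4 : x ≤ 4
      · have : x = 1 ∨ x = 2 ∨ x = 3 ∨ x = 4 := by omega
        rcases this with rfl | rfl | rfl | rfl <;> norm_num [paired_apply]
      · have hfix : ∀ a b : ℤ, Root 4 a b → paired a b x = x := fun a b h => by
          refine (isSigned_of_mem h.mem).2 x ?_
          rw [abs_of_pos (by omega)]
          push_cast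
          omega
        have R14 : Root 4 1 4 := root_four (by norm_num)
        have R14' : Root 4 (-1) 4 := root_four (by norm_num)
        simp only [hfix _ _ R12, hfix _ _ R23, hfix _ _ R34, hfix _ _ R34', hfix _ _ R14,
          hfix _ _ R14']
  rw [e]
  exact hc

/-- The conjugate of `w` by `spin`. -/
def spinConj {w : Equiv.Perm ℤ} (hw : w ∈ W 4) : Equiv.Perm ℤ := (exists_spinConj hw).choose

theorem spinConj_spec {w : Equiv.Perm ℤ} (hw : w ∈ W 4) : SpinConj w (spinConj hw) :=
  (exists_spinConj hw).choose_spec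

/-- The map `w ↦ g w⁻¹ g⁻¹` of `NC(D_4)`, for `g` the map `spin`. -/
def exoticMap (w : NC 4) : NC 4 :=
  ⟨(spinConj w.2.1)⁻¹, inv_mem (spinConj_spec w.2.1).2.1, by
    have hc := cox_mem (n := 4) (by norm_num)
    have h := absLE_inv (spinConj_spec w.2.1).2.1 (inv_mem hc)
      ((spinConj_spec w.2.1).absLE spinConj_cox w.2.2)
    rwa [inv_inv] at h⟩

theorem exoticMap_eq {v w : NC 4} (h : SpinConj v.1 w.1⁻¹) : exoticMap v = w :=
  Subtype.ext (inv_eq_iff_eq_inv.mpr ((spinConj_spec v.2.1).unique h))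

theorem exoticMap_exoticMap (w : NC 4) : exoticMap (exoticMap w) = w :=
  exoticMap_eq (spinConj_spec w.2.1).inv.symm

theorem exoticMap_mono {v w : NC 4} (h : v ≤ w) : exoticMap v ≤ exoticMap w :=
  absLE_inv (spinConj_spec v.2.1).2.1 (spinConj_spec w.2.1).2.1
    ((spinConj_spec v.2.1).absLE (spinConj_spec w.2.1) h)

/-- The exotic automorphism of `NC(D_4)`. -/
def exotic : NC 4 ≃o NC 4 where
  toFun := exoticMap
  invFun := exoticMap
  left_inv := exoticMap_exoticMap
  right_inv := exoticMap_exoticMap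
  map_rel_iff' := by
    intro v w
    refine ⟨fun h => ?_, exoticMap_mono⟩
    have := exoticMap_mono h
    simpa only [Equiv.coe_fn_mk, exoticMap_exoticMap] using this

theorem exotic_pairs : ∀ p ∈ exoticPairs, ∃ x y : NC 4,
    x.1 = p.1 ∧ y.1 = p.2 ∧ exotic x = y ∧ exotic y = x := by
  intro p hp
  have hR : (∃ a b, Root 4 a b ∧ p.1 = paired a b) ∧ ∃ a b, Root 4 a b ∧ p.2 = paired a b := by
    simp only [exoticPairs, List.mem_cons, List.not_mem_nil, or_false] at hp
    rcases hp with rfl | rfl | rfl | rfl | rfl | rfl | rfl <;>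
      exact ⟨⟨_, _, root_four (by norm_num), rfl⟩, ⟨_, _, root_four (by norm_num), rfl⟩⟩
  obtain ⟨⟨a, b, hab, e1⟩, c, d, hcd, e2⟩ := hR
  have h := spinConj_exotic p hp
  rw [e1, e2] at h ⊢
  have h2 : 2 ≤ 4 := by norm_num
  refine ⟨⟨_, hab.mem, root_le_cox h2 hab⟩, ⟨_, hcd.mem, root_le_cox h2 hcd⟩, rfl, rfl, ?_, ?_⟩
  · exact exoticMap_eq (by rw [hcd.inv]; exact h)
  · exact exoticMap_eq (by rw [hab.inv]; exact h.symm)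

/-- The exotic automorphism takes the spoke ((1 4)) to ((1 2)), which is not a spoke. -/
theorem exotic_notMem {hn : 2 ≤ 4} {l r : Equiv.Perm ℤ} (h : IsBipartition 4 l r) :
    exotic ∉ DStar hn h := by
  intro hm
  obtain ⟨j, hj⟩ := exists_spoke_of_mem_dStar (by norm_num) hn h hm 0
  obtain ⟨x, y, hx, hy, -, hyx⟩ := exotic_pairs (paired 1 2, paired 1 4) (by simp [exoticPairs])
  have e : y = spoke hn 0 := IsSpoke.eq_spoke hn (by
    rw [IsSpoke, hy, pos_eq hn (by norm_num) (by norm_num)]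
    rfl)
  rw [e, hj] at hyx
  have hp := pos_ne_last hn j
  have R12 : Root 4 1 2 := root_four (by norm_num)
  have := (root_last hn j).paired_inj R12 ((congrArg Subtype.val hyx).trans hx)
  omega

theorem orderOf_exotic {hn : 2 ≤ 4} {l r : Equiv.Perm ℤ} (h : IsBipartition 4 l r) :
    orderOf exotic = 2 := by
  refine orderOf_eq_prime ?_ fun h1 => exotic_notMem (hn := hn) h (h1 ▸ one_mem _)
  rw [sq]
  exact RelIso.ext exoticMap_exoticMap

end NCD

end

/-! ### The main theorem -/

theorem mainTheorem3 (n : ℕ) (hn : 3 ≤ n) :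
    (∃ l r : Equiv.Perm ℤ, NCD.IsBipartition n l r) ∧
    ∀ (l r : Equiv.Perm ℤ) (h : NCD.IsBipartition n l r),
      (Nonempty (NCD.DStar (le_of_lt hn) h ≃* DihedralGroup (2 * (n - 1))) ∧
        Nat.card (NCD.DStar (le_of_lt hn) h) = 4 * (n - 1)) ∧
      (n ≠ 4 → NCD.DStar (le_of_lt hn) h = ⊤) ∧
      (n = 4 → NCD.DStar (le_of_lt hn) h < ⊤ ∧
        ∃ ζ : NCD.NC n ≃o NCD.NC n, orderOf ζ = 2 ∧ ζ ∉ NCD.DStar (le_of_lt hn) h ∧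
          ∀ p ∈ NCD.exoticPairs, ∃ x y : NCD.NC n,
            x.1 = p.1 ∧ y.1 = p.2 ∧ ζ x = y ∧ ζ y = x) := by
  refine ⟨NCD.exists_isBipartition hn, fun l r h => ⟨?_, fun h4 => NCD.dStar_eq_top hn h4 _ h, ?_⟩⟩
  · obtain ⟨e⟩ := NCD.nonempty_dStar_mulEquiv hn (le_of_lt hn) h
    refine ⟨⟨e⟩, ?_⟩
    rw [Nat.card_congr e.toEquiv, DihedralGroup.nat_card]
    ring
  · rintro rfl
    refine ⟨lt_top_iff_ne_top.mpr fun ht => ?_, NCD.exotic, NCD.orderOf_exotic (hn := le_of_lt hn) h,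
      NCD.exotic_notMem h, NCD.exotic_pairs⟩
    exact NCD.exotic_notMem h (ht ▸ Subgroup.mem_top _)
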